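/- Let $c\ge 0$, let $\kappa\in\mathbb C$ with $\Re\kappa>0$, $\Im\kappa>0$, and let $\nu\in\mathbb C\setminus\{0\}$. Let $\sqrt{k^2+c^2}$ denote the branch that is analytic off the segment $[-ic,ic]$ and behaves like $k$ as $k\to\infty$, and put $$g_c(x,t;k)=\bigl(2(2k^2-c^2)t+x\bigr)\sqrt{k^2+c^2},\qquad \chi=\chi_1+i\chi_2=\sqrt{\kappa^2+c^2}.$$ Then $\chi_1>0$ and $\chi_2>0$. For $x,t\in\mathbb R$ consider the following Riemann–Hilbert problem: find a $2\times2$ matrix function $M(k)$, meromorphic in $\mathbb C\setminus[-ic,ic]$ with simple poles at $\kappa,\bar\kappa,-\kappa,-\bar\kappa$ and no others, such that 1. $M$ has continuous boundary values $M_\pm$ on the open segment $(ic,-ic)$, oriented from $ic$ to $-ic$ ($M_+$ from $\Re k>0$, $M_-$ from $\Re k<0$), with $M_-=M_+\begin{pmatrix}0&i\\ i&0\end{pmatrix}$, and $M(k)=O(|k\mp ic|^{-1/4})$ as $k\to\pm ic$; 2. $\operatorname{Res}_{p}M=\lim_{k\to p}M(k)N_p(k)$, where $N_{\kappa}=\begin{pmatrix}0&0\\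 i\nu e^{2ig_c}&0\end{pmatrix}$, $N_{-\bar\kappa}=\begin{pmatrix}0&0\\ i\bar\nu e^{2ig_c}&0\end{pmatrix}$, $N_{\bar\kappa}=\begin{pmatrix}0&i\bar\nu e^{-2ig_c}\\0&0\end{pmatrix}$, $N_{-\kappa}=\begin{pmatrix}0&i\nu e^{-2ig_c}\\0&0\end{pmatrix}$, with $g_c=g_c(x,t;k)$; 3. $M(k)=I+O(1/k)$ as $k\to\infty$. This problem has exactly one solution $M(x,t;k)$, and $$q(x,t)=2i\lim_{k\to\infty}kM_{21}(x,t;k)=2i\lim_{k\to\infty}kM_{12}(x,t;k)$$ exists and is real, is a smooth solution of $q_t+6q^2q_x+q_{xxx}=0$ on $\mathbb R^2$, and is given by $$q(x,t)=c+2\,\partial_x\arctan\frac{h(x,t)}{f(x,t)},$$ $$h=|\chi|\cos(2\Re g_c+\theta_1-\theta_2)+\frac{c|\nu|\chi_1^2}{2|\chi|^2\chi_2}e^{-2\Im g_c},$$ $$f=\frac{|\chi|^2}{|\nu|}e^{2\Im g_c}+\frac{\chi_1^2(|\chi|^2-c^2)}{4|\chi|^2\chi_2^2}|\nu|e^{-2\Im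 g_c}+c\sin(2\Re g_c+\theta_1-2\theta_2),$$ where $g_c=g_c(x,t;\kappa)$, that is, $$\Re g_c=\chi_1\bigl(4(\chi_1^2-3\chi_2^2-\tfrac32c^2)t+x\bigr),\qquad \Im g_c=\chi_2\bigl(4(3\chi_1^2-\chi_2^2-\tfrac32c^2)t+x\bigr),$$ $\theta_2=\arccos\frac{\chi_1}{|\chi|}$, and $\theta_1=\arg(i\nu)$ is the angle with $\cos\theta_1=-\frac{\Im\nu}{|\nu|}$, $\sin\theta_1=\frac{\Re\nu}{|\nu|}$ (so $\theta_1=\arccos\frac{-\Im\nu}{|\nu|}$ if $\Re\nu\ge0$). The functions $f,h$ have no common zero, and at the zeros of $f$ the function $\arctan(h/f)$ is continued as a continuous branch of $\arg(f+ih)$, so that everywhere $q=c+2\frac{fh_x-hf_x}{f^2+h^2}$. With $$Z=x+4t(3\chi_1^2-\chi_2^2-\tfrac32c^2),\qquad \varphi=2(Z-8t|\chi|^2)\chi_1+\theta_1-\theta_2,$$ one has equivalently $$h=|\chi|\cos\varphi+\frac{c|\nu|\chi_1^2}{2|\chi|^2\chi_2}e^{-2Z\chi_2},\qquad f=\frac{|\chi|^2}{|\nu|}e^{2Z\chi_2}+\frac{\chi_1^2(|\chi|^2-c^2)}{4|\chi|^2\chi_2^2}|\nu|e^{-2Z\chi_2}+c\sin(\varphi-\theta_2).$$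 The function $q$ is a breather on the constant background $c$ with speed $V=4\chi_2^2+6c^2-12\chi_1^2$: one has $Z=x-Vt$; for every $\xi\in\mathbb R$ the function $t\mapsto q(\xi+Vt,t)$ is periodic with period $\frac{\pi}{8|\chi|^2\chi_1}$; there is a constant $C$ (depending on $c,\kappa,\nu$) with $|q(x,t)-c|\le Ce^{-2\chi_2|x-Vt|}$ for all $x,t$; and $q\not\equiv c$. -/

import Mathlib

open Complex Filter Topology Bornology
open scoped ContDiff

namespace MKdV

noncomputable section

/-- The segment `[ic, -ic]` of the imaginary axis. -/
def slit (c : ℝ) : Set ℂ := {k | k.re = 0 ∧ |k.im| ≤ c}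

/-- The four points `κ, κ̄, -κ, -κ̄` of the discrete spectrum. -/
def spectralPoints (κ : ℂ) : Set ℂ :=
  {κ, starRingEnd ℂ κ, -κ, -starRingEnd ℂ κ}

/-- The branch of `√(k² + c²)` that is analytic off the segment `[ic, -ic]` and behaves like `k`
at infinity: off the segment, `1 + c²/k²` avoids the cut of the principal square root. -/
def sqrtBranch (c : ℝ) (k : ℂ) : ℂ := k * (1 + (c : ℂ) ^ 2 / k ^ 2) ^ (1 / 2 : ℂ)

/-- The phase `g_c(x,t;k) = (2(2k² - c²)t + x) √(k² + c²)`. -/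
def gc (c x t : ℝ) (k : ℂ) : ℂ :=
  (2 * (2 * k ^ 2 - (c : ℂ) ^ 2) * (t : ℂ) + (x : ℂ)) * sqrtBranch c k

/-- The jump matrix. -/
def jumpMatrix : Matrix (Fin 2) (Fin 2) ℂ := !![0, I; I, 0]

/-- The pole condition `Res_p M = lim_{k → p} M(k) N(k)`: both `(k - p) M(k)` and `M(k) N(k)`
converge as `k → p`, to the same matrix. -/
def PoleCondition (M N : ℂ → Matrix (Fin 2) (Fin 2) ℂ) (p : ℂ) : Prop :=
  ∃ L : Matrix (Fin 2) (Fin 2) ℂ,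
    Tendsto (fun k => (k - p) • M k) (𝓝[≠] p) (𝓝 L) ∧
      Tendsto (fun k => M k * N k) (𝓝[≠] p) (𝓝 L)

/-- `M` solves the meromorphic Riemann-Hilbert problem with parameters `c, κ, ν` at `(x,t)`.
The segment is oriented from `ic` to `-ic`, so that its left (`+`) side is `Re k > 0` and its
right (`-`) side is `Re k < 0`. -/
structure IsRHSolution (c : ℝ) (κ ν : ℂ) (x t : ℝ) (M : ℂ → Matrix (Fin 2) (Fin 2) ℂ) :
    Prop where
  analytic : ∀ i j, DifferentiableOn ℂ (fun k => M k i j) (slit c ∪ spectralPoints κ)ᶜ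
  jump : ∀ s : ℝ, |s| < c → ∃ Mplus Mminus : Matrix (Fin 2) (Fin 2) ℂ,
    Tendsto M (𝓝[{k : ℂ | 0 < k.re}] ((s : ℂ) * I)) (𝓝 Mplus) ∧
    Tendsto M (𝓝[{k : ℂ | k.re < 0}] ((s : ℂ) * I)) (𝓝 Mminus) ∧
    Mminus = Mplus * jumpMatrix
  pole_kappa :
    PoleCondition M (fun k => !![0, 0; I * ν * exp (2 * I * gc c x t k), 0]) κ
  pole_neg_conj :
    PoleCondition M (fun k => !![0, 0; I * starRingEnd ℂ ν * exp (2 * I * gc c x t k), 0])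
      (-starRingEnd ℂ κ)
  pole_conj :
    PoleCondition M (fun k => !![0, I * starRingEnd ℂ ν * exp (-2 * I * gc c x t k); 0, 0])
      (starRingEnd ℂ κ)
  pole_neg :
    PoleCondition M (fun k => !![0, I * ν * exp (-2 * I * gc c x t k); 0, 0]) (-κ)
  /-- at most fourth root singularities at the endpoints `±ic` -/
  endpoint_top : ∀ i j, (fun k => M k i j) =O[𝓝[(slit c)ᶜ] ((c : ℂ) * I)]
    (fun k => ‖k - (c : ℂ) * I‖ ^ (-(1 / 4) : ℝ))
  endpoint_bot : ∀ i j, (fun k => M k i j) =O[𝓝[(slit c)ᶜ] (-((c : ℂ) * I))]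
    (fun k => ‖k + (c : ℂ) * I‖ ^ (-(1 / 4) : ℝ))
  asymptotics : ∀ i j, (fun k => M k i j - (1 : Matrix (Fin 2) (Fin 2) ℂ) i j)
    =O[cobounded ℂ] (fun k => k⁻¹)

/-- The number `χ = χ₁ + iχ₂ = √(κ² + c²)`. -/
def chi (c : ℝ) (κ : ℂ) : ℂ := sqrtBranch c κ

/-- The phase `θ₁`: the angle with `cos θ₁ = -Im ν / |ν|` and `sin θ₁ = Re ν / |ν|`. -/
def theta1 (ν : ℂ) : ℝ := arg (I * ν)

/-- The phase `θ₂ = arccos (χ₁ / |χ|)`. -/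
def theta2 (c : ℝ) (κ : ℂ) : ℝ := Real.arccos ((chi c κ).re / ‖chi c κ‖)

/-- The numerator `h`, in terms of `g_c = g_c(x,t;κ)`. -/
def breatherNum (c : ℝ) (κ ν : ℂ) (x t : ℝ) : ℝ :=
  ‖chi c κ‖ * Real.cos (2 * (gc c x t κ).re + theta1 ν - theta2 c κ)
    + c * ‖ν‖ * (chi c κ).re ^ 2 / (2 * ‖chi c κ‖ ^ 2 * (chi c κ).im)
      * Real.exp (-2 * (gc c x t κ).im)

/-- The denominator `f`, in terms of `g_c = g_c(x,t;κ)`. -/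
def breatherDen (c : ℝ) (κ ν : ℂ) (x t : ℝ) : ℝ :=
  ‖chi c κ‖ ^ 2 / ‖ν‖ * Real.exp (2 * (gc c x t κ).im)
    + (chi c κ).re ^ 2 * (‖chi c κ‖ ^ 2 - c ^ 2) / (4 * ‖chi c κ‖ ^ 2 * (chi c κ).im ^ 2) * ‖ν‖
      * Real.exp (-2 * (gc c x t κ).im)
    + c * Real.sin (2 * (gc c x t κ).re + theta1 ν - 2 * theta2 c κ)

/-- The breather `q = c + 2 ∂ₓ arctan (h / f)`. At the points where `f = 0` the function
`arctan (h / f)` is continued as a continuous branch of the argument of `f + i h`; the derivative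
of such a branch is `(f hₓ - h fₓ) / (f² + h²)` everywhere. -/
def breather (c : ℝ) (κ ν : ℂ) (x t : ℝ) : ℝ :=
  c + 2 * ((breatherDen c κ ν x t * deriv (fun y => breatherNum c κ ν y t) x
      - breatherNum c κ ν x t * deriv (fun y => breatherDen c κ ν y t) x)
    / (breatherDen c κ ν x t ^ 2 + breatherNum c κ ν x t ^ 2))

/-- `Z = x + 4t(3χ₁² - χ₂² - (3/2)c²)`. -/
def Z (c : ℝ) (κ : ℂ) (x t : ℝ) : ℝ :=
  x + 4 * t * (3 * (chi c κ).re ^ 2 - (chi c κ).im ^ 2 - 3 / 2 * c ^ 2)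

/-- `φ = 2(Z - 8t|χ|²)χ₁ + θ₁ - θ₂`. -/
def phi (c : ℝ) (κ ν : ℂ) (x t : ℝ) : ℝ :=
  2 * (Z c κ x t - 8 * t * ‖chi c κ‖ ^ 2) * (chi c κ).re + theta1 ν - theta2 c κ

/-- The speed `V = 4χ₂² + 6c² - 12χ₁²`. -/
def speed (c : ℝ) (κ : ℂ) : ℝ :=
  4 * (chi c κ).im ^ 2 + 6 * c ^ 2 - 12 * (chi c κ).re ^ 2

/-- The period `π / (8|χ|²χ₁)` of the oscillation. -/
def period (c : ℝ) (κ : ℂ) : ℝ := Real.pi / (8 * ‖chi c κ‖ ^ 2 * (chi c κ).re)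

end

end MKdV

open MKdV

/-! Existence. Write λ = √(k² + c²) and e^{4θ} = (k - ic)/(k + ic). Crossing the slit from right to
left replaces θ by θ + iπ/2 and λ by -λ, so the matrix with rows (cosh θ, sinh θ), (sinh θ, cosh θ)
has exactly the required jump and fourth root singularities: it is the solution without poles. The
symmetry k ↦ -k decouples the rows (1, i)M and (1, -i)M. Each is sought as the corresponding
background row, with its first entry multiplied by 1 - Y₁/(λ - l₁) - Y₂/(λ - l₂) and its second
entry by the same factor at -λ, where l₁ = χ and l₂ = -χ̄. The jump is preserved, the pole
conditions at -κ and κ̄ follow from those at κ and -κ̄, and the latter form a 2×2 linear system for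
Y₁, Y₂ (`rhRow_isRowSolution`, `exists_linear_system`).

The formula for q. The determinant of this system, for the row with sign σ, is a two-soliton tau
function τ_σ = 1 + S₁ + S₂ + ((l₁ - l₂)/(l₁ + l₂))² S₁S₂, with S₁, S₂ exponential in x and t, and Y₁
+ Y₂ = i ∂ₓ log τ_σ. Complex conjugation exchanges τ₁ and τ₋₁, so the 1/k coefficient of M yields q
= c + 2 ∂ₓ arg τ₁. By `breatherTau_mul`, τ₁ is a positive multiple of f + ih. It never vanishes,
because `breatherDen_mul_eq` writes a positive multiple of f as a sum of two squares, one of them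
nonzero, plus a multiple of h. This also gives solvability of the linear system and smoothness of q.

Uniqueness. For two solutions, M' adj M has no jump, since the jump matrix has determinant 1; its
poles cancel, since the singular column is proportional to the regular one; and its endpoint
singularities are too weak to survive. By Painlevé's and Liouville's theorems it is the identity
(`eq_of_holomorphic_off_slit`).

The equation. τ₁ and τ₋₁ satisfy two Hirota bilinear equations, which are rational identities in two
free exponentials. Together they give q_xx + 2q³ - 2c³ = -P with P_x = q_t, and differentiating once
in x gives mKdV (`mkdv_of_hirota`).

Localization. In the variable y = e^{-2Zχ₂}, the functions yf and yh are polynomials in y with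
bounded coefficients, and q - c turns out to be O(y/(1 + y²)); the lower bound on the denominator
for large y comes again from `breatherDen_mul_eq`. -/

namespace MKdV

/-! ### Gluing across the slit and Liouville's theorem -/

/-- Painlevé's theorem for a segment of a vertical line: a continuous function on an open set that
is holomorphic off the imaginary axis is holomorphic. -/
theorem differentiableOn_of_continuousOn_off_imaginary_axis {f : ℂ → ℂ} {U : Set ℂ}
    (hU : IsOpen U) (hc : ContinuousOn f U)
    (hd : DifferentiableOn ℂ f (U ∩ {k | k.re ≠ 0})) : DifferentiableOn ℂ f U := by
  have hV : IsOpen (U ∩ {k : ℂ | k.re ≠ 0}) :=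
    hU.inter (isOpen_ne_fun continuous_re continuous_const)
  rw [← isConservativeOn_and_continuousOn_iff_isDifferentiableOn hU]
  refine ⟨fun z w hzw => ?_, hc⟩
  rw [← add_eq_zero_iff_eq_neg, wedgeIntegral_add_wedgeIntegral_eq]
  have hzw' : Set.uIcc z.re w.re ×ℂ Set.uIcc z.im w.im ⊆ U := hzw
  -- the rectangle over a range of real parts which does not have `0` in its interior
  have key : ∀ a b : ℝ, Set.uIcc a b ⊆ Set.uIcc z.re w.re →
      (∀ x ∈ Set.Ioo (min a b) (max a b), x ≠ 0) →
      (∫ x : ℝ in a..b, f (x + z.im * I)) - (∫ x : ℝ in a..b, f (x + w.im * I)) +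
        I • (∫ y : ℝ in z.im..w.im, f (b + y * I)) -
        I • (∫ y : ℝ in z.im..w.im, f (a + y * I)) = 0 := by
    intro a b hab h0
    have h := integral_boundary_rect_eq_zero_of_continuousOn_of_differentiableOn f
      (a + z.im * I) (b + w.im * I)
    simp only [add_re, ofReal_re, mul_re, I_re, mul_zero, ofReal_im, I_im, mul_one, sub_self,
      add_zero, add_im, mul_im, zero_add] at h
    refine h (hc.mono fun k hk => hzw' ⟨hab hk.1, hk.2⟩) (hd.mono fun k hk => ⟨hzw' ⟨hab ?_, ?_⟩, ?_⟩)
    · exact Set.Ioo_subset_Icc_self hk.1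
    · exact Set.Ioo_subset_Icc_self hk.2
    · exact h0 _ hk.1
  -- Morera: a rectangle that the imaginary axis crosses is cut along it. Cauchy's theorem applies
  -- to each half, because it needs holomorphy only in the interior and continuity up to the
  -- boundary.
  by_cases h0 : ∀ x ∈ Set.Ioo (min z.re w.re) (max z.re w.re), x ≠ 0
  · exact key z.re w.re subset_rfl h0
  · push Not at h0
    obtain ⟨x, hx, rfl⟩ := h0
    have h0mem : (0 : ℝ) ∈ Set.uIcc z.re w.re := Set.Ioo_subset_Icc_self hx
    have hint : ∀ y ∈ Set.uIcc z.im w.im, ∀ a b : ℝ, Set.uIcc a b ⊆ Set.uIcc z.re w.re →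
        IntervalIntegrable (fun x : ℝ => f (x + y * I)) MeasureTheory.volume a b := by
      intro y hy a b hab
      apply ContinuousOn.intervalIntegrable
      refine hc.comp (by fun_prop) fun x hx => hzw' ⟨?_, ?_⟩
      · simpa using hab hx
      · simpa using hy
    have s1 : Set.uIcc z.re 0 ⊆ Set.uIcc z.re w.re := Set.uIcc_subset_uIcc_left h0mem
    have s2 : Set.uIcc 0 w.re ⊆ Set.uIcc z.re w.re := Set.uIcc_subset_uIcc_right h0mem
    have h1 := key z.re 0 s1 (by
      intro x hx h
      subst h
      rcases le_total z.re 0 with h | h <;> simp [h] at hx)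
    have h2 := key 0 w.re s2 (by
      intro x hx h
      subst h
      rcases le_total 0 w.re with h | h <;> simp [h] at hx)
    rw [← intervalIntegral.integral_add_adjacent_intervals
        (hint _ Set.left_mem_uIcc z.re 0 s1) (hint _ Set.left_mem_uIcc 0 w.re s2),
      ← intervalIntegral.integral_add_adjacent_intervals
        (hint _ Set.right_mem_uIcc z.re 0 s1) (hint _ Set.right_mem_uIcc 0 w.re s2)]
    linear_combination h1 + h2

/-- Removable singularities at finitely many points. -/
theorem exists_entire_extension {f : ℂ → ℂ} {E : Set ℂ} (hE : E.Finite)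
    (hd : DifferentiableOn ℂ f Eᶜ)
    (ho : ∀ p ∈ E, Tendsto (fun k => (k - p) * f k) (𝓝[≠] p) (𝓝 0)) :
    ∃ g : ℂ → ℂ, Differentiable ℂ g ∧ Set.EqOn g f Eᶜ := by
  classical
  refine ⟨fun z => if z ∈ E then limUnder (𝓝[≠] z) f else f z, fun p => ?_, fun z hz => if_neg hz⟩
  have hs : insert p Eᶜ ∈ 𝓝 p := by
    have : (E \ {p})ᶜ ∈ 𝓝 p := (hE.subset Set.sdiff_subset).isClosed.isOpen_compl.mem_nhds (by simp)
    filter_upwards [this] with z hz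
    simp only [Set.mem_compl_iff, Set.mem_sdiff, Set.mem_singleton_iff, not_and, not_not] at hz
    by_cases h : z ∈ E
    · exact Or.inl (hz h)
    · exact Or.inr h
  by_cases hp : p ∈ E
  · have hlo : (fun z => f z - f p) =o[𝓝[≠] p] fun z => (z - p)⁻¹ := by
      rw [Asymptotics.isLittleO_iff_tendsto']
      · have h2 : Tendsto (fun k : ℂ => (k - p) * f p) (𝓝[≠] p) (𝓝 0) := by
          have : Tendsto (fun k : ℂ => (k - p) * f p) (𝓝 p) (𝓝 ((p - p) * f p)) :=
            Continuous.tendsto (by fun_prop) p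
          simpa using this.mono_left nhdsWithin_le_nhds
        have h3 := (ho p hp).sub h2
        rw [sub_zero] at h3
        refine h3.congr fun z => ?_
        rw [div_inv_eq_mul]; ring
      · filter_upwards [self_mem_nhdsWithin] with z hz h
        exact absurd (sub_eq_zero.mp (inv_eq_zero.mp h)) hz
    have H := (differentiableOn_update_limUnder_of_isLittleO hs (hd.mono (by
      intro z hz; exact hz.1.resolve_left hz.2)) hlo).differentiableAt hs
    refine H.congr_of_eventuallyEq ?_
    filter_upwards [hs] with z hz
    by_cases hzp : z = p
    · subst hzp; simp [hp]
    · rw [Function.update_of_ne hzp, if_neg (hz.resolve_left hzp)]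
  · have : Eᶜ ∈ 𝓝 p := hE.isClosed.isOpen_compl.mem_nhds hp
    refine (hd.differentiableAt this).congr_of_eventuallyEq ?_
    filter_upwards [this] with z hz
    exact if_neg hz

/-- Liouville's theorem for functions that are holomorphic off the slit and a finite set, continuous
across the open slit, with removable singularities. -/
theorem eq_of_holomorphic_off_slit {c : ℝ} {f : ℂ → ℂ} {E : Set ℂ} {a : ℂ}
    (hc : 0 ≤ c) (hE : E.Finite) (hE0 : ∀ p ∈ E, p.re ≠ 0)
    (hd : DifferentiableOn ℂ f (slit c ∪ E)ᶜ)
    (hj : ∀ s : ℝ, |s| < c → ∃ L, Tendsto f (𝓝[{k : ℂ | 0 < k.re}] (s * I)) (𝓝 L) ∧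
      Tendsto f (𝓝[{k : ℂ | k.re < 0}] (s * I)) (𝓝 L))
    (hp : ∀ p ∈ E, Tendsto (fun k => (k - p) * f k) (𝓝[≠] p) (𝓝 0))
    (htop : Tendsto (fun k => (k - c * I) * f k) (𝓝[(slit c)ᶜ] (c * I)) (𝓝 0))
    (hbot : Tendsto (fun k => (k + c * I) * f k) (𝓝[(slit c)ᶜ] (-(c * I))) (𝓝 0))
    (hinf : Tendsto f (cobounded ℂ) (𝓝 a)) :
    Set.EqOn f (fun _ => a) (slit c ∪ E)ᶜ := by
  classical
  set D : Set ℂ := {k | k.re ≠ 0} with hD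
  have hDo : IsOpen D := isOpen_ne_fun continuous_re continuous_const
  have hDdense : Dense D := by
    have h : Dense ({0}ᶜ : Set ℝ) := dense_compl_singleton 0
    exact h.preimage isOpenMap_re
  have hDs : D ⊆ (slit c)ᶜ := fun k hk h => hk h.1
  have hne : ∀ k, (𝓝[D] k).NeBot := fun k => mem_closure_iff_nhdsWithin_neBot.mp (hDdense k)
  set E' : Set ℂ := E ∪ {(c : ℂ) * I, -((c : ℂ) * I)} with hE'
  have hE'f : E'.Finite := hE.union (by simp)
  have hso : IsOpen (slit c ∪ E)ᶜ := by
    refine IsClosed.isOpen_compl (self := IsClosed.union ?_ hE.isClosed)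
    exact (isClosed_eq continuous_re continuous_const).inter
      (isClosed_le (continuous_im.abs) continuous_const)
  have hcont : ∀ k ∈ (slit c ∪ E)ᶜ, Tendsto f (𝓝[D] k) (𝓝 (f k)) := fun k hk =>
    ((hd.differentiableAt (hso.mem_nhds hk)).continuousAt.tendsto).mono_left nhdsWithin_le_nhds
  have hlim : ∀ k ∈ E'ᶜ, ∃ L, Tendsto f (𝓝[D] k) (𝓝 L) := by
    intro k hk
    by_cases hks : k ∈ slit c
    · have hkc : |k.im| < c := by
        refine lt_of_le_of_ne hks.2 fun h => hk (Or.inr ?_)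
        have hk' : k = (k.im : ℂ) * I := by apply Complex.ext <;> simp [hks.1]
        rcases abs_choice k.im with h' | h'
        · left; rw [hk', ← h, h']
        · right
          rw [Set.mem_singleton_iff, hk', ← h, h']; simp
      obtain ⟨L, h1, h2⟩ := hj k.im hkc
      have hk' : (k.im : ℂ) * I = k := by apply Complex.ext <;> simp [hks.1]
      rw [hk'] at h1 h2
      refine ⟨L, ?_⟩
      have : D = {k : ℂ | 0 < k.re} ∪ {k : ℂ | k.re < 0} := by
        ext z; simp [hD, lt_or_lt_iff_ne, ne_comm]
      rw [this, nhdsWithin_union]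
      exact h1.sup h2
    · exact ⟨f k, hcont k fun h => h.elim hks fun h => hk (Or.inl h)⟩
  -- The values of `f` on the slit are arbitrary. They are replaced by the common limit from the two
  -- sides, taken along the dense set off the imaginary axis.
  set g := extendFrom D f with hg
  have hgf : Set.EqOn g f (slit c ∪ E)ᶜ := fun k hk => extendFrom_eq (hDdense k) (hcont k hk)
  have hgd : DifferentiableOn ℂ g E'ᶜ := by
    refine differentiableOn_of_continuousOn_off_imaginary_axis hE'f.isClosed.isOpen_compl
      (continuousOn_extendFrom (fun k _ => hDdense k) hlim) ?_
    have hsub : E'ᶜ ∩ D ⊆ (slit c ∪ E)ᶜ := fun k hk h =>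
      h.elim (hDs hk.2) fun h => hk.1 (Or.inl h)
    exact (hd.mono hsub).congr (hgf.mono hsub)
  -- The endpoint estimate is known for `f` off the slit only. Every value of `g` near the endpoint
  -- is a limit of such values of `f`, so it inherits the bound; ε/2 absorbs the loss of strictness
  -- in the limit.
  have hgE : ∀ q : ℂ, Tendsto (fun k => (k - q) * f k) (𝓝[(slit c)ᶜ] q) (𝓝 0) →
      Tendsto (fun k => (k - q) * g k) (𝓝[≠] q) (𝓝 0) := by
    intro q hq
    rw [NormedAddGroup.tendsto_nhds_zero] at hq ⊢
    intro ε hε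
    have h1 := hq (ε / 2) (half_pos hε)
    rw [eventually_nhdsWithin_iff, Metric.eventually_nhds_iff_ball] at h1
    obtain ⟨δ, hδ, h1⟩ := h1
    have h2 : ∀ᶠ k in 𝓝[≠] q, k ∈ E'ᶜ := by
      have : (E' \ {q})ᶜ ∈ 𝓝 q :=
        (hE'f.subset Set.sdiff_subset).isClosed.isOpen_compl.mem_nhds (by simp)
      filter_upwards [nhdsWithin_le_nhds this, self_mem_nhdsWithin] with k hk hkq hkE
      exact hk ⟨hkE, hkq⟩
    filter_upwards [h2, nhdsWithin_le_nhds (Metric.ball_mem_nhds q hδ)] with k hk hkb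
    refine lt_of_le_of_lt ?_ (half_lt_self hε)
    have ht : Tendsto (fun z => ‖(z - q) * f z‖) (𝓝[D] k) (𝓝 ‖(k - q) * g k‖) :=
      (((continuous_id.sub continuous_const).tendsto k).mono_left nhdsWithin_le_nhds |>.mul
        (tendsto_extendFrom (hlim k hk))).norm
    have := hne k
    refine le_of_tendsto ht ?_
    filter_upwards [self_mem_nhdsWithin,
      nhdsWithin_le_nhds (Metric.isOpen_ball.mem_nhds hkb)] with z hz hzb
    exact (h1 z hzb (hDs hz)).le
  obtain ⟨G, hGd, hGg⟩ := exists_entire_extension hE'f hgd (by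
    rintro p (hpE | rfl | rfl)
    · have h := hp p hpE
      refine h.congr' ?_
      have : (E \ {p})ᶜ ∈ 𝓝 p :=
        (hE.subset Set.sdiff_subset).isClosed.isOpen_compl.mem_nhds (by simp)
      filter_upwards [nhdsWithin_le_nhds this, self_mem_nhdsWithin,
        nhdsWithin_le_nhds (hDo.mem_nhds (hE0 p hpE))] with k hk hkp hkD
      rw [hgf]
      exact fun h => h.elim (hDs hkD) fun h => hk ⟨h, hkp⟩
    · exact hgE _ htop
    · exact hgE _ (by simpa using hbot))
  have hbd : Bornology.IsBounded (slit c ∪ E') := by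
    refine Bornology.IsBounded.union ?_ hE'f.isBounded
    refine (Metric.isBounded_closedBall (x := (0 : ℂ)) (r := c)).subset fun k hk => ?_
    rw [mem_closedBall_zero_iff]
    refine (norm_le_abs_re_add_abs_im k).trans ?_
    rw [hk.1]; simpa using hk.2
  have hev : ∀ᶠ k in cobounded ℂ, G k = f k := by
    filter_upwards [isBounded_def.mp hbd] with k hk
    rw [hGg fun h => hk (Or.inr h), hgf fun h => hk (h.imp id Or.inl)]
  intro k hk
  have hGa : ∀ z, G z = a := fun z => hGd.apply_eq_of_tendsto_cocompact z (by
    rw [← Metric.cobounded_eq_cocompact]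
    exact hinf.congr' (hev.mono fun _ h => h.symm))
  have hkE : k ∉ E' := by
    rintro (h | rfl | rfl)
    · exact hk (Or.inr h)
    all_goals exact hk (Or.inl ⟨by simp, by simp [abs_of_nonneg hc]⟩)
  rw [← hgf hk, ← hGg hkE, hGa]

/-! ### The uniformizer θ and the branch λ of √(k² + c²) -/

section

/-- The function `θ` with `k = λ cosh 2θ` and `λ = √(k² + c²)`. -/
noncomputable def uniformizer (c : ℝ) (k : ℂ) : ℂ := 1 / 4 * log ((k - c * I) / (k + c * I))

theorem isClosed_slit (c : ℝ) : IsClosed (slit c) :=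
  (isClosed_eq continuous_re continuous_const).inter
    (isClosed_le (continuous_im.abs) continuous_const)

theorem neg_mem_slit {c : ℝ} {k : ℂ} : -k ∈ slit c ↔ k ∈ slit c := by simp [slit]

theorem conj_mem_slit {c : ℝ} {k : ℂ} : starRingEnd ℂ k ∈ slit c ↔ k ∈ slit c := by simp [slit]

variable {c : ℝ} {k : ℂ}

theorem sub_ne_zero_of_not_mem_slit (hc : 0 ≤ c) (hk : k ∉ slit c) : k - c * I ≠ 0 := by
  intro h
  rw [sub_eq_zero] at h
  exact hk (by simp [slit, h, abs_of_nonneg hc])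

theorem add_ne_zero_of_not_mem_slit (hc : 0 ≤ c) (hk : k ∉ slit c) : k + c * I ≠ 0 := by
  have := sub_ne_zero_of_not_mem_slit hc (mt neg_mem_slit.mp hk)
  intro h
  exact this (by linear_combination -h)

theorem ne_zero_of_not_mem_slit (hc : 0 ≤ c) (hk : k ∉ slit c) : k ≠ 0 := by
  rintro rfl
  exact hk (by simp [slit, hc])

theorem cayley_re (c : ℝ) (k : ℂ) :
    ((k - c * I) / (k + c * I)).re = (k.re ^ 2 + k.im ^ 2 - c ^ 2) / normSq (k + c * I) := by
  rw [div_re]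
  simp
  ring

theorem cayley_im (c : ℝ) (k : ℂ) :
    ((k - c * I) / (k + c * I)).im = -2 * c * k.re / normSq (k + c * I) := by
  rw [div_im]
  simp
  ring

/-- For c > 0 this Möbius map sends the open slit to the negative real axis and the two endpoints to
0 and ∞, so the principal logarithm of the image is holomorphic off the slit. For c = 0 the map is
the constant 1 away from the origin. -/
theorem cayley_mem_slitPlane (hc : 0 ≤ c) (hk : k ∉ slit c) :
    (k - c * I) / (k + c * I) ∈ slitPlane := by
  have hn : 0 < normSq (k + c * I) := normSq_pos.mpr (add_ne_zero_of_not_mem_slit hc hk)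
  rw [mem_slitPlane_iff, cayley_re, cayley_im]
  by_cases h0 : k.re = 0
  · left
    have : c < |k.im| := by
      by_contra h
      exact hk ⟨h0, not_lt.mp h⟩
    have h2 : c ^ 2 < k.im ^ 2 := by
      rw [← sq_abs k.im]; exact pow_lt_pow_left₀ this hc two_ne_zero
    apply div_pos _ hn
    rw [h0]; linarith
  · rcases hc.eq_or_lt with rfl | hc'
    · left
      apply div_pos _ hn
      have := sq_pos_of_ne_zero h0
      nlinarith [sq_nonneg k.im]
    · right
      have : -2 * c ≠ 0 := by linarith
      exact div_ne_zero (mul_ne_zero this h0) hn.ne'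

theorem differentiableAt_uniformizer (hc : 0 ≤ c) (hk : k ∉ slit c) :
    DifferentiableAt ℂ (uniformizer c) k := by
  have h := add_ne_zero_of_not_mem_slit hc hk
  unfold uniformizer
  have hd : DifferentiableAt ℂ (fun k : ℂ => (k - c * I) / (k + c * I)) k :=
    DifferentiableAt.div (by fun_prop) (by fun_prop) h
  exact (hd.clog (cayley_mem_slitPlane hc hk)).const_mul _

theorem exp_two_uniformizer_sq (hc : 0 ≤ c) (hk : k ∉ slit c) :
    exp (2 * uniformizer c k) ^ 2 = (k - c * I) / (k + c * I) := by
  rw [← exp_nat_mul, uniformizer]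
  rw [show ((2 : ℕ) : ℂ) * (2 * (1 / 4 * log ((k - c * I) / (k + c * I))))
    = log ((k - c * I) / (k + c * I)) by push_cast; ring]
  exact exp_log (div_ne_zero (sub_ne_zero_of_not_mem_slit hc hk) (add_ne_zero_of_not_mem_slit hc hk))

theorem exp_two_uniformizer_re_pos (hc : 0 ≤ c) (hk : k ∉ slit c) :
    0 < (exp (2 * uniformizer c k)).re := by
  rw [exp_re]
  refine mul_pos (Real.exp_pos _) (Real.cos_pos_of_mem_Ioo ?_)
  have h := (mem_slitPlane_iff_arg.mp (cayley_mem_slitPlane hc hk)).1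
  have h1 := neg_pi_lt_arg ((k - c * I) / (k + c * I))
  have h2 := lt_of_le_of_ne (arg_le_pi ((k - c * I) / (k + c * I))) h
  have : (2 * uniformizer c k).im = arg ((k - c * I) / (k + c * I)) / 2 := by
    rw [uniformizer, show (2 : ℂ) * (1 / 4 * log ((k - c * I) / (k + c * I)))
      = ((1 / 2 : ℝ) : ℂ) * log ((k - c * I) / (k + c * I)) by push_cast; ring, im_ofReal_mul, log_im]
    ring
  rw [this]
  constructor <;> linarith

theorem eq_of_sq_eq_sq_of_re_pos {x y : ℂ} (h : x ^ 2 = y ^ 2) (hx : 0 < x.re) (hy : 0 ≤ y.re) :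
    x = y := by
  rcases sq_eq_sq_iff_eq_or_eq_neg.mp h with h | h
  · exact h
  · rw [h, neg_re] at hx; linarith

theorem cpow_half_sq (z : ℂ) : (z ^ (1 / 2 : ℂ)) ^ 2 = z := by
  rw [show (1 / 2 : ℂ) = ((2 : ℕ) : ℂ)⁻¹ by norm_num]
  exact cpow_nat_inv_pow z two_ne_zero

theorem cpow_half_re_nonneg (z : ℂ) : 0 ≤ (z ^ (1 / 2 : ℂ)).re := by
  by_cases hz : z = 0
  · subst hz; simp
  rw [cpow_def_of_ne_zero hz, exp_re]
  refine mul_nonneg (Real.exp_pos _).le (Real.cos_nonneg_of_mem_Icc ?_)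
  have h1 := neg_pi_lt_arg z
  have h2 := arg_le_pi z
  have : (log z * (1 / 2)).im = arg z / 2 := by
    rw [show log z * (1 / 2 : ℂ) = ((1 / 2 : ℝ) : ℂ) * log z by push_cast; ring, im_ofReal_mul, log_im]
    ring
  rw [this]
  constructor <;> linarith

theorem sqrtBranch_sq (hk : k ≠ 0) : sqrtBranch c k ^ 2 = k ^ 2 + c ^ 2 := by
  rw [sqrtBranch, mul_pow, cpow_half_sq]
  field_simp

theorem exp_add_inv_re_pos (hc : 0 ≤ c) (hk : k ∉ slit c) :
    0 < (exp (2 * uniformizer c k) + (exp (2 * uniformizer c k))⁻¹).re := by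
  have hre := exp_two_uniformizer_re_pos hc hk
  have := normSq_pos.mpr (exp_ne_zero (2 * uniformizer c k))
  rw [add_re, inv_re]
  positivity

/-- With u = e^{2θ}, the quotient (k + ic)u/k equals 2/(u + u⁻¹), which has positive real part
because u has. So it is the principal square root of 1 + c²/k², and no continuity argument is needed
to match the branches. -/
theorem sqrtBranch_eq (hc : 0 ≤ c) (hk : k ∉ slit c) :
    sqrtBranch c k = (k + c * I) * exp (2 * uniformizer c k) := by
  have h0 := ne_zero_of_not_mem_slit hc hk
  have h1 := add_ne_zero_of_not_mem_slit hc hk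
  have hsq := exp_two_uniformizer_sq hc hk
  set u := exp (2 * uniformizer c k) with hu
  have hu0 : u ≠ 0 := exp_ne_zero _
  have hsum : 0 < (u + u⁻¹).re := exp_add_inv_re_pos hc hk
  have hsum0 : u + u⁻¹ ≠ 0 := fun h => by rw [h] at hsum; simp at hsum
  have key : (k + c * I) * u * (u + u⁻¹) = 2 * k := by
    have h2 : u ^ 2 * (k + c * I) = k - c * I := by rw [hsq]; field_simp
    field_simp
    linear_combination h2
  have h3 : (k + c * I) * u / k = 2 / (u + u⁻¹) := by
    rw [div_eq_div_iff h0 hsum0, key]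
  have h4 : 0 < ((k + c * I) * u / k).re := by
    rw [h3, div_re]
    have := normSq_pos.mpr hsum0
    simp only [re_ofNat, im_ofNat, zero_mul, zero_div, add_zero]
    positivity
  have h5 : ((k + c * I) * u / k) ^ 2 = ((1 + (c : ℂ) ^ 2 / k ^ 2) ^ (1 / 2 : ℂ)) ^ 2 := by
    rw [cpow_half_sq, div_pow, mul_pow, hsq]
    field_simp
    linear_combination (-(c : ℂ) ^ 2) * I_sq
  rw [sqrtBranch, ← eq_of_sq_eq_sq_of_re_pos h5 h4 (cpow_half_re_nonneg _)]
  field_simp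

theorem sqrtBranch_mul_exp_neg (hc : 0 ≤ c) (hk : k ∉ slit c) :
    sqrtBranch c k * exp (-(2 * uniformizer c k)) = k + c * I := by
  rw [sqrtBranch_eq hc hk, mul_assoc, ← exp_add]; simp

theorem sqrtBranch_mul_exp (hc : 0 ≤ c) (hk : k ∉ slit c) :
    sqrtBranch c k * exp (2 * uniformizer c k) = k - c * I := by
  rw [sqrtBranch_eq hc hk, mul_assoc, ← sq, exp_two_uniformizer_sq hc hk]
  have := add_ne_zero_of_not_mem_slit hc hk
  field_simp

theorem sqrtBranch_mul_cosh (hc : 0 ≤ c) (hk : k ∉ slit c) :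
    sqrtBranch c k * cosh (2 * uniformizer c k) = k := by
  rw [cosh]
  linear_combination (sqrtBranch_mul_exp_neg hc hk + sqrtBranch_mul_exp hc hk) / 2

theorem sqrtBranch_mul_sinh (hc : 0 ≤ c) (hk : k ∉ slit c) :
    sqrtBranch c k * sinh (2 * uniformizer c k) = -(c * I) := by
  rw [sinh]
  linear_combination (sqrtBranch_mul_exp hc hk - sqrtBranch_mul_exp_neg hc hk) / 2

theorem sqrtBranch_ne_zero (hc : 0 ≤ c) (hk : k ∉ slit c) : sqrtBranch c k ≠ 0 := by
  rw [sqrtBranch_eq hc hk]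
  exact mul_ne_zero (add_ne_zero_of_not_mem_slit hc hk) (exp_ne_zero _)

theorem differentiableAt_sqrtBranch (hc : 0 ≤ c) (hk : k ∉ slit c) :
    DifferentiableAt ℂ (sqrtBranch c) k := by
  have h : DifferentiableAt ℂ (fun k => (k + c * I) * exp (2 * uniformizer c k)) k :=
    DifferentiableAt.mul (by fun_prop) ((differentiableAt_uniformizer hc hk).const_mul 2).cexp
  refine h.congr_of_eventuallyEq ?_
  filter_upwards [(isClosed_slit c).isOpen_compl.mem_nhds hk] with z hz
  exact sqrtBranch_eq hc hz

theorem uniformizer_neg (hc : 0 ≤ c) (hk : k ∉ slit c) :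
    uniformizer c (-k) = -uniformizer c k := by
  have h := (mem_slitPlane_iff_arg.mp (cayley_mem_slitPlane hc hk)).1
  have : (-k - c * I) / (-k + c * I) = ((k - c * I) / (k + c * I))⁻¹ := by
    rw [inv_div, ← neg_div_neg_eq]; congr 1 <;> ring
  rw [uniformizer, this, log_inv _ h, uniformizer]
  ring

theorem uniformizer_neg_conj (hc : 0 ≤ c) (hk : k ∉ slit c) :
    uniformizer c (-starRingEnd ℂ k) = starRingEnd ℂ (uniformizer c k) := by
  have h := (mem_slitPlane_iff_arg.mp (cayley_mem_slitPlane hc hk)).1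
  have : (-starRingEnd ℂ k - c * I) / (-starRingEnd ℂ k + c * I)
      = starRingEnd ℂ ((k - c * I) / (k + c * I)) := by
    rw [← neg_div_neg_eq]
    simp only [map_div₀, map_sub, map_add, map_mul, conj_I, conj_ofReal]
    congr 1 <;> ring
  rw [uniformizer, this, log_conj _ h, uniformizer]
  simp only [map_mul, map_div₀, map_one, map_ofNat]

theorem sqrtBranch_neg (c : ℝ) (k : ℂ) : sqrtBranch c (-k) = -sqrtBranch c k := by
  simp [sqrtBranch]

theorem sqrtBranch_neg_conj (hc : 0 ≤ c) (hk : k ∉ slit c) :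
    sqrtBranch c (-starRingEnd ℂ k) = -starRingEnd ℂ (sqrtBranch c k) := by
  rw [sqrtBranch_eq hc (by rwa [neg_mem_slit, conj_mem_slit]), sqrtBranch_eq hc hk,
    uniformizer_neg_conj hc hk]
  simp only [map_mul, map_add, conj_I, conj_ofReal, ← exp_conj, map_ofNat]
  ring

/-- Boundary values of the uniformizer on the two sides of the slit. -/
theorem exists_tendsto_uniformizer {s : ℝ} (hs : |s| < c) : ∃ θ : ℂ,
    Tendsto (uniformizer c) (𝓝[{k : ℂ | 0 < k.re}] (s * I)) (𝓝 θ) ∧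
    Tendsto (uniformizer c) (𝓝[{k : ℂ | k.re < 0}] (s * I)) (𝓝 (θ + Real.pi / 2 * I)) := by
  have hc : 0 < c := (abs_nonneg s).trans_lt hs
  obtain ⟨hs1, hs2⟩ := abs_lt.mp hs
  have h0 : (s : ℂ) * I + c * I ≠ 0 := by
    rw [← add_mul]
    refine mul_ne_zero ?_ I_ne_zero
    norm_cast; linarith
  set z : ℂ := ((s : ℂ) * I - c * I) / (s * I + c * I) with hz
  have hn : 0 < normSq ((s : ℂ) * I + c * I) := normSq_pos.mpr h0
  have hre : z.re < 0 := by
    rw [hz, cayley_re]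
    apply div_neg_of_neg_of_pos _ hn
    simp; nlinarith
  have him : z.im = 0 := by rw [hz, cayley_im]; simp
  have hz0 : z ≠ 0 := fun h => by rw [h] at hre; simp at hre
  have hcont : Tendsto (fun k : ℂ => (k - c * I) / (k + c * I)) (𝓝 (s * I)) (𝓝 z) := by
    apply ContinuousAt.div <;> first | fun_prop | exact h0
  refine ⟨1 / 4 * (Real.log ‖z‖ - Real.pi * I), ?_, ?_⟩
  -- The imaginary part of the image has the sign opposite to Re k. The right side of the slit
  -- therefore meets the lower edge of the cut of the logarithm and the left side the upper edge; a
  -- quarter of the difference 2πi is iπ/2.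
  · refine Tendsto.const_mul _ ((tendsto_log_nhdsWithin_im_neg_of_re_neg_of_im_zero hre him).comp ?_)
    refine tendsto_nhdsWithin_iff.mpr ⟨hcont.mono_left nhdsWithin_le_nhds, ?_⟩
    filter_upwards [self_mem_nhdsWithin,
      nhdsWithin_le_nhds (hcont.eventually_ne hz0)] with k hk hk0
    rw [cayley_im]
    have hk1 : k + c * I ≠ 0 := fun h => hk0 (by rw [h, div_zero])
    have := normSq_pos.mpr hk1
    have hk' : 0 < k.re := hk
    apply div_neg_of_neg_of_pos _ this
    nlinarith [mul_pos hc hk']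
  · rw [show 1 / 4 * ((Real.log ‖z‖ : ℂ) - Real.pi * I) + Real.pi / 2 * I
      = 1 / 4 * (Real.log ‖z‖ + Real.pi * I) by ring]
    refine Tendsto.const_mul _
      ((tendsto_log_nhdsWithin_im_nonneg_of_re_neg_of_im_zero hre him).comp ?_)
    refine tendsto_nhdsWithin_iff.mpr ⟨hcont.mono_left nhdsWithin_le_nhds, ?_⟩
    filter_upwards [self_mem_nhdsWithin] with k hk
    rw [cayley_im]
    have hk' : k.re < 0 := hk
    refine div_nonneg ?_ (normSq_nonneg _)
    nlinarith [mul_pos hc (neg_pos.mpr hk')]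

/-- This is the source of the exponent 1/4 at the endpoints: e^{-θ} blows up at ic and e^{θ} at -ic
when c > 0. -/
theorem norm_exp_uniformizer (hc : 0 ≤ c) (hk : k ∉ slit c) :
    ‖exp (uniformizer c k)‖ = (‖k - c * I‖ / ‖k + c * I‖) ^ (1 / 4 : ℝ) := by
  have h0 : 0 < ‖(k - c * I) / (k + c * I)‖ := norm_pos_iff.mpr
    (div_ne_zero (sub_ne_zero_of_not_mem_slit hc hk) (add_ne_zero_of_not_mem_slit hc hk))
  rw [norm_exp, uniformizer, ← norm_div, Real.rpow_def_of_pos h0,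
    show (1 / 4 : ℂ) = ((1 / 4 : ℝ) : ℂ) by push_cast; rfl, re_ofReal_mul, log_re, mul_comm]

theorem isBigO_exp_neg_uniformizer (hc : 0 ≤ c) :
    (fun k => exp (-uniformizer c k)) =O[𝓝[(slit c)ᶜ] (c * I)]
      (fun k => ‖k - c * I‖ ^ (-(1 / 4) : ℝ)) := by
  refine Asymptotics.IsBigO.of_bound ((2 * c + 1) ^ (1 / 4 : ℝ)) ?_
  filter_upwards [self_mem_nhdsWithin,
    nhdsWithin_le_nhds (Metric.ball_mem_nhds ((c : ℂ) * I) one_pos)] with k hk hkb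
  have h1 := norm_pos_iff.mpr (sub_ne_zero_of_not_mem_slit hc hk)
  have h2 := norm_pos_iff.mpr (add_ne_zero_of_not_mem_slit hc hk)
  rw [mem_ball_iff_norm] at hkb
  have h3 : ‖k + c * I‖ ≤ 2 * c + 1 := by
    calc ‖k + c * I‖ = ‖(k - c * I) + 2 * c * I‖ := by congr 1; ring
      _ ≤ ‖k - c * I‖ + ‖(2 * c * I : ℂ)‖ := norm_add_le _ _
      _ ≤ 1 + 2 * c := by
        gcongr
        simp [abs_of_nonneg hc]
      _ = _ := by ring
  rw [Complex.exp_neg, norm_inv, norm_exp_uniformizer hc hk, ← Real.inv_rpow (by positivity), inv_div,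
    Real.norm_of_nonneg (by positivity), Real.rpow_neg h1.le, ← Real.inv_rpow h1.le,
    ← Real.mul_rpow (by positivity) (by positivity)]
  gcongr
  rw [div_eq_mul_inv]
  gcongr

theorem isBigO_exp_uniformizer (hc : 0 ≤ c) :
    (fun k => exp (uniformizer c k)) =O[𝓝[(slit c)ᶜ] (c * I)]
      (fun k => ‖k - c * I‖ ^ (-(1 / 4) : ℝ)) := by
  refine Asymptotics.IsBigO.of_bound 1 ?_
  have hev : ∀ᶠ k : ℂ in 𝓝 (c * I), 0 ≤ c * k.im := by
    rcases hc.eq_or_lt with rfl | hc'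
    · simp
    · have : ∀ᶠ k : ℂ in 𝓝 (c * I), 0 < k.im :=
        continuous_im.continuousAt.eventually (lt_mem_nhds (by simpa using hc'))
      filter_upwards [this] with k hk
      positivity
  filter_upwards [self_mem_nhdsWithin, nhdsWithin_le_nhds hev,
    nhdsWithin_le_nhds (Metric.ball_mem_nhds ((c : ℂ) * I) one_pos)] with k hk him hkb
  have h1 := norm_pos_iff.mpr (sub_ne_zero_of_not_mem_slit hc hk)
  have h2 := norm_pos_iff.mpr (add_ne_zero_of_not_mem_slit hc hk)
  rw [mem_ball_iff_norm] at hkb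
  have h3 : ‖k - c * I‖ ≤ ‖k + c * I‖ := by
    rw [← sq_le_sq₀ (norm_nonneg _) (norm_nonneg _), ← normSq_eq_norm_sq, ← normSq_eq_norm_sq,
      normSq_apply, normSq_apply]
    simp
    nlinarith
  rw [norm_exp_uniformizer hc hk, Real.norm_of_nonneg (by positivity), one_mul]
  calc _ ≤ (1 : ℝ) := Real.rpow_le_one (by positivity) ((div_le_one h2).mpr h3) (by norm_num)
    _ ≤ _ := Real.one_le_rpow_of_pos_of_le_one_of_nonpos h1 hkb.le (by norm_num)

theorem tendsto_sqrtBranch_endpoint {p : ℂ} (hp : p ^ 2 + c ^ 2 = 0) (hc : 0 ≤ c) :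
    Tendsto (sqrtBranch c) (𝓝[(slit c)ᶜ] p) (𝓝 0) := by
  rw [tendsto_zero_iff_norm_tendsto_zero]
  have h : Tendsto (fun k : ℂ => √‖k ^ 2 + c ^ 2‖) (𝓝[(slit c)ᶜ] p) (𝓝 0) := by
    have : Tendsto (fun k : ℂ => √‖k ^ 2 + c ^ 2‖) (𝓝 p) (𝓝 (√‖p ^ 2 + c ^ 2‖)) :=
      Continuous.tendsto (by fun_prop) p
    rw [hp, norm_zero, Real.sqrt_zero] at this
    exact this.mono_left nhdsWithin_le_nhds
  refine h.congr' ?_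
  filter_upwards [self_mem_nhdsWithin] with k hk
  rw [← sqrtBranch_sq (ne_zero_of_not_mem_slit hc hk), norm_pow, Real.sqrt_sq (norm_nonneg _)]

/-- In the coordinate w = 1/k the uniformizer is differentiable at w = 0 with derivative -ic/2; the
claim is the chain rule there. -/
theorem tendsto_mul_comp_uniformizer (c : ℝ) {f : ℂ → ℂ} {f' : ℂ} (hf : HasDerivAt f f' 0) :
    Tendsto (fun k => k * (f (uniformizer c k) - f 0)) (cobounded ℂ) (𝓝 (f' * (-(c * I) / 2))) := by
  set φ : ℂ → ℂ := fun w => 1 / 4 * log ((1 - c * I * w) / (1 + c * I * w)) with hφ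
  have hφ0 : φ 0 = 0 := by simp [hφ]
  have hφd : HasDerivAt φ (-(c * I) / 2) 0 := by
    have h1 : HasDerivAt (fun w : ℂ => 1 - c * I * w) (-(c * I)) 0 := by
      simpa using ((hasDerivAt_id (0 : ℂ)).const_mul (c * I)).const_sub 1
    have h2 : HasDerivAt (fun w : ℂ => 1 + c * I * w) (c * I) 0 := by
      simpa using ((hasDerivAt_id (0 : ℂ)).const_mul (c * I)).const_add 1
    have h3 := ((h1.div h2 (by simp)).clog (by simp)).const_mul (1 / 4 : ℂ)
    refine h3.congr_deriv ?_
    simp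
    ring
  have hd : HasDerivAt (f ∘ φ) (f' * (-(c * I) / 2)) 0 :=
    HasDerivAt.comp 0 (by rwa [hφ0]) hφd
  have h := (hasDerivAt_iff_tendsto_slope.mp hd).comp (tendsto_inv₀_cobounded' (α := ℂ))
  refine h.congr' ?_
  filter_upwards [eventually_ne_cobounded (0 : ℂ)] with k hk
  have hk' : φ k⁻¹ = uniformizer c k := by
    simp only [hφ, uniformizer]
    congr 2
    rw [← mul_div_mul_left _ _ hk]
    congr 1 <;> field_simp
  rw [Function.comp_apply, slope_def_field, Function.comp_apply, Function.comp_apply, hk', hφ0,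
    sub_zero, div_inv_eq_mul, mul_comm]

theorem tendsto_sqrtBranch_div (c : ℝ) :
    Tendsto (fun k => sqrtBranch c k / k) (cobounded ℂ) (𝓝 1) := by
  have h : Tendsto (fun k : ℂ => (1 + (c : ℂ) ^ 2 * k⁻¹ ^ 2) ^ (1 / 2 : ℂ)) (cobounded ℂ) (𝓝 1) := by
    have : ContinuousAt (fun w : ℂ => (1 + (c : ℂ) ^ 2 * w ^ 2) ^ (1 / 2 : ℂ)) 0 :=
      ContinuousAt.cpow (by fun_prop) continuousAt_const (by simp)
    have h := this.tendsto.comp (tendsto_inv₀_cobounded (α := ℂ))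
    simpa [Function.comp_def] using h
  refine h.congr' ?_
  filter_upwards [eventually_ne_cobounded (0 : ℂ)] with k hk
  rw [sqrtBranch, mul_div_cancel_left₀ _ hk, inv_pow, ← div_eq_mul_inv]

/-- The square root maps the first quadrant to itself. -/
theorem sqrtBranch_mem_quadrant (hc : 0 ≤ c) {κ : ℂ} (h1 : 0 < κ.re) (h2 : 0 < κ.im) :
    0 < (sqrtBranch c κ).re ∧ 0 < (sqrtBranch c κ).im := by
  have hκ : κ ≠ 0 := fun h => by simp [h] at h1
  have hsq := sqrtBranch_sq (c := c) hκ
  have him : 0 < (sqrtBranch c κ).re * (sqrtBranch c κ).im := by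
    have := congrArg im hsq
    simp [sq] at this
    nlinarith [mul_pos h1 h2]
  set z := (1 + (c : ℂ) ^ 2 / κ ^ 2) ^ (1 / 2 : ℂ) with hz
  have hκs : κ ∉ slit c := fun h => h1.ne' h.1
  -- Write χ = κz with z the principal root of 1 + c²/κ². Since Im κ² > 0, the number under the root
  -- has Im ≤ 0, so Re z > 0 forces Im z ≤ 0 and Re χ ≥ 0. The sign of Im χ then follows from Re χ ·
  -- Im χ = Re κ · Im κ > 0.
  have hz1 : 0 < z.re := by
    have h3 : z = κ * (κ * cosh (2 * uniformizer c κ))⁻¹ := by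
      have h4 := sqrtBranch_mul_cosh hc hκs
      have h5 : cosh (2 * uniformizer c κ) ≠ 0 := fun h => by rw [h, mul_zero] at h4; exact hκ h4.symm
      rw [sqrtBranch, ← hz] at h4
      field_simp
      exact mul_left_cancel₀ hκ (by linear_combination h4)
    rw [h3, mul_inv, mul_inv_cancel_left₀ hκ, cosh, Complex.exp_neg, inv_re]
    have h4 := exp_add_inv_re_pos hc hκs
    have h5 : 0 < ((exp (2 * uniformizer c κ) + (exp (2 * uniformizer c κ))⁻¹) / 2).re := by
      rw [show (2 : ℂ) = ((2 : ℝ) : ℂ) by norm_num] at h4 ⊢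
      rw [div_ofReal_re]
      positivity
    refine div_pos h5 (normSq_pos.mpr fun h => ?_)
    rw [h] at h5
    simp at h5
  have hz2 : z.re * z.im ≤ 0 := by
    have h3 := congrArg im (cpow_half_sq (1 + (c : ℂ) ^ 2 / κ ^ 2))
    rw [← hz] at h3
    have h4 : (1 + (c : ℂ) ^ 2 / κ ^ 2).im ≤ 0 := by
      rw [add_im, one_im, zero_add, ← ofReal_pow, div_eq_mul_inv, im_ofReal_mul, inv_im]
      have h5 : 0 ≤ (κ ^ 2).im := by simp [sq]; nlinarith [mul_pos h1 h2]
      have := normSq_nonneg (κ ^ 2)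
      rw [neg_div, mul_neg, neg_nonpos]
      positivity
    simp [sq] at h3
    simp [sq] at h4
    nlinarith
  have hre : 0 ≤ (sqrtBranch c κ).re := by
    rw [sqrtBranch, ← hz, mul_re]
    have : z.im ≤ 0 := by
      by_contra h'
      nlinarith [mul_pos hz1 (not_le.mp h')]
    nlinarith
  have hre' : 0 < (sqrtBranch c κ).re := lt_of_le_of_ne hre fun h => by rw [← h] at him; simp at him
  exact ⟨hre', pos_of_mul_pos_right him hre⟩

end

/-! ### Uniqueness for the Riemann-Hilbert problem -/

section

/-- The residue condition controls only the product of the second column with `n`. As `n₀ ≠ 0` it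
can be divided out, which shows that the second column itself converges and that the residue of the
first is `n₀` times this limit. -/
theorem PoleCondition.exists_of_lower {M : ℂ → Matrix (Fin 2) (Fin 2) ℂ} {n : ℂ → ℂ} {p n₀ : ℂ}
    (h : PoleCondition M (fun k => !![0, 0; n k, 0]) p) (hn : Tendsto n (𝓝[≠] p) (𝓝 n₀))
    (hn₀ : n₀ ≠ 0) : ∃ a : Fin 2 → ℂ, ∀ i,
      Tendsto (fun k => (k - p) * M k i 0) (𝓝[≠] p) (𝓝 (n₀ * a i)) ∧
      Tendsto (fun k => M k i 1) (𝓝[≠] p) (𝓝 (a i)) := by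
  obtain ⟨L, h1, h2⟩ := h
  refine ⟨fun i => L i 0 / n₀, fun i => ⟨?_, ?_⟩⟩
  · rw [mul_div_cancel₀ _ hn₀]
    exact tendsto_pi_nhds.mp (tendsto_pi_nhds.mp h1 i) 0
  · have h3 := (tendsto_pi_nhds.mp (tendsto_pi_nhds.mp h2 i) 0).div hn hn₀
    refine h3.congr' ?_
    filter_upwards [hn.eventually_ne hn₀] with k hk
    simp [Matrix.mul_apply, Fin.sum_univ_two, hk]

theorem PoleCondition.exists_of_upper {M : ℂ → Matrix (Fin 2) (Fin 2) ℂ} {n : ℂ → ℂ} {p n₀ : ℂ}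
    (h : PoleCondition M (fun k => !![0, n k; 0, 0]) p) (hn : Tendsto n (𝓝[≠] p) (𝓝 n₀))
    (hn₀ : n₀ ≠ 0) : ∃ a : Fin 2 → ℂ, ∀ i,
      Tendsto (fun k => (k - p) * M k i 1) (𝓝[≠] p) (𝓝 (n₀ * a i)) ∧
      Tendsto (fun k => M k i 0) (𝓝[≠] p) (𝓝 (a i)) := by
  obtain ⟨L, h1, h2⟩ := h
  refine ⟨fun i => L i 1 / n₀, fun i => ⟨?_, ?_⟩⟩
  · rw [mul_div_cancel₀ _ hn₀]
    exact tendsto_pi_nhds.mp (tendsto_pi_nhds.mp h1 i) 1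
  · have h3 := (tendsto_pi_nhds.mp (tendsto_pi_nhds.mp h2 i) 1).div hn hn₀
    refine h3.congr' ?_
    filter_upwards [hn.eventually_ne hn₀] with k hk
    simp [Matrix.mul_apply, Fin.sum_univ_two, hk]

/-- The entries of `M' adj M`, up to sign and order. -/
def rowDet (M' M : ℂ → Matrix (Fin 2) (Fin 2) ℂ) (i j : Fin 2) (k : ℂ) : ℂ :=
  M' k i 0 * M k j 1 - M' k i 1 * M k j 0

/-- In both matrices the polar part of the first column is the same multiple `n₀` of the second
column, so the two contributions to the residue cancel. -/
theorem tendsto_rowDet_of_lower {M M' : ℂ → Matrix (Fin 2) (Fin 2) ℂ} {n : ℂ → ℂ} {p n₀ : ℂ}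
    (h : PoleCondition M (fun k => !![0, 0; n k, 0]) p)
    (h' : PoleCondition M' (fun k => !![0, 0; n k, 0]) p) (hn : Tendsto n (𝓝[≠] p) (𝓝 n₀))
    (hn₀ : n₀ ≠ 0) (i j : Fin 2) :
    Tendsto (fun k => (k - p) * rowDet M' M i j k) (𝓝[≠] p) (𝓝 0) := by
  obtain ⟨a, ha⟩ := h.exists_of_lower hn hn₀
  obtain ⟨a', ha'⟩ := h'.exists_of_lower hn hn₀
  have := ((ha' i).1.mul (ha j).2).sub ((ha' i).2.mul (ha j).1)
  rw [show n₀ * a' i * a j - a' i * (n₀ * a j) = 0 by ring] at this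
  exact this.congr fun k => by rw [rowDet]; ring

theorem tendsto_rowDet_of_upper {M M' : ℂ → Matrix (Fin 2) (Fin 2) ℂ} {n : ℂ → ℂ} {p n₀ : ℂ}
    (h : PoleCondition M (fun k => !![0, n k; 0, 0]) p)
    (h' : PoleCondition M' (fun k => !![0, n k; 0, 0]) p) (hn : Tendsto n (𝓝[≠] p) (𝓝 n₀))
    (hn₀ : n₀ ≠ 0) (i j : Fin 2) :
    Tendsto (fun k => (k - p) * rowDet M' M i j k) (𝓝[≠] p) (𝓝 0) := by
  obtain ⟨a, ha⟩ := h.exists_of_upper hn hn₀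
  obtain ⟨a', ha'⟩ := h'.exists_of_upper hn hn₀
  have := ((ha' i).2.mul (ha j).1).sub ((ha' i).1.mul (ha j).2)
  rw [show a' i * (n₀ * a j) - n₀ * a' i * a j = 0 by ring] at this
  exact this.congr fun k => by rw [rowDet]; ring

/-- The exponent left over is 1 - 1/4 - 1/4 = 1/2 > 0. -/
theorem tendsto_rowDet_endpoint {M M' : ℂ → Matrix (Fin 2) (Fin 2) ℂ} {S : Set ℂ} {p : ℂ}
    (hS : p ∉ S)
    (h : ∀ i j, (fun k => M k i j) =O[𝓝[S] p] (fun k => ‖k - p‖ ^ (-(1 / 4) : ℝ)))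
    (h' : ∀ i j, (fun k => M' k i j) =O[𝓝[S] p] (fun k => ‖k - p‖ ^ (-(1 / 4) : ℝ)))
    (i j : Fin 2) :
    Tendsto (fun k => (k - p) * rowDet M' M i j k) (𝓝[S] p) (𝓝 0) := by
  have h1 : rowDet M' M i j =O[𝓝[S] p]
      (fun k => ‖k - p‖ ^ (-(1 / 4) : ℝ) * ‖k - p‖ ^ (-(1 / 4) : ℝ)) :=
    ((h' i 0).mul (h j 1)).sub ((h' i 1).mul (h j 0))
  have h2 : (fun k => k - p) =O[𝓝[S] p] (fun k => ‖k - p‖) :=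
    Asymptotics.isBigO_norm_right.mpr (Asymptotics.isBigO_refl _ _)
  refine (h2.mul h1).trans_tendsto ?_
  have h3 : Tendsto (fun k : ℂ => ‖k - p‖ ^ (1 / 2 : ℝ)) (𝓝[S] p) (𝓝 0) := by
    have : Tendsto (fun k : ℂ => ‖k - p‖ ^ (1 / 2 : ℝ)) (𝓝 p) (𝓝 (‖p - p‖ ^ (1 / 2 : ℝ))) :=
      ((continuous_id.sub continuous_const).norm.tendsto p).rpow_const (by norm_num)
    rw [sub_self, norm_zero, Real.zero_rpow (by norm_num)] at this
    exact this.mono_left nhdsWithin_le_nhds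
  refine h3.congr' ?_
  filter_upwards [self_mem_nhdsWithin] with k hk
  have : 0 < ‖k - p‖ := norm_pos_iff.mpr (sub_ne_zero.mpr fun h => hS (h ▸ hk))
  nth_rw 2 [← Real.rpow_one ‖k - p‖]
  rw [← Real.rpow_add this, ← Real.rpow_add this]
  norm_num

variable {c : ℝ} {κ ν : ℂ} {x t : ℝ}

theorem spectralPoints_re_ne_zero (hκ : κ.re ≠ 0) {p : ℂ} (hp : p ∈ spectralPoints κ) :
    p.re ≠ 0 := by
  rcases hp with rfl | rfl | rfl | rfl <;> simpa

theorem not_mem_slit_of_re_ne_zero {p : ℂ} (hp : p.re ≠ 0) : p ∉ slit c := fun h => hp h.1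

theorem continuousAt_gc (hc : 0 ≤ c) {p : ℂ} (hp : p ∉ slit c) : ContinuousAt (gc c x t) p := by
  have := (differentiableAt_sqrtBranch hc hp).continuousAt
  unfold gc
  exact ContinuousAt.mul (by fun_prop) this

theorem tendsto_residue_coefficient (hc : 0 ≤ c) {p : ℂ} (hp : p ∉ slit c) (a b : ℂ) :
    Tendsto (fun k => a * exp (b * gc c x t k)) (𝓝[≠] p) (𝓝 (a * exp (b * gc c x t p))) := by
  have := continuousAt_gc (x := x) (t := t) hc hp
  have h : ContinuousAt (fun k => a * exp (b * gc c x t k)) p := by fun_prop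
  exact h.tendsto.mono_left nhdsWithin_le_nhds

theorem spectralPoints_finite (κ : ℂ) : (spectralPoints κ).Finite := by
  simp [spectralPoints]

theorem IsRHSolution.tendsto_one {M : ℂ → Matrix (Fin 2) (Fin 2) ℂ}
    (h : IsRHSolution c κ ν x t M) (i j : Fin 2) :
    Tendsto (fun k => M k i j) (cobounded ℂ) (𝓝 ((1 : Matrix (Fin 2) (Fin 2) ℂ) i j)) := by
  have h1 := (h.asymptotics i j).trans_tendsto (tendsto_inv₀_cobounded (α := ℂ))
  simpa using h1.add_const ((1 : Matrix (Fin 2) (Fin 2) ℂ) i j)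

theorem IsRHSolution.rowDet_eqOn (hc : 0 ≤ c) (hκ : κ.re ≠ 0) (hν : ν ≠ 0)
    {M M' : ℂ → Matrix (Fin 2) (Fin 2) ℂ} (h : IsRHSolution c κ ν x t M)
    (h' : IsRHSolution c κ ν x t M') (i j : Fin 2) :
    Set.EqOn (rowDet M' M i j) (fun _ => (1 : Matrix (Fin 2) (Fin 2) ℂ) i 0 *
      (1 : Matrix (Fin 2) (Fin 2) ℂ) j 1 - (1 : Matrix (Fin 2) (Fin 2) ℂ) i 1 *
      (1 : Matrix (Fin 2) (Fin 2) ℂ) j 0) (slit c ∪ spectralPoints κ)ᶜ := by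
  have hI : ∀ z : ℂ, z ≠ 0 → ∀ w, I * z * exp w ≠ 0 := fun z hz w =>
    mul_ne_zero (mul_ne_zero I_ne_zero hz) (exp_ne_zero _)
  have hν' : starRingEnd ℂ ν ≠ 0 := (map_ne_zero _).mpr hν
  have hsp : ∀ p ∈ spectralPoints κ, p ∉ slit c := fun p hp =>
    not_mem_slit_of_re_ne_zero (spectralPoints_re_ne_zero hκ hp)
  refine eq_of_holomorphic_off_slit hc (spectralPoints_finite κ)
    (fun p hp => spectralPoints_re_ne_zero hκ hp) ?_ ?_ ?_ ?_ ?_ ?_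
  · exact ((h'.analytic i 0).mul (h.analytic j 1)).sub ((h'.analytic i 1).mul (h.analytic j 0))
  · intro s hs
    obtain ⟨P, N, h1, h2, h3⟩ := h.jump s hs
    obtain ⟨P', N', h1', h2', h3'⟩ := h'.jump s hs
    have e : ∀ {l : Filter ℂ} {A : ℂ → Matrix (Fin 2) (Fin 2) ℂ} {B : Matrix (Fin 2) (Fin 2) ℂ},
        Tendsto A l (𝓝 B) → ∀ i j, Tendsto (fun k => A k i j) l (𝓝 (B i j)) :=
      fun hA i j => tendsto_pi_nhds.mp (tendsto_pi_nhds.mp hA i) j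
    refine ⟨P' i 0 * P j 1 - P' i 1 * P j 0,
      ((e h1' i 0).mul (e h1 j 1)).sub ((e h1' i 1).mul (e h1 j 0)), ?_⟩
    have := ((e h2' i 0).mul (e h2 j 1)).sub ((e h2' i 1).mul (e h2 j 0))
    -- The jump matrix has determinant -i² = 1, so these 2×2 minors are continuous across the slit.
    have e2 : N' i 0 * N j 1 - N' i 1 * N j 0 = P' i 0 * P j 1 - P' i 1 * P j 0 := by
      rw [h3, h3']
      simp only [Matrix.mul_apply, Fin.sum_univ_two, jumpMatrix]
      simp
      linear_combination (P' i 1 * P j 0 - P' i 0 * P j 1) * I_sq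
    rw [← e2]
    exact this
  · rintro p hp
    have hps := hsp p hp
    rcases hp with rfl | rfl | rfl | rfl
    · exact tendsto_rowDet_of_lower h.pole_kappa h'.pole_kappa
        (tendsto_residue_coefficient hc hps _ _) (hI _ hν _) i j
    · exact tendsto_rowDet_of_upper h.pole_conj h'.pole_conj
        (tendsto_residue_coefficient hc hps _ _) (hI _ hν' _) i j
    · exact tendsto_rowDet_of_upper h.pole_neg h'.pole_neg
        (tendsto_residue_coefficient hc hps _ _) (hI _ hν _) i j
    · exact tendsto_rowDet_of_lower h.pole_neg_conj h'.pole_neg_conj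
        (tendsto_residue_coefficient hc hps _ _) (hI _ hν' _) i j
  · exact tendsto_rowDet_endpoint (by simp [slit, abs_of_nonneg hc])
      h.endpoint_top h'.endpoint_top i j
  · have := tendsto_rowDet_endpoint (S := (slit c)ᶜ) (p := -((c : ℂ) * I)) (M := M) (M' := M')
      (by simp [slit, abs_of_nonneg hc]) (by simpa using h.endpoint_bot)
      (by simpa using h'.endpoint_bot) i j
    simpa using this
  · exact ((h'.tendsto_one i 0).mul (h.tendsto_one j 1)).sub
      ((h'.tendsto_one i 1).mul (h.tendsto_one j 0))

/-- The minors of M against itself give det M = 1, and those of M' against M give M' adj M = I.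
Equality can hold only off the slit and the poles, where the conditions do not see the values of M.
-/
theorem IsRHSolution.eqOn (hc : 0 ≤ c) (hκ : κ.re ≠ 0) (hν : ν ≠ 0)
    {M M' : ℂ → Matrix (Fin 2) (Fin 2) ℂ} (h : IsRHSolution c κ ν x t M)
    (h' : IsRHSolution c κ ν x t M') : Set.EqOn M M' (slit c ∪ spectralPoints κ)ᶜ := by
  intro k hk
  have hdet := h.rowDet_eqOn hc hκ hν h 0 1 hk
  have h0 := fun i => h.rowDet_eqOn hc hκ hν h' i 0 hk
  have h1 := fun i => h.rowDet_eqOn hc hκ hν h' i 1 hk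
  simp only [rowDet] at hdet h0 h1
  have h00 := h0 0
  have h01 := h0 1
  have h10 := h1 0
  have h11 := h1 1
  simp at hdet h00 h01 h10 h11
  ext i j
  fin_cases i <;> fin_cases j <;> simp
  · linear_combination M' k 0 0 * hdet - M k 0 0 * h10 + M k 1 0 * h00
  · linear_combination M' k 0 1 * hdet - M k 0 1 * h10 + M k 1 1 * h00
  · linear_combination M' k 1 0 * hdet - M k 0 0 * h11 + M k 1 0 * h01
  · linear_combination M' k 1 1 * hdet - M k 0 1 * h11 + M k 1 1 * h01

end

/-! ### Building blocks: background rows multiplied by rational functions of λ -/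

section

/-- The function `θ ↦ cosh θ + σ i sinh θ`. -/
noncomputable def hypOne (σ θ : ℂ) : ℂ := cosh θ + σ * I * sinh θ

/-- The function `θ ↦ sinh θ + σ i cosh θ`. -/
noncomputable def hypTwo (σ θ : ℂ) : ℂ := sinh θ + σ * I * cosh θ

/-- A function with simple poles where `√(k² + c²)` takes the values `l₁`, `l₂`. -/
noncomputable def polarRow (c : ℝ) (f : ℂ → ℂ) (Y₁ Y₂ l₁ l₂ : ℂ) (k : ℂ) : ℂ :=
  f (uniformizer c k) * (1 - Y₁ / (sqrtBranch c k - l₁) - Y₂ / (sqrtBranch c k - l₂))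

theorem polarRow_swap (c : ℝ) (f : ℂ → ℂ) (Y₁ Y₂ l₁ l₂ : ℂ) :
    polarRow c f Y₁ Y₂ l₁ l₂ = polarRow c f Y₂ Y₁ l₂ l₁ := by
  funext k; simp only [polarRow]; ring

theorem hasDerivAt_hypOne (σ θ : ℂ) : HasDerivAt (hypOne σ) (hypTwo σ θ) θ :=
  (hasDerivAt_cosh θ).add ((hasDerivAt_sinh θ).const_mul (σ * I))

theorem hasDerivAt_hypTwo (σ θ : ℂ) : HasDerivAt (hypTwo σ) (hypOne σ θ) θ :=
  (hasDerivAt_sinh θ).add ((hasDerivAt_cosh θ).const_mul (σ * I))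

theorem differentiable_hypOne (σ : ℂ) : Differentiable ℂ (hypOne σ) := fun θ =>
  (hasDerivAt_hypOne σ θ).differentiableAt

theorem differentiable_hypTwo (σ : ℂ) : Differentiable ℂ (hypTwo σ) := fun θ =>
  (hasDerivAt_hypTwo σ θ).differentiableAt

theorem cosh_add_half_pi (θ : ℂ) : cosh (θ + Real.pi / 2 * I) = I * sinh θ := by
  rw [cosh_add, cosh_mul_I, sinh_mul_I]; simp [mul_comm]

theorem sinh_add_half_pi (θ : ℂ) : sinh (θ + Real.pi / 2 * I) = I * cosh θ := by
  rw [sinh_add, cosh_mul_I, sinh_mul_I]; simp [mul_comm]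

theorem hypOne_add_half_pi (σ θ : ℂ) : hypOne σ (θ + Real.pi / 2 * I) = I * hypTwo σ θ := by
  rw [hypOne, hypTwo, cosh_add_half_pi, sinh_add_half_pi]; ring

theorem hypTwo_add_half_pi (σ θ : ℂ) : hypTwo σ (θ + Real.pi / 2 * I) = I * hypOne σ θ := by
  rw [hypOne, hypTwo, cosh_add_half_pi, sinh_add_half_pi]; ring

variable {c : ℝ} {k p q : ℂ}

/-- The relation between the two columns of the background solution at a pole. -/
theorem hypOne_uniformizer_mul (hc : 0 ≤ c) (hp : p ∉ slit c) {σ : ℂ} (hσ : σ ^ 2 = 1) :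
    -(I * σ * (σ * c - sqrtBranch c p)) * hypOne σ (uniformizer c p)
      = p * hypTwo σ (uniformizer c p) := by
  have h1 := sqrtBranch_mul_cosh hc hp
  have h2 := sqrtBranch_mul_sinh hc hp
  rw [cosh_two_mul] at h1
  rw [sinh_two_mul] at h2
  have h3 := cosh_sq_sub_sinh_sq (uniformizer c p)
  rw [hypOne, hypTwo]
  set θ := uniformizer c p
  set l := sqrtBranch c p
  -- Here c is eliminated through λ sinh 2θ = -ic; with k = λ cosh 2θ what remains is an identity
  -- between hyperbolic functions.
  have e : -(I * σ * (σ * c - l)) = l * (2 * sinh θ * cosh θ + I * σ) := by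
    linear_combination (-(c * I)) * hσ - h2
  rw [e, ← h1]
  linear_combination l * (sinh θ - σ * I * cosh θ) * h3 + l * sinh θ * σ ^ 2 * I_sq
    - l * sinh θ * hσ

/-- λ² determines k up to sign, and λ is odd and nonzero. Hence 1/(λ - λ(p)) has its only pole off
the slit at p. -/
theorem eq_of_sqrtBranch_eq (hc : 0 ≤ c) (hk : k ∉ slit c) (hp : p ∉ slit c)
    (h : sqrtBranch c k = sqrtBranch c p) : k = p := by
  have h1 := sqrtBranch_sq (c := c) (ne_zero_of_not_mem_slit hc hk)
  have h2 := sqrtBranch_sq (c := c) (ne_zero_of_not_mem_slit hc hp)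
  have h3 : k ^ 2 = p ^ 2 := by
    rw [h] at h1
    linear_combination h2 - h1
  rcases sq_eq_sq_iff_eq_or_eq_neg.mp h3 with h4 | h4
  · exact h4
  · rw [h4, sqrtBranch_neg] at h
    have h5 := sqrtBranch_ne_zero hc hp
    exact absurd (by linear_combination (-1 / 2 : ℂ) * h) h5

theorem continuousAt_sqrtBranch (hc : 0 ≤ c) (hk : k ∉ slit c) : ContinuousAt (sqrtBranch c) k :=
  (differentiableAt_sqrtBranch hc hk).continuousAt

variable {f : ℂ → ℂ} {Y₁ Y₂ l₁ l₂ : ℂ}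

theorem differentiableAt_polarRow (hc : 0 ≤ c) (hk : k ∉ slit c) (hf : Differentiable ℂ f)
    (h₁ : sqrtBranch c k ≠ l₁) (h₂ : sqrtBranch c k ≠ l₂) :
    DifferentiableAt ℂ (polarRow c f Y₁ Y₂ l₁ l₂) k := by
  have hs := differentiableAt_sqrtBranch hc hk
  have hu := differentiableAt_uniformizer hc hk
  refine DifferentiableAt.mul ((hf _).comp k hu) ?_
  refine (DifferentiableAt.sub (differentiableAt_const _) ?_).sub ?_
  · exact (differentiableAt_const _).div (hs.sub_const _) (sub_ne_zero.mpr h₁)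
  · exact (differentiableAt_const _).div (hs.sub_const _) (sub_ne_zero.mpr h₂)

/-- From λ² - l₁² = k² - p² one gets (k - p)/(λ - l₁) = (λ + l₁)/(k + p), whose value at p is l₁/p.
This gives the residue without differentiating the square root. -/
theorem tendsto_sub_mul_polarRow (hc : 0 ≤ c) (hp : p ∉ slit c) (hf : Continuous f)
    (h₁ : sqrtBranch c p = l₁) (h₂ : l₁ ≠ l₂) :
    Tendsto (fun k => (k - p) * polarRow c f Y₁ Y₂ l₁ l₂ k) (𝓝[≠] p)
      (𝓝 (-(f (uniformizer c p) * Y₁ * (l₁ / p)))) := by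
  have hp0 := ne_zero_of_not_mem_slit hc hp
  have hs := continuousAt_sqrtBranch hc hp
  have hu : ContinuousAt (fun k => f (uniformizer c k)) p :=
    hf.continuousAt.comp (differentiableAt_uniformizer hc hp).continuousAt
  have h3 : ContinuousAt (fun k => f (uniformizer c k) * ((k - p) * (1 - Y₂ / (sqrtBranch c k - l₂))
      - Y₁ * ((sqrtBranch c k + l₁) / (k + p)))) p := by
    refine hu.mul (ContinuousAt.sub (ContinuousAt.mul (by fun_prop) ?_) ?_)
    · exact continuousAt_const.sub
        (continuousAt_const.div (by fun_prop) (sub_ne_zero.mpr (h₁ ▸ h₂)))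
    · refine continuousAt_const.mul (ContinuousAt.div (by fun_prop) (by fun_prop) ?_)
      rw [← two_mul]; exact mul_ne_zero two_ne_zero hp0
  have h4 := h3.tendsto.mono_left (nhdsWithin_le_nhds (s := {p}ᶜ))
  have h5 : f (uniformizer c p) * ((p - p) * (1 - Y₂ / (sqrtBranch c p - l₂))
      - Y₁ * ((sqrtBranch c p + l₁) / (p + p))) = -(f (uniformizer c p) * Y₁ * (l₁ / p)) := by
    rw [h₁, sub_self, ← two_mul, ← two_mul, mul_div_mul_left _ _ two_ne_zero]; ring
  rw [h5] at h4
  refine h4.congr' ?_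
  have hk : ∀ᶠ k in 𝓝 p, k ∉ slit c ∧ k ≠ -p :=
    ((isClosed_slit c).isOpen_compl.eventually_mem hp).and
      (isOpen_ne.eventually_mem fun h => hp0 (self_eq_neg.mp h))
  filter_upwards [self_mem_nhdsWithin, nhdsWithin_le_nhds hk] with k hkp hk
  have h6 : sqrtBranch c k - l₁ ≠ 0 := by
    rw [← h₁]; exact fun h => hkp (eq_of_sqrtBranch_eq hc hk.1 hp (sub_eq_zero.mp h))
  have h7 : k + p ≠ 0 := fun h => hk.2 (eq_neg_of_add_eq_zero_left h)
  have h8 : (sqrtBranch c k + l₁) / (k + p) = (k - p) / (sqrtBranch c k - l₁) := by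
    rw [div_eq_div_iff h7 h6, ← h₁]
    linear_combination sqrtBranch_sq (c := c) (ne_zero_of_not_mem_slit hc hk.1)
      - sqrtBranch_sq (c := c) hp0
  rw [h8, polarRow]; ring

/-- At the endpoints λ → 0, so the rational factor stays bounded and the singularity is that of the
background. -/
theorem isBigO_polarRow {l : Filter ℂ} {g : ℂ → ℝ} (hs : Tendsto (sqrtBranch c) l (𝓝 0))
    (h₁ : l₁ ≠ 0) (h₂ : l₂ ≠ 0) (hf : (fun k => f (uniformizer c k)) =O[l] g) :
    polarRow c f Y₁ Y₂ l₁ l₂ =O[l] g := by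
  have h : Tendsto (fun k => 1 - Y₁ / (sqrtBranch c k - l₁) - Y₂ / (sqrtBranch c k - l₂)) l
      (𝓝 (1 - Y₁ / (0 - l₁) - Y₂ / (0 - l₂))) :=
    (tendsto_const_nhds.sub (tendsto_const_nhds.div (hs.sub_const _) (by simpa))).sub
      (tendsto_const_nhds.div (hs.sub_const _) (by simpa))
  have h2 := hf.mul (h.isBigO_one ℝ)
  simpa using! h2

theorem tendsto_mul_polarRow (c : ℝ) {f' : ℂ} (hf : HasDerivAt f f' 0) :
    Tendsto (fun k => k * (polarRow c f Y₁ Y₂ l₁ l₂ k - f 0)) (cobounded ℂ)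
      (𝓝 (f' * (-(c * I) / 2) - f 0 * (Y₁ + Y₂))) := by
  have h1 := tendsto_mul_comp_uniformizer c hf
  have hs := tendsto_sqrtBranch_div c
  have h2 : ∀ l : ℂ, Tendsto (fun k => k * (1 / (sqrtBranch c k - l))) (cobounded ℂ) (𝓝 1) := by
    intro l
    have h3 : Tendsto (fun k => (sqrtBranch c k / k - l * k⁻¹)⁻¹) (cobounded ℂ) (𝓝 1) := by
      have := (hs.sub ((tendsto_inv₀_cobounded (α := ℂ)).const_mul l)).inv₀ (by simp)
      simpa using this
    refine h3.congr' ?_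
    filter_upwards [eventually_ne_cobounded (0 : ℂ)] with k hk
    rw [← div_eq_mul_inv, ← sub_div, inv_div, mul_one_div]
  have h0 : ∀ l : ℂ, Tendsto (fun k => 1 / (sqrtBranch c k - l)) (cobounded ℂ) (𝓝 0) := by
    intro l
    have := (h2 l).mul (tendsto_inv₀_cobounded (α := ℂ))
    rw [mul_zero] at this
    refine this.congr' ?_
    filter_upwards [eventually_ne_cobounded (0 : ℂ)] with k hk
    field_simp
  have h4 := (h1.mul (((h0 l₁).const_mul Y₁).add ((h0 l₂).const_mul Y₂) |>.const_sub 1)).sub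
    ((((h2 l₁).const_mul Y₁).add ((h2 l₂).const_mul Y₂)).const_mul (f 0))
  simp only [mul_zero, add_zero, sub_zero, mul_one] at h4
  refine h4.congr fun k => ?_
  rw [polarRow]; ring

/-- The boundary values of the square root on the two sides of the slit. -/
theorem exists_tendsto_sqrtBranch {s : ℝ} (hs : |s| < c) : ∃ θ l : ℂ, l ^ 2 = ((c ^ 2 - s ^ 2 : ℝ) : ℂ) ∧
    Tendsto (uniformizer c) (𝓝[{k : ℂ | 0 < k.re}] (s * I)) (𝓝 θ) ∧
    Tendsto (uniformizer c) (𝓝[{k : ℂ | k.re < 0}] (s * I)) (𝓝 (θ + Real.pi / 2 * I)) ∧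
    Tendsto (sqrtBranch c) (𝓝[{k : ℂ | 0 < k.re}] (s * I)) (𝓝 l) ∧
    Tendsto (sqrtBranch c) (𝓝[{k : ℂ | k.re < 0}] (s * I)) (𝓝 (-l)) := by
  have hc : 0 ≤ c := (abs_nonneg s).trans hs.le
  obtain ⟨θ, h1, h2⟩ := exists_tendsto_uniformizer hs
  have key : ∀ (S : Set ℂ) (θ' : ℂ), (∀ k ∈ S, k ∉ slit c) →
      Tendsto (uniformizer c) (𝓝[S] (s * I)) (𝓝 θ') →
      Tendsto (sqrtBranch c) (𝓝[S] (s * I)) (𝓝 ((s * I + c * I) * exp (2 * θ'))) := by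
    intro S θ' hS h
    have h3 : Tendsto (fun k : ℂ => k + c * I) (𝓝[S] (s * I)) (𝓝 (s * I + c * I)) :=
      (Continuous.tendsto (by fun_prop) _).mono_left nhdsWithin_le_nhds
    refine (h3.mul (h.const_mul 2).cexp).congr' ?_
    filter_upwards [self_mem_nhdsWithin] with k hk
    rw [sqrtBranch_eq hc (hS k hk)]
  have h3 := key {k : ℂ | 0 < k.re} _ (fun k (hk : 0 < k.re) => not_mem_slit_of_re_ne_zero hk.ne') h1
  have h4 := key {k : ℂ | k.re < 0} _ (fun k (hk : k.re < 0) => not_mem_slit_of_re_ne_zero hk.ne) h2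
  refine ⟨θ, _, ?_, h1, h2, h3, ?_⟩
  · have : (𝓝[{k : ℂ | 0 < k.re}] (s * I)).NeBot := by
      rw [← mem_closure_iff_nhdsWithin_neBot, closure_setOfPred_lt_re]
      simp
    refine tendsto_nhds_unique (h3.pow 2) ?_
    have h5 : Tendsto (fun k : ℂ => k ^ 2 + c ^ 2) (𝓝[{k : ℂ | 0 < k.re}] (s * I))
        (𝓝 ((s * I) ^ 2 + c ^ 2)) :=
      (Continuous.tendsto (by fun_prop) _).mono_left nhdsWithin_le_nhds
    have h6 : ((s : ℂ) * I) ^ 2 + c ^ 2 = ((c ^ 2 - s ^ 2 : ℝ) : ℂ) := by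
      push_cast
      linear_combination (s : ℂ) ^ 2 * I_sq
    rw [h6] at h5
    refine h5.congr' ?_
    filter_upwards [self_mem_nhdsWithin] with k hk
    have hk' : 0 < k.re := hk
    rw [sqrtBranch_sq (fun h => by simp [h] at hk')]
  · convert h4 using 2
    rw [show 2 * (θ + Real.pi / 2 * I) = 2 * θ + Real.pi * I by ring, exp_add, exp_pi_mul_I]
    ring

theorem tendsto_polarRow {l : Filter ℂ} {θ L : ℂ} (hf : Continuous f)
    (hu : Tendsto (uniformizer c) l (𝓝 θ)) (hs : Tendsto (sqrtBranch c) l (𝓝 L))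
    (h₁ : L ≠ l₁) (h₂ : L ≠ l₂) :
    Tendsto (polarRow c f Y₁ Y₂ l₁ l₂) l (𝓝 (f θ * (1 - Y₁ / (L - l₁) - Y₂ / (L - l₂)))) :=
  ((hf.tendsto θ).comp hu).mul
    ((tendsto_const_nhds.sub (tendsto_const_nhds.div (hs.sub_const _) (sub_ne_zero.mpr h₁))).sub
      (tendsto_const_nhds.div (hs.sub_const _) (sub_ne_zero.mpr h₂)))

theorem isBigO_hyp {l : Filter ℂ} {g : ℂ → ℝ} (σ : ℂ)
    (h1 : (fun k => exp (uniformizer c k)) =O[l] g)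
    (h2 : (fun k => exp (-uniformizer c k)) =O[l] g) :
    (fun k => hypOne σ (uniformizer c k)) =O[l] g ∧
      (fun k => hypTwo σ (uniformizer c k)) =O[l] g := by
  constructor
  · refine ((h1.const_mul_left ((1 + σ * I) / 2)).add
      (h2.const_mul_left ((1 - σ * I) / 2))).congr_left fun k => ?_
    rw [hypOne, cosh, sinh]; ring
  · refine ((h1.const_mul_left ((1 + σ * I) / 2)).add
      (h2.const_mul_left ((σ * I - 1) / 2))).congr_left fun k => ?_
    rw [hypTwo, cosh, sinh]; ring

theorem isBigO_hyp_top (hc : 0 ≤ c) (σ : ℂ) :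
    (fun k => hypOne σ (uniformizer c k)) =O[𝓝[(slit c)ᶜ] (c * I)]
        (fun k => ‖k - c * I‖ ^ (-(1 / 4) : ℝ)) ∧
      (fun k => hypTwo σ (uniformizer c k)) =O[𝓝[(slit c)ᶜ] (c * I)]
        (fun k => ‖k - c * I‖ ^ (-(1 / 4) : ℝ)) :=
  isBigO_hyp σ (isBigO_exp_uniformizer hc) (isBigO_exp_neg_uniformizer hc)

theorem isBigO_hyp_bot (hc : 0 ≤ c) (σ : ℂ) :
    (fun k => hypOne σ (uniformizer c k)) =O[𝓝[(slit c)ᶜ] (-(c * I))]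
        (fun k => ‖k + c * I‖ ^ (-(1 / 4) : ℝ)) ∧
      (fun k => hypTwo σ (uniformizer c k)) =O[𝓝[(slit c)ᶜ] (-(c * I))]
        (fun k => ‖k + c * I‖ ^ (-(1 / 4) : ℝ)) := by
  have hneg : Tendsto (fun k : ℂ => -k) (𝓝[(slit c)ᶜ] (-(c * I))) (𝓝[(slit c)ᶜ] (c * I)) := by
    refine tendsto_nhdsWithin_iff.mpr ⟨?_, ?_⟩
    · have := (continuous_neg (G := ℂ)).tendsto (-((c : ℂ) * I))
      rw [neg_neg] at this
      exact this.mono_left nhdsWithin_le_nhds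
    · filter_upwards [self_mem_nhdsWithin] with k hk
      exact mt neg_mem_slit.mp hk
  have hev : ∀ᶠ k in 𝓝[(slit c)ᶜ] (-((c : ℂ) * I)), uniformizer c (-k) = -uniformizer c k := by
    filter_upwards [self_mem_nhdsWithin] with k hk
    exact uniformizer_neg hc hk
  have e : ∀ k : ℂ, ‖-k - c * I‖ = ‖k + c * I‖ := fun k => by
    rw [← norm_neg]; congr 1; ring
  refine isBigO_hyp σ ?_ ?_
  · refine ((isBigO_exp_neg_uniformizer hc).comp_tendsto hneg).congr' ?_ ?_
    · filter_upwards [hev] with k hk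
      simp [hk]
    · exact Eventually.of_forall fun k => by simp [e]
  · refine ((isBigO_exp_uniformizer hc).comp_tendsto hneg).congr' ?_ ?_
    · filter_upwards [hev] with k hk
      simp [hk]
    · exact Eventually.of_forall fun k => by simp [e]

end

/-! ### Row solutions and the 2×2 linear system -/

section

/-- A row of a solution of the Riemann-Hilbert problem with poles at `p₁, p₂` in the first column
and at `-p₁, -p₂` in the second one, without normalization at infinity. -/
structure IsRowSolution (c : ℝ) (p₁ p₂ C₁ C₂ : ℂ) (r : Fin 2 → ℂ → ℂ) : Prop where
  analytic : ∀ j, ∀ k, k ∉ slit c → k ≠ p₁ → k ≠ p₂ → k ≠ -p₁ → k ≠ -p₂ →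
    DifferentiableAt ℂ (r j) k
  jump : ∀ s : ℝ, |s| < c → ∃ P : Fin 2 → ℂ,
    (∀ j, Tendsto (r j) (𝓝[{k : ℂ | 0 < k.re}] (s * I)) (𝓝 (P j))) ∧
    Tendsto (r 0) (𝓝[{k : ℂ | k.re < 0}] (s * I)) (𝓝 (P 1 * I)) ∧
    Tendsto (r 1) (𝓝[{k : ℂ | k.re < 0}] (s * I)) (𝓝 (P 0 * I))
  lower₁ : ∃ a, Tendsto (fun k => (k - p₁) * r 0 k) (𝓝[≠] p₁) (𝓝 (C₁ * a)) ∧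
    Tendsto (r 1) (𝓝[≠] p₁) (𝓝 a)
  lower₂ : ∃ a, Tendsto (fun k => (k - p₂) * r 0 k) (𝓝[≠] p₂) (𝓝 (C₂ * a)) ∧
    Tendsto (r 1) (𝓝[≠] p₂) (𝓝 a)
  upper₁ : ∃ a, Tendsto (fun k => (k - -p₁) * r 1 k) (𝓝[≠] (-p₁)) (𝓝 (C₁ * a)) ∧
    Tendsto (r 0) (𝓝[≠] (-p₁)) (𝓝 a)
  upper₂ : ∃ a, Tendsto (fun k => (k - -p₂) * r 1 k) (𝓝[≠] (-p₂)) (𝓝 (C₂ * a)) ∧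
    Tendsto (r 0) (𝓝[≠] (-p₂)) (𝓝 a)
  top : ∀ j, r j =O[𝓝[(slit c)ᶜ] (c * I)] (fun k => ‖k - c * I‖ ^ (-(1 / 4) : ℝ))
  bot : ∀ j, r j =O[𝓝[(slit c)ᶜ] (-(c * I))] (fun k => ‖k + c * I‖ ^ (-(1 / 4) : ℝ))

/-- The row `(1, σi) M` of the solution of the Riemann-Hilbert problem. -/
noncomputable def rhRow (c : ℝ) (σ Y₁ Y₂ l₁ l₂ : ℂ) : Fin 2 → ℂ → ℂ :=
  ![polarRow c (hypOne σ) Y₁ Y₂ l₁ l₂, polarRow c (hypTwo σ) (-Y₁) (-Y₂) (-l₁) (-l₂)]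

theorem rhRow_swap (c : ℝ) (σ Y₁ Y₂ l₁ l₂ : ℂ) : rhRow c σ Y₁ Y₂ l₁ l₂ = rhRow c σ Y₂ Y₁ l₂ l₁ := by
  rw [rhRow, polarRow_swap, polarRow_swap (Y₁ := -Y₁), ← rhRow]

variable {c : ℝ} {p₁ p₂ C₁ C₂ σ Y₁ Y₂ : ℂ}

theorem sqrtBranch_ne (hc : 0 ≤ c) {p q : ℂ} (hp : p ∉ slit c) (hq : q ∉ slit c) (h : p ≠ q) :
    sqrtBranch c p ≠ sqrtBranch c q := fun h' => h (eq_of_sqrtBranch_eq hc hp hq h')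

theorem sqrtBranch_ne_neg (hc : 0 ≤ c) {p q : ℂ} (hp : p ∉ slit c) (hq : q ∉ slit c)
    (h : p ≠ -q) : sqrtBranch c p ≠ -sqrtBranch c q := by
  rw [← sqrtBranch_neg]
  exact sqrtBranch_ne hc hp (mt neg_mem_slit.mp hq) h

/-- By `hypOne_uniformizer_mul` the background entries at `p₁` have a known ratio. Cancelling it
turns the residue condition into the scalar equation `hY`. -/
theorem rhRow_lower (hc : 0 ≤ c) (h₁ : p₁ ∉ slit c) (h₂ : p₂ ∉ slit c) (h : p₁ ≠ p₂)
    (h' : p₁ ≠ -p₂) (hσ : σ ^ 2 = 1)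
    (hY : Y₁ = I * σ * C₁ * (σ * c - sqrtBranch c p₁) / sqrtBranch c p₁ *
      (1 + Y₁ / (2 * sqrtBranch c p₁) + Y₂ / (sqrtBranch c p₁ + sqrtBranch c p₂))) :
    ∃ a, Tendsto (fun k => (k - p₁) * rhRow c σ Y₁ Y₂ (sqrtBranch c p₁) (sqrtBranch c p₂) 0 k)
      (𝓝[≠] p₁) (𝓝 (C₁ * a)) ∧
    Tendsto (rhRow c σ Y₁ Y₂ (sqrtBranch c p₁) (sqrtBranch c p₂) 1) (𝓝[≠] p₁) (𝓝 a) := by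
  have hl := sqrtBranch_ne_zero hc h₁
  have hp := ne_zero_of_not_mem_slit hc h₁
  refine ⟨polarRow c (hypTwo σ) (-Y₁) (-Y₂) (-sqrtBranch c p₁) (-sqrtBranch c p₂) p₁, ?_, ?_⟩
  rotate_left
  · have h4 := (differentiableAt_polarRow (Y₁ := -Y₁) (Y₂ := -Y₂) hc h₁ (differentiable_hypTwo σ)
      (l₁ := -sqrtBranch c p₁) (l₂ := -sqrtBranch c p₂) (fun h => hl (self_eq_neg.mp h))
      (sqrtBranch_ne_neg hc h₁ h₂ h')).continuousAt
    exact h4.tendsto.mono_left nhdsWithin_le_nhds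
  · have h4 := tendsto_sub_mul_polarRow (Y₁ := Y₁) (Y₂ := Y₂) hc h₁
      (differentiable_hypOne σ).continuous rfl (sqrtBranch_ne hc h₁ h₂ h)
    change Tendsto (fun k => (k - p₁) * polarRow c (hypOne σ) Y₁ Y₂ _ _ k) _ _
    convert h4 using 2
    have key := hypOne_uniformizer_mul hc h₁ hσ
    have e : 1 - -Y₁ / (sqrtBranch c p₁ - -sqrtBranch c p₁) - -Y₂ / (sqrtBranch c p₁ - -sqrtBranch c p₂)
      = 1 + Y₁ / (2 * sqrtBranch c p₁) + Y₂ / (sqrtBranch c p₁ + sqrtBranch c p₂) := by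
      rw [sub_neg_eq_add, sub_neg_eq_add, two_mul]; ring
    rw [polarRow, e]
    set W := 1 + Y₁ / (2 * sqrtBranch c p₁) + Y₂ / (sqrtBranch c p₁ + sqrtBranch c p₂)
    rw [hY]
    field_simp
    linear_combination (-C₁ * W) * key

theorem hypOne_neg (σ θ : ℂ) (hσ : σ ^ 2 = 1) : hypOne σ (-θ) = -(σ * I) * hypTwo σ θ := by
  rw [hypOne, hypTwo, cosh_neg, sinh_neg]
  linear_combination (-cosh θ) * hσ + (cosh θ * σ ^ 2) * I_sq

theorem hypTwo_neg (σ θ : ℂ) (hσ : σ ^ 2 = 1) : hypTwo σ (-θ) = σ * I * hypOne σ θ := by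
  rw [hypOne, hypTwo, cosh_neg, sinh_neg]
  linear_combination sinh θ * hσ - (sinh θ * σ ^ 2) * I_sq

/-- The row satisfies r₀(-k) = -σi r₁(k), so the condition at `-p₁` is the same equation `hY` as at
`p₁`. This is why two unknowns suffice for four poles. -/
theorem rhRow_upper (hc : 0 ≤ c) (h₁ : p₁ ∉ slit c) (h₂ : p₂ ∉ slit c) (h : p₁ ≠ p₂)
    (h' : p₁ ≠ -p₂) (hσ : σ ^ 2 = 1)
    (hY : Y₁ = I * σ * C₁ * (σ * c - sqrtBranch c p₁) / sqrtBranch c p₁ *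
      (1 + Y₁ / (2 * sqrtBranch c p₁) + Y₂ / (sqrtBranch c p₁ + sqrtBranch c p₂))) :
    ∃ a, Tendsto (fun k => (k - -p₁) * rhRow c σ Y₁ Y₂ (sqrtBranch c p₁) (sqrtBranch c p₂) 1 k)
      (𝓝[≠] (-p₁)) (𝓝 (C₁ * a)) ∧
    Tendsto (rhRow c σ Y₁ Y₂ (sqrtBranch c p₁) (sqrtBranch c p₂) 0) (𝓝[≠] (-p₁)) (𝓝 a) := by
  have hl := sqrtBranch_ne_zero hc h₁
  have hp := ne_zero_of_not_mem_slit hc h₁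
  have h₁' : -p₁ ∉ slit c := mt neg_mem_slit.mp h₁
  refine ⟨polarRow c (hypOne σ) Y₁ Y₂ (sqrtBranch c p₁) (sqrtBranch c p₂) (-p₁), ?_, ?_⟩
  rotate_left
  · have h4 := (differentiableAt_polarRow (Y₁ := Y₁) (Y₂ := Y₂) hc h₁' (differentiable_hypOne σ)
      (l₁ := sqrtBranch c p₁) (l₂ := sqrtBranch c p₂)
      (fun h => hl (neg_eq_self.mp (by rwa [sqrtBranch_neg] at h)))
      (sqrtBranch_ne hc h₁' h₂ fun h => h' (by rw [← h, neg_neg]))).continuousAt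
    exact h4.tendsto.mono_left nhdsWithin_le_nhds
  · have h4 := tendsto_sub_mul_polarRow (Y₁ := -Y₁) (Y₂ := -Y₂) hc h₁'
      (differentiable_hypTwo σ).continuous (sqrtBranch_neg c p₁)
      (neg_injective.ne (sqrtBranch_ne hc h₁ h₂ h))
    change Tendsto (fun k => (k - -p₁) * polarRow c (hypTwo σ) (-Y₁) (-Y₂) _ _ k) _ _
    convert h4 using 2
    have key := hypOne_uniformizer_mul hc h₁ hσ
    have e : 1 - Y₁ / (-sqrtBranch c p₁ - sqrtBranch c p₁) - Y₂ / (-sqrtBranch c p₁ - sqrtBranch c p₂)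
      = 1 + Y₁ / (2 * sqrtBranch c p₁) + Y₂ / (sqrtBranch c p₁ + sqrtBranch c p₂) := by
      rw [← neg_add', ← neg_add', div_neg, div_neg, two_mul]; ring
    rw [polarRow, sqrtBranch_neg, e, uniformizer_neg hc h₁, hypOne_neg _ _ hσ, hypTwo_neg _ _ hσ]
    set W := 1 + Y₁ / (2 * sqrtBranch c p₁) + Y₂ / (sqrtBranch c p₁ + sqrtBranch c p₂)
    rw [hY]
    field_simp
    linear_combination (C₁ * W * σ) * key

/-- Boundary values of λ on the slit have the real square c² - s², whereas the squares of l₁, l₂ are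
not real; hence the rational factors have no pole on the slit. -/
theorem ne_of_sq_im_ne_zero {l m : ℂ} {a : ℝ} (hl : l ^ 2 = a) (hm : (m ^ 2).im ≠ 0) : l ≠ m := by
  rintro rfl
  exact hm (by rw [hl, ofReal_im])

theorem rhRow_isRowSolution (hc : 0 ≤ c) (h₁ : p₁ ∉ slit c) (h₂ : p₂ ∉ slit c) (h : p₁ ≠ p₂)
    (h' : p₁ ≠ -p₂) (hσ : σ ^ 2 = 1) (him₁ : (p₁ ^ 2).im ≠ 0) (him₂ : (p₂ ^ 2).im ≠ 0)
    (hY₁ : Y₁ = I * σ * C₁ * (σ * c - sqrtBranch c p₁) / sqrtBranch c p₁ *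
      (1 + Y₁ / (2 * sqrtBranch c p₁) + Y₂ / (sqrtBranch c p₁ + sqrtBranch c p₂)))
    (hY₂ : Y₂ = I * σ * C₂ * (σ * c - sqrtBranch c p₂) / sqrtBranch c p₂ *
      (1 + Y₁ / (sqrtBranch c p₁ + sqrtBranch c p₂) + Y₂ / (2 * sqrtBranch c p₂))) :
    IsRowSolution c p₁ p₂ C₁ C₂ (rhRow c σ Y₁ Y₂ (sqrtBranch c p₁) (sqrtBranch c p₂)) := by
  have hl₁ := sqrtBranch_ne_zero hc h₁
  have hl₂ := sqrtBranch_ne_zero hc h₂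
  have h'' : p₂ ≠ -p₁ := fun h => h' (by rw [h, neg_neg])
  have hY₂' : Y₂ = I * σ * C₂ * (σ * c - sqrtBranch c p₂) / sqrtBranch c p₂ *
      (1 + Y₂ / (2 * sqrtBranch c p₂) + Y₁ / (sqrtBranch c p₂ + sqrtBranch c p₁)) := by
    rw [add_comm (sqrtBranch c p₂) (sqrtBranch c p₁), add_right_comm]; exact hY₂
  have hsq : ∀ p, p ∉ slit c → (p ^ 2).im ≠ 0 → (sqrtBranch c p ^ 2).im ≠ 0 := fun p hp h => by
    rw [sqrtBranch_sq (ne_zero_of_not_mem_slit hc hp), add_im, ← ofReal_pow, ofReal_im, add_zero]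
    exact h
  have hend : ∀ {p : ℂ} {g : ℂ → ℝ}, p ^ 2 + c ^ 2 = 0 →
      (fun k => hypOne σ (uniformizer c k)) =O[𝓝[(slit c)ᶜ] p] g →
      (fun k => hypTwo σ (uniformizer c k)) =O[𝓝[(slit c)ᶜ] p] g →
      ∀ j, rhRow c σ Y₁ Y₂ (sqrtBranch c p₁) (sqrtBranch c p₂) j =O[𝓝[(slit c)ᶜ] p] g := by
    intro p g hp hg1 hg2
    rw [Fin.forall_fin_two]
    exact ⟨isBigO_polarRow (tendsto_sqrtBranch_endpoint hp hc) hl₁ hl₂ hg1,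
      isBigO_polarRow (tendsto_sqrtBranch_endpoint hp hc) (neg_ne_zero.mpr hl₁)
        (neg_ne_zero.mpr hl₂) hg2⟩
  refine ⟨?_, ?_, rhRow_lower hc h₁ h₂ h h' hσ hY₁, ?_, rhRow_upper hc h₁ h₂ h h' hσ hY₁, ?_, ?_, ?_⟩
  · rw [Fin.forall_fin_two]
    exact ⟨fun k hk h1 h2 _ _ => differentiableAt_polarRow hc hk (differentiable_hypOne σ)
        (sqrtBranch_ne hc hk h₁ h1) (sqrtBranch_ne hc hk h₂ h2),
      fun k hk _ _ h1 h2 => differentiableAt_polarRow hc hk (differentiable_hypTwo σ)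
        (sqrtBranch_ne_neg hc hk h₁ h1) (sqrtBranch_ne_neg hc hk h₂ h2)⟩
  · intro s hs
    obtain ⟨θ, l, hl, hu1, hu2, hs1, hs2⟩ := exists_tendsto_sqrtBranch hs
    have n₁ := ne_of_sq_im_ne_zero hl (hsq p₁ h₁ him₁)
    have n₂ := ne_of_sq_im_ne_zero hl (hsq p₂ h₂ him₂)
    have m₁ : l ≠ -sqrtBranch c p₁ := ne_of_sq_im_ne_zero hl (by rw [neg_sq]; exact hsq p₁ h₁ him₁)
    have m₂ : l ≠ -sqrtBranch c p₂ := ne_of_sq_im_ne_zero hl (by rw [neg_sq]; exact hsq p₂ h₂ him₂)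
    refine ⟨![_, _], Fin.forall_fin_two.mpr
      ⟨tendsto_polarRow (differentiable_hypOne σ).continuous hu1 hs1 n₁ n₂,
        tendsto_polarRow (differentiable_hypTwo σ).continuous hu1 hs1 m₁ m₂⟩, ?_, ?_⟩
    · have := tendsto_polarRow (Y₁ := Y₁) (Y₂ := Y₂) (differentiable_hypOne σ).continuous hu2 hs2
        (fun h => m₁ (neg_eq_iff_eq_neg.mp h)) (fun h => m₂ (neg_eq_iff_eq_neg.mp h))
      change Tendsto (polarRow c (hypOne σ) Y₁ Y₂ _ _) _ _
      convert this using 2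
      rw [hypOne_add_half_pi]
      simp only [Matrix.cons_val_one, Matrix.cons_val_fin_one]
      rw [← neg_add', ← neg_add', div_neg, div_neg, neg_div, neg_div, sub_neg_eq_add, sub_neg_eq_add]
      ring
    · have := tendsto_polarRow (Y₁ := -Y₁) (Y₂ := -Y₂) (differentiable_hypTwo σ).continuous hu2 hs2
        (neg_injective.ne n₁) (neg_injective.ne n₂)
      change Tendsto (polarRow c (hypTwo σ) (-Y₁) (-Y₂) _ _) _ _
      convert this using 2
      rw [hypTwo_add_half_pi]
      simp only [Matrix.cons_val_zero]
      rw [← neg_sub', ← neg_sub', neg_div_neg_eq, neg_div_neg_eq]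
      ring
  · rw [rhRow_swap]
    exact rhRow_lower hc h₂ h₁ h.symm h'' hσ hY₂'
  · rw [rhRow_swap]
    exact rhRow_upper hc h₂ h₁ h.symm h'' hσ hY₂'
  · exact hend (by linear_combination (c : ℂ) ^ 2 * I_sq) (isBigO_hyp_top hc σ).1 (isBigO_hyp_top hc σ).2
  · exact hend (by linear_combination (c : ℂ) ^ 2 * I_sq) (isBigO_hyp_bot hc σ).1 (isBigO_hyp_bot hc σ).2

/-- The determinant of the linear system for `Y₁`, `Y₂`. -/
noncomputable def tau (e₁ e₂ l₁ l₂ : ℂ) : ℂ :=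
  (1 - e₁ / (2 * l₁)) * (1 - e₂ / (2 * l₂)) - e₁ * e₂ / (l₁ + l₂) ^ 2

/-- Cramer's rule. Only the sum Y₁ + Y₂ enters q. -/
theorem exists_linear_system {e₁ e₂ l₁ l₂ : ℂ} (h : tau e₁ e₂ l₁ l₂ ≠ 0) : ∃ Y₁ Y₂ : ℂ,
    Y₁ = e₁ * (1 + Y₁ / (2 * l₁) + Y₂ / (l₁ + l₂)) ∧
    Y₂ = e₂ * (1 + Y₁ / (l₁ + l₂) + Y₂ / (2 * l₂)) ∧
    Y₁ + Y₂ = (e₁ + e₂ + e₁ * e₂ * (2 / (l₁ + l₂) - 1 / (2 * l₁) - 1 / (2 * l₂)))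
      / tau e₁ e₂ l₁ l₂ := by
  have hw := mul_inv_cancel₀ h
  set w := (tau e₁ e₂ l₁ l₂)⁻¹
  rw [tau, div_eq_mul_inv _ ((l₁ + l₂) ^ 2), ← inv_pow] at hw
  refine ⟨e₁ * (1 - e₂ / (2 * l₂) + e₂ / (l₁ + l₂)) * w,
    e₂ * (1 - e₁ / (2 * l₁) + e₁ / (l₁ + l₂)) * w, ?_, ?_, ?_⟩
  · linear_combination e₁ * hw
  · linear_combination e₂ * hw
  · rw [div_eq_mul_inv]; ring

end

/-! ### From two rows to the matrix solution -/

section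

/-- The matrix `M` with `(1, i) M = r` and `(1, -i) M = r'`. -/
noncomputable def matrixOfRows (r r' : Fin 2 → ℂ → ℂ) (k : ℂ) : Matrix (Fin 2) (Fin 2) ℂ :=
  Matrix.of fun i j => (![1 / 2, -I / 2] : Fin 2 → ℂ) i * r j k
    + (![1 / 2, I / 2] : Fin 2 → ℂ) i * r' j k

theorem PoleCondition.of_lower {M : ℂ → Matrix (Fin 2) (Fin 2) ℂ} {n : ℂ → ℂ} {p n₀ : ℂ}
    (hn : Tendsto n (𝓝[≠] p) (𝓝 n₀)) (a : Fin 2 → ℂ) (h : ∀ i,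
      Tendsto (fun k => (k - p) * M k i 0) (𝓝[≠] p) (𝓝 (n₀ * a i)) ∧
      Tendsto (fun k => M k i 1) (𝓝[≠] p) (𝓝 (a i))) :
    PoleCondition M (fun k => !![0, 0; n k, 0]) p := by
  have h0 : Tendsto (fun k : ℂ => k - p) (𝓝[≠] p) (𝓝 0) := by
    have : Tendsto (fun k : ℂ => k - p) (𝓝 p) (𝓝 (p - p)) := Continuous.tendsto (by fun_prop) p
    rw [sub_self] at this
    exact this.mono_left nhdsWithin_le_nhds
  refine ⟨Matrix.of fun i => ![n₀ * a i, 0], ?_, ?_⟩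
  · refine tendsto_pi_nhds.mpr fun i => tendsto_pi_nhds.mpr (Fin.forall_fin_two.mpr ⟨?_, ?_⟩)
    · exact (h i).1
    · have := h0.mul (h i).2
      rw [zero_mul] at this
      exact this
  · refine tendsto_pi_nhds.mpr fun i => tendsto_pi_nhds.mpr (Fin.forall_fin_two.mpr ⟨?_, ?_⟩)
    · have := hn.mul (h i).2
      refine this.congr fun k => ?_
      simp [Matrix.mul_apply, Fin.sum_univ_two, mul_comm]
    · refine tendsto_const_nhds.congr fun k => ?_
      simp [Matrix.mul_apply, Fin.sum_univ_two]

theorem PoleCondition.of_upper {M : ℂ → Matrix (Fin 2) (Fin 2) ℂ} {n : ℂ → ℂ} {p n₀ : ℂ}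
    (hn : Tendsto n (𝓝[≠] p) (𝓝 n₀)) (a : Fin 2 → ℂ) (h : ∀ i,
      Tendsto (fun k => (k - p) * M k i 1) (𝓝[≠] p) (𝓝 (n₀ * a i)) ∧
      Tendsto (fun k => M k i 0) (𝓝[≠] p) (𝓝 (a i))) :
    PoleCondition M (fun k => !![0, n k; 0, 0]) p := by
  have h0 : Tendsto (fun k : ℂ => k - p) (𝓝[≠] p) (𝓝 0) := by
    have : Tendsto (fun k : ℂ => k - p) (𝓝 p) (𝓝 (p - p)) := Continuous.tendsto (by fun_prop) p
    rw [sub_self] at this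
    exact this.mono_left nhdsWithin_le_nhds
  refine ⟨Matrix.of fun i => ![0, n₀ * a i], ?_, ?_⟩
  · refine tendsto_pi_nhds.mpr fun i => tendsto_pi_nhds.mpr (Fin.forall_fin_two.mpr ⟨?_, ?_⟩)
    · have := h0.mul (h i).2
      rw [zero_mul] at this
      exact this
    · exact (h i).1
  · refine tendsto_pi_nhds.mpr fun i => tendsto_pi_nhds.mpr (Fin.forall_fin_two.mpr ⟨?_, ?_⟩)
    · refine tendsto_const_nhds.congr fun k => ?_
      simp [Matrix.mul_apply, Fin.sum_univ_two]
    · have := hn.mul (h i).2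
      refine this.congr fun k => ?_
      simp [Matrix.mul_apply, Fin.sum_univ_two, mul_comm]

variable {c : ℝ} {κ ν : ℂ} {x t : ℝ}

/-- The factor `g` allows one statement to serve for plain limits (g = 1) and for residues (g = k -
p). -/
theorem tendsto_matrixOfRows {r r' : Fin 2 → ℂ → ℂ} {l : Filter ℂ} {g : ℂ → ℂ} {j : Fin 2} {a a' : ℂ}
    (h : Tendsto (fun k => g k * r j k) l (𝓝 a)) (h' : Tendsto (fun k => g k * r' j k) l (𝓝 a'))
    (i : Fin 2) : Tendsto (fun k => g k * matrixOfRows r r' k i j) l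
      (𝓝 ((![1 / 2, -I / 2] : Fin 2 → ℂ) i * a + (![1 / 2, I / 2] : Fin 2 → ℂ) i * a')) :=
  ((h.const_mul _).add (h'.const_mul _)).congr fun k => by
    simp only [matrixOfRows, Matrix.of_apply]; ring

theorem gc_neg (c x t : ℝ) (k : ℂ) : gc c x t (-k) = -gc c x t k := by
  rw [gc, gc, sqrtBranch_neg, neg_sq, mul_neg]

theorem isRHSolution_matrixOfRows (hc : 0 ≤ c) (hκ : κ.re ≠ 0) {C₁ C₂ : ℂ}
    (hC₁ : C₁ = I * ν * exp (2 * I * gc c x t κ))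
    (hC₂ : C₂ = I * starRingEnd ℂ ν * exp (2 * I * gc c x t (-starRingEnd ℂ κ)))
    {r r' : Fin 2 → ℂ → ℂ} (hr : IsRowSolution c κ (-starRingEnd ℂ κ) C₁ C₂ r)
    (hr' : IsRowSolution c κ (-starRingEnd ℂ κ) C₁ C₂ r')
    (has : ∀ i j, ∃ b, Tendsto (fun k => k * (matrixOfRows r r' k i j
      - (1 : Matrix (Fin 2) (Fin 2) ℂ) i j)) (cobounded ℂ) (𝓝 b)) :
    IsRHSolution c κ ν x t (matrixOfRows r r') := by
  have hκs : κ ∉ slit c := not_mem_slit_of_re_ne_zero hκ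
  have hκs' : -starRingEnd ℂ κ ∉ slit c := not_mem_slit_of_re_ne_zero (by simpa)
  have hκs'' : starRingEnd ℂ κ ∉ slit c := not_mem_slit_of_re_ne_zero (by simpa)
  have one : ∀ {f : ℂ → ℂ} {l : Filter ℂ} {a : ℂ}, Tendsto f l (𝓝 a) →
      Tendsto (fun k => (fun _ => (1 : ℂ)) k * f k) l (𝓝 a) := fun h => by simpa using h
  have lower : ∀ {p n₀ : ℂ} {n : ℂ → ℂ}, Tendsto n (𝓝[≠] p) (𝓝 n₀) →
      (∃ a, Tendsto (fun k => (k - p) * r 0 k) (𝓝[≠] p) (𝓝 (n₀ * a)) ∧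
        Tendsto (r 1) (𝓝[≠] p) (𝓝 a)) →
      (∃ a, Tendsto (fun k => (k - p) * r' 0 k) (𝓝[≠] p) (𝓝 (n₀ * a)) ∧
        Tendsto (r' 1) (𝓝[≠] p) (𝓝 a)) →
      PoleCondition (matrixOfRows r r') (fun k => !![0, 0; n k, 0]) p := by
    rintro p n₀ n hn ⟨a, ha1, ha2⟩ ⟨a', ha1', ha2'⟩
    refine PoleCondition.of_lower hn (fun i => (![1 / 2, -I / 2] : Fin 2 → ℂ) i * a
      + (![1 / 2, I / 2] : Fin 2 → ℂ) i * a') fun i => ⟨?_, ?_⟩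
    · convert tendsto_matrixOfRows ha1 ha1' i using 2
      ring
    · simpa using tendsto_matrixOfRows (one ha2) (one ha2') i
  have upper : ∀ {p n₀ : ℂ} {n : ℂ → ℂ}, Tendsto n (𝓝[≠] p) (𝓝 n₀) →
      (∃ a, Tendsto (fun k => (k - p) * r 1 k) (𝓝[≠] p) (𝓝 (n₀ * a)) ∧
        Tendsto (r 0) (𝓝[≠] p) (𝓝 a)) →
      (∃ a, Tendsto (fun k => (k - p) * r' 1 k) (𝓝[≠] p) (𝓝 (n₀ * a)) ∧
        Tendsto (r' 0) (𝓝[≠] p) (𝓝 a)) →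
      PoleCondition (matrixOfRows r r') (fun k => !![0, n k; 0, 0]) p := by
    rintro p n₀ n hn ⟨a, ha1, ha2⟩ ⟨a', ha1', ha2'⟩
    refine PoleCondition.of_upper hn (fun i => (![1 / 2, -I / 2] : Fin 2 → ℂ) i * a
      + (![1 / 2, I / 2] : Fin 2 → ℂ) i * a') fun i => ⟨?_, ?_⟩
    · convert tendsto_matrixOfRows ha1 ha1' i using 2
      ring
    · simpa using tendsto_matrixOfRows (one ha2) (one ha2') i
  refine ⟨fun i j k hk => ?_, fun s hs => ?_, ?_, ?_, ?_, ?_, fun i j => ?_, fun i j => ?_,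
    fun i j => ?_⟩
  · have hk1 : k ∉ slit c := fun h => hk (Or.inl h)
    have hk2 : k ∉ spectralPoints κ := fun h => hk (Or.inr h)
    simp only [spectralPoints, Set.mem_insert_iff, Set.mem_singleton_iff, not_or] at hk2
    obtain ⟨n1, n2, n3, n4⟩ := hk2
    have d := fun (s : Fin 2 → ℂ → ℂ) (h : IsRowSolution c κ (-starRingEnd ℂ κ) C₁ C₂ s) =>
      h.analytic j k hk1 n1 n4 n3 (by rwa [neg_neg])
    exact (((d r hr).const_mul _).add ((d r' hr').const_mul _)).differentiableWithinAt
  · obtain ⟨P, h1, h2, h3⟩ := hr.jump s hs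
    obtain ⟨P', h1', h2', h3'⟩ := hr'.jump s hs
    refine ⟨Matrix.of fun i j => (![1 / 2, -I / 2] : Fin 2 → ℂ) i * P j
      + (![1 / 2, I / 2] : Fin 2 → ℂ) i * P' j, _, ?_, ?_, rfl⟩
    · refine tendsto_pi_nhds.mpr fun i => tendsto_pi_nhds.mpr fun j => ?_
      simpa using tendsto_matrixOfRows (one (h1 j)) (one (h1' j)) i
    · refine tendsto_pi_nhds.mpr fun i => tendsto_pi_nhds.mpr (Fin.forall_fin_two.mpr ⟨?_, ?_⟩)
      · have := tendsto_matrixOfRows (one h2) (one h2') i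
        simp only [one_mul] at this
        convert this using 2
        simp only [jumpMatrix, Matrix.mul_apply, Fin.sum_univ_two, Matrix.of_apply, Matrix.cons_val_zero,
          Matrix.cons_val_one, Matrix.cons_val_fin_one]
        ring
      · have := tendsto_matrixOfRows (one h3) (one h3') i
        simp only [one_mul] at this
        convert this using 2
        simp only [jumpMatrix, Matrix.mul_apply, Fin.sum_univ_two, Matrix.of_apply, Matrix.cons_val_zero,
          Matrix.cons_val_one, Matrix.cons_val_fin_one]
        ring
  · refine lower (tendsto_residue_coefficient hc hκs _ _) ?_ ?_ <;> rw [← hC₁]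
    exacts [hr.lower₁, hr'.lower₁]
  · refine lower (tendsto_residue_coefficient hc hκs' _ _) ?_ ?_ <;> rw [← hC₂]
    exacts [hr.lower₂, hr'.lower₂]
  -- κ̄ is the negative of the second lower pole -κ̄. As g_c is odd, the coefficient at κ̄ is the
  -- same number as at -κ̄.
  · have e : I * starRingEnd ℂ ν * exp (-2 * I * gc c x t (starRingEnd ℂ κ)) = C₂ := by
      rw [hC₂, gc_neg]; ring_nf
    refine upper (tendsto_residue_coefficient hc hκs'' _ _) ?_ ?_ <;> rw [e]
    · simpa using hr.upper₂
    · simpa using hr'.upper₂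
  · have e : I * ν * exp (-2 * I * gc c x t (-κ)) = C₁ := by
      rw [hC₁, gc_neg]; ring_nf
    refine upper (tendsto_residue_coefficient hc (mt neg_mem_slit.mp hκs) _ _) ?_ ?_ <;> rw [e]
    exacts [hr.upper₁, hr'.upper₁]
  · exact ((hr.top j).const_mul_left _).add ((hr'.top j).const_mul_left _)
  · exact ((hr.bot j).const_mul_left _).add ((hr'.bot j).const_mul_left _)
  · obtain ⟨b, hb⟩ := has i j
    have h1 := hb.isBigO_one ℂ |>.mul (Asymptotics.isBigO_refl (fun k : ℂ => k⁻¹) (cobounded ℂ))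
    refine h1.congr' ?_ (Eventually.of_forall fun k => by simp)
    filter_upwards [eventually_ne_cobounded (0 : ℂ)] with k hk
    field_simp

theorem tendsto_rhRow (c : ℝ) (σ Y₁ Y₂ l₁ l₂ : ℂ) :
    Tendsto (fun k => k * (rhRow c σ Y₁ Y₂ l₁ l₂ 0 k - 1)) (cobounded ℂ)
      (𝓝 (σ * c / 2 - (Y₁ + Y₂))) ∧
    Tendsto (fun k => k * (rhRow c σ Y₁ Y₂ l₁ l₂ 1 k - σ * I)) (cobounded ℂ)
      (𝓝 (-(c * I) / 2 + σ * I * (Y₁ + Y₂))) := by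
  constructor
  · have := tendsto_mul_polarRow (Y₁ := Y₁) (Y₂ := Y₂) (l₁ := l₁) (l₂ := l₂) c (hasDerivAt_hypOne σ 0)
    have e1 : hypOne σ 0 = 1 := by simp [hypOne]
    have e2 : hypTwo σ 0 = σ * I := by simp [hypTwo]
    rw [e1, e2] at this
    change Tendsto (fun k => k * (polarRow c (hypOne σ) Y₁ Y₂ l₁ l₂ k - 1)) _ _
    convert this using 2
    linear_combination (σ * c / 2) * I_sq
  · have := tendsto_mul_polarRow (Y₁ := -Y₁) (Y₂ := -Y₂) (l₁ := -l₁) (l₂ := -l₂) c (hasDerivAt_hypTwo σ 0)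
    have e1 : hypOne σ 0 = 1 := by simp [hypOne]
    have e2 : hypTwo σ 0 = σ * I := by simp [hypTwo]
    rw [e1, e2] at this
    change Tendsto (fun k => k * (polarRow c (hypTwo σ) (-Y₁) (-Y₂) (-l₁) (-l₂) k - σ * I)) _ _
    convert this using 2
    ring

/-- The limits that define `q`, for the matrix built from the two rows. -/
theorem tendsto_matrixOfRows_rhRow (c : ℝ) (Y₁ Y₂ Y₁' Y₂' l₁ l₂ : ℂ) (i j : Fin 2) :
    Tendsto (fun k => k * (matrixOfRows (rhRow c 1 Y₁ Y₂ l₁ l₂) (rhRow c (-1) Y₁' Y₂' l₁ l₂) k i j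
      - (1 : Matrix (Fin 2) (Fin 2) ℂ) i j)) (cobounded ℂ)
      (𝓝 ((![![-(Y₁ + Y₂) / 2 - (Y₁' + Y₂') / 2, -I / 2 * (c - (Y₁ + Y₂ - (Y₁' + Y₂')))],
        ![-I / 2 * (c - (Y₁ + Y₂ - (Y₁' + Y₂'))), (Y₁ + Y₂) / 2 + (Y₁' + Y₂') / 2]] :
          Fin 2 → Fin 2 → ℂ) i j)) := by
  obtain ⟨h1, h2⟩ := tendsto_rhRow c 1 Y₁ Y₂ l₁ l₂
  obtain ⟨h1', h2'⟩ := tendsto_rhRow c (-1) Y₁' Y₂' l₁ l₂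
  fin_cases i <;> fin_cases j
  · convert (h1.const_mul (1 / 2)).add (h1'.const_mul (1 / 2)) using 2
    · simp [matrixOfRows]; ring
    · simp; ring
  · convert (h2.const_mul (1 / 2)).add (h2'.const_mul (1 / 2)) using 2
    · simp [matrixOfRows]; ring
    · simp; ring
  · convert (h1.const_mul (-I / 2)).add (h1'.const_mul (I / 2)) using 2
    · simp [matrixOfRows]; ring
    · simp; ring
  · convert (h2.const_mul (-I / 2)).add (h2'.const_mul (I / 2)) using 2 with k
    · simp [matrixOfRows]
      linear_combination (-k) * I_sq
    · simp
      linear_combination (Y₁ + Y₂ + Y₁' + Y₂') / 2 * I_sq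

end

/-! ### The real functions f, h and the breather -/

section

variable {c : ℝ} {κ ν : ℂ}

theorem chi_sq (hκ : κ ≠ 0) : chi c κ ^ 2 = κ ^ 2 + (c : ℂ) ^ 2 := sqrtBranch_sq hκ

theorem gc_eq (hκ : κ ≠ 0) (x t : ℝ) :
    gc c x t κ = chi c κ * (x + 2 * (2 * chi c κ ^ 2 - 3 * c ^ 2) * t) := by
  rw [chi_sq hκ, gc, chi]; ring

theorem gc_re (hκ : κ ≠ 0) (x t : ℝ) : (gc c x t κ).re = (chi c κ).re *
    (4 * ((chi c κ).re ^ 2 - 3 * (chi c κ).im ^ 2 - 3 / 2 * c ^ 2) * t + x) := by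
  rw [gc_eq hκ]
  simp [sq]
  ring

theorem gc_im (hκ : κ ≠ 0) (x t : ℝ) : (gc c x t κ).im = (chi c κ).im *
    (4 * (3 * (chi c κ).re ^ 2 - (chi c κ).im ^ 2 - 3 / 2 * c ^ 2) * t + x) := by
  rw [gc_eq hκ]
  simp [sq]
  ring

theorem norm_chi_sq (c : ℝ) (κ : ℂ) : ‖chi c κ‖ ^ 2 = (chi c κ).re ^ 2 + (chi c κ).im ^ 2 := by
  rw [← normSq_eq_norm_sq, normSq_apply]; ring

theorem cos_theta2 (c : ℝ) (κ : ℂ) : Real.cos (theta2 c κ) = (chi c κ).re / ‖chi c κ‖ := by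
  have h := abs_le.mp (abs_re_div_norm_le_one (chi c κ))
  rw [theta2, Real.cos_arccos h.1 h.2]

theorem sin_theta2 (h : 0 < (chi c κ).im) : Real.sin (theta2 c κ) = (chi c κ).im / ‖chi c κ‖ := by
  have hR : 0 < ‖chi c κ‖ := norm_pos_iff.mpr fun h0 => by simp [h0] at h
  rw [theta2, Real.sin_arccos, Real.sqrt_eq_iff_mul_self_eq_of_pos (by positivity)]
  have := norm_chi_sq c κ
  field_simp
  linarith

theorem Z_eq (c : ℝ) (κ : ℂ) (x t : ℝ) : Z c κ x t = x - speed c κ * t := by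
  rw [Z, speed]; ring

theorem gc_im_eq_Z (hκ : κ ≠ 0) (x t : ℝ) : (gc c x t κ).im = Z c κ x t * (chi c κ).im := by
  rw [gc_im hκ, Z]; ring

theorem gc_re_eq_phi (hκ : κ ≠ 0) (x t : ℝ) :
    2 * (gc c x t κ).re + theta1 ν - theta2 c κ = phi c κ ν x t := by
  rw [gc_re hκ, phi, Z, norm_chi_sq]; ring

theorem breatherNum_eq (hκ : κ ≠ 0) (x t : ℝ) : breatherNum c κ ν x t =
    ‖chi c κ‖ * Real.cos (phi c κ ν x t)
      + c * ‖ν‖ * (chi c κ).re ^ 2 / (2 * ‖chi c κ‖ ^ 2 * (chi c κ).im)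
        * Real.exp (-2 * Z c κ x t * (chi c κ).im) := by
  rw [breatherNum, gc_re_eq_phi hκ, gc_im_eq_Z hκ, mul_assoc (-2)]

theorem breatherDen_eq (hκ : κ ≠ 0) (x t : ℝ) : breatherDen c κ ν x t =
    ‖chi c κ‖ ^ 2 / ‖ν‖ * Real.exp (2 * Z c κ x t * (chi c κ).im)
      + (chi c κ).re ^ 2 * (‖chi c κ‖ ^ 2 - c ^ 2)
        / (4 * ‖chi c κ‖ ^ 2 * (chi c κ).im ^ 2) * ‖ν‖
        * Real.exp (-2 * Z c κ x t * (chi c κ).im)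
      + c * Real.sin (phi c κ ν x t - theta2 c κ) := by
  rw [breatherDen, ← gc_re_eq_phi hκ, gc_im_eq_Z hκ, mul_assoc (-2), mul_assoc 2 (Z c κ x t)]
  ring_nf

/-- The `x`-derivative of `h`. -/
noncomputable def breatherNumDeriv (c : ℝ) (κ ν : ℂ) (x t : ℝ) : ℝ :=
  -2 * (chi c κ).re * ‖chi c κ‖ * Real.sin (phi c κ ν x t)
    - 2 * (chi c κ).im * (c * ‖ν‖ * (chi c κ).re ^ 2 / (2 * ‖chi c κ‖ ^ 2 * (chi c κ).im))
      * Real.exp (-2 * Z c κ x t * (chi c κ).im)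

/-- The `x`-derivative of `f`. -/
noncomputable def breatherDenDeriv (c : ℝ) (κ ν : ℂ) (x t : ℝ) : ℝ :=
  2 * (chi c κ).im * (‖chi c κ‖ ^ 2 / ‖ν‖) * Real.exp (2 * Z c κ x t * (chi c κ).im)
    - 2 * (chi c κ).im * ((chi c κ).re ^ 2 * (‖chi c κ‖ ^ 2 - c ^ 2)
        / (4 * ‖chi c κ‖ ^ 2 * (chi c κ).im ^ 2) * ‖ν‖)
        * Real.exp (-2 * Z c κ x t * (chi c κ).im)
    + 2 * (chi c κ).re * c * Real.cos (phi c κ ν x t - theta2 c κ)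

theorem hasDerivAt_Z (c : ℝ) (κ : ℂ) (x t : ℝ) : HasDerivAt (fun y => Z c κ y t) 1 x :=
  (hasDerivAt_id x).add_const _

theorem hasDerivAt_phi (c : ℝ) (κ ν : ℂ) (x t : ℝ) :
    HasDerivAt (fun y => phi c κ ν y t) (2 * (chi c κ).re) x := by
  have := ((((((hasDerivAt_Z c κ x t).sub_const (8 * t * ‖chi c κ‖ ^ 2)).const_mul 2).mul_const
    (chi c κ).re).add_const (theta1 ν)).sub_const (theta2 c κ))
  simpa [phi] using! this

theorem hasDerivAt_breatherNum (hκ : κ ≠ 0) (x t : ℝ) :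
    HasDerivAt (fun y => breatherNum c κ ν y t) (breatherNumDeriv c κ ν x t) x := by
  simp only [breatherNum_eq hκ]
  have h1 := ((hasDerivAt_phi c κ ν x t).cos).const_mul ‖chi c κ‖
  have h2 := ((((hasDerivAt_Z c κ x t).const_mul (-2)).mul_const (chi c κ).im).exp).const_mul
    (c * ‖ν‖ * (chi c κ).re ^ 2 / (2 * ‖chi c κ‖ ^ 2 * (chi c κ).im))
  refine (h1.add h2).congr_deriv ?_
  rw [breatherNumDeriv]; ring

theorem hasDerivAt_breatherDen (hκ : κ ≠ 0) (x t : ℝ) :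
    HasDerivAt (fun y => breatherDen c κ ν y t) (breatherDenDeriv c κ ν x t) x := by
  simp only [breatherDen_eq hκ]
  have h1 := (((hasDerivAt_phi c κ ν x t).sub_const (theta2 c κ)).sin).const_mul c
  have h2 := ((((hasDerivAt_Z c κ x t).const_mul (-2)).mul_const (chi c κ).im).exp).const_mul
    ((chi c κ).re ^ 2 * (‖chi c κ‖ ^ 2 - c ^ 2) / (4 * ‖chi c κ‖ ^ 2 * (chi c κ).im ^ 2) * ‖ν‖)
  have h3 := ((((hasDerivAt_Z c κ x t).const_mul 2).mul_const (chi c κ).im).exp).const_mul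
    (‖chi c κ‖ ^ 2 / ‖ν‖)
  refine ((h3.add h2).add h1).congr_deriv ?_
  rw [breatherDenDeriv]; ring

theorem breather_eq (hκ : κ ≠ 0) (x t : ℝ) : breather c κ ν x t = c + 2 *
    ((breatherDen c κ ν x t * breatherNumDeriv c κ ν x t
      - breatherNum c κ ν x t * breatherDenDeriv c κ ν x t)
    / (breatherDen c κ ν x t ^ 2 + breatherNum c κ ν x t ^ 2)) := by
  rw [breather, (hasDerivAt_breatherNum hκ x t).deriv, (hasDerivAt_breatherDen hκ x t).deriv]

/-- The identity behind `f² + h² ≠ 0`: the part of `f` that does not contain `h` is positive. -/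
theorem breatherDen_mul_eq (hκ : κ ≠ 0) (hb : 0 < (chi c κ).im) (hν : ν ≠ 0) (x t s : ℝ)
    (hs : s = ‖ν‖ * Real.exp (-2 * Z c κ x t * (chi c κ).im)) :
    s * breatherDen c κ ν x t / ‖chi c κ‖ ^ 2 =
      (Real.sin (phi c κ ν x t) + c * (chi c κ).re * s / (2 * ‖chi c κ‖ ^ 3)) ^ 2
      + (s * (chi c κ).re / (2 * ‖chi c κ‖ * (chi c κ).im)) ^ 2
      + breatherNum c κ ν x t / ‖chi c κ‖ * (Real.cos (phi c κ ν x t)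
        - (c * (chi c κ).re ^ 2 / (2 * ‖chi c κ‖ ^ 3 * (chi c κ).im)
          + c * (chi c κ).im / ‖chi c κ‖ ^ 3) * s) := by
  have hR : 0 < ‖chi c κ‖ := norm_pos_iff.mpr fun h0 => by simp [h0] at hb
  have hn : 0 < ‖ν‖ := norm_pos_iff.mpr hν
  have hs0 : 0 < s := by rw [hs]; positivity
  have hR2 := norm_chi_sq c κ
  have hcs := Real.sin_sq_add_cos_sq (phi c κ ν x t)
  have hE : Real.exp (2 * Z c κ x t * (chi c κ).im) = ‖ν‖ / s := by
    rw [hs, show -2 * Z c κ x t * (chi c κ).im = -(2 * Z c κ x t * (chi c κ).im) by ring, Real.exp_neg]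
    field_simp
  have hE' : Real.exp (-2 * Z c κ x t * (chi c κ).im) = s / ‖ν‖ := by rw [hs]; field_simp
  rw [breatherDen_eq hκ, breatherNum_eq hκ, hE, hE', Real.sin_sub, cos_theta2, sin_theta2 hb]
  generalize Real.sin (phi c κ ν x t) = q at *
  generalize Real.cos (phi c κ ν x t) = p at *
  generalize ‖chi c κ‖ = R at *
  generalize (chi c κ).re = a at *
  generalize (chi c κ).im = b at *
  clear hs hE hE'
  have hb' := hb.ne'
  rw [← sub_eq_zero]
  -- The two sides differ by a combination of the relations sin² + cos² = 1 and χ₁² + χ₂² = |χ|².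
  trans (1 - q ^ 2 - p ^ 2) + a ^ 2 * c ^ 2 * s ^ 2 / (4 * R ^ 6 * b ^ 2) * (a ^ 2 + b ^ 2 - R ^ 2)
  · field_simp
    ring
  · rw [hR2]
    linear_combination -hcs

theorem breather_denominator_ne_zero (hκ : κ ≠ 0) (ha : 0 < (chi c κ).re) (hb : 0 < (chi c κ).im)
    (hν : ν ≠ 0) (x t : ℝ) : breatherDen c κ ν x t ^ 2 + breatherNum c κ ν x t ^ 2 ≠ 0 := by
  intro h
  have h1 : breatherDen c κ ν x t = 0 := by nlinarith [sq_nonneg (breatherDen c κ ν x t), sq_nonneg (breatherNum c κ ν x t)]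
  have h2 : breatherNum c κ ν x t = 0 := by nlinarith [sq_nonneg (breatherDen c κ ν x t), sq_nonneg (breatherNum c κ ν x t)]
  have h3 := breatherDen_mul_eq hκ hb hν x t _ rfl
  rw [h1, h2, mul_zero, zero_div, zero_div, zero_mul, add_zero] at h3
  have hR : 0 < ‖chi c κ‖ := norm_pos_iff.mpr fun h0 => by simp [h0] at hb
  have hn : 0 < ‖ν‖ := norm_pos_iff.mpr hν
  have : 0 < (‖ν‖ * Real.exp (-2 * Z c κ x t * (chi c κ).im) * (chi c κ).re
      / (2 * ‖chi c κ‖ * (chi c κ).im)) ^ 2 := by positivity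
  have := sq_nonneg (Real.sin (phi c κ ν x t) + c * (chi c κ).re
    * (‖ν‖ * Real.exp (-2 * Z c κ x t * (chi c κ).im)) / (2 * ‖chi c κ‖ ^ 3))
  linarith

theorem hasDerivAt_arctan_breather (hκ : κ ≠ 0) (x t : ℝ) (h : breatherDen c κ ν x t ≠ 0) :
    HasDerivAt (fun y => Real.arctan (breatherNum c κ ν y t / breatherDen c κ ν y t))
      ((breather c κ ν x t - c) / 2) x := by
  have h1 := ((hasDerivAt_breatherNum (c := c) (ν := ν) hκ x t).div
    (hasDerivAt_breatherDen hκ x t) h).arctan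
  refine h1.congr_deriv ?_
  have h2 : breatherDen c κ ν x t ^ 2 + breatherNum c κ ν x t ^ 2 ≠ 0 := by positivity
  rw [breather_eq hκ]
  have h3 : 1 + (breatherNum c κ ν x t / breatherDen c κ ν x t) ^ 2 ≠ 0 := by positivity
  simp only [Pi.div_apply]
  field_simp
  ring

/-- In the moving frame Z is constant and φ decreases at the rate 16|χ|²χ₁, hence by 2π over one
period. -/
theorem breather_periodic (hκ : κ ≠ 0) (ha : 0 < (chi c κ).re) (ξ : ℝ) :
    Function.Periodic (fun t => breather c κ ν (ξ + speed c κ * t) t) (period c κ) := by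
  have hR : 0 < ‖chi c κ‖ := norm_pos_iff.mpr fun h0 => by simp [h0] at ha
  intro t
  have hZ : Z c κ (ξ + speed c κ * (t + period c κ)) (t + period c κ)
      = Z c κ (ξ + speed c κ * t) t := by rw [Z_eq, Z_eq]; ring
  have hφ : phi c κ ν (ξ + speed c κ * (t + period c κ)) (t + period c κ)
      = phi c κ ν (ξ + speed c κ * t) t - 2 * Real.pi := by
    rw [phi, hZ, phi, period]
    field_simp
    ring
  have hc' : Real.cos (phi c κ ν (ξ + speed c κ * t) t - 2 * Real.pi - theta2 c κ)
      = Real.cos (phi c κ ν (ξ + speed c κ * t) t - theta2 c κ) := by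
    rw [sub_right_comm, Real.cos_sub_two_pi]
  have hs' : Real.sin (phi c κ ν (ξ + speed c κ * t) t - 2 * Real.pi - theta2 c κ)
      = Real.sin (phi c κ ν (ξ + speed c κ * t) t - theta2 c κ) := by
    rw [sub_right_comm, Real.sin_sub_two_pi]
  simp only [breather_eq hκ, breatherNum_eq hκ, breatherDen_eq hκ, breatherNumDeriv,
    breatherDenDeriv, hZ, hφ, Real.cos_sub_two_pi, Real.sin_sub_two_pi, hc', hs']

/-- Z and φ are independent affine coordinates on the (x, t)-plane. -/
theorem exists_Z_phi (ha : 0 < (chi c κ).re) (z : ℝ) :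
    ∃ x t : ℝ, Z c κ x t = z ∧ phi c κ ν x t = 0 := by
  have hR : 0 < ‖chi c κ‖ := norm_pos_iff.mpr fun h0 => by simp [h0] at ha
  set t := (z + (theta1 ν - theta2 c κ) / (2 * (chi c κ).re)) / (8 * ‖chi c κ‖ ^ 2) with ht
  have h1 : Z c κ (z + speed c κ * t) t = z := by rw [Z_eq]; ring
  refine ⟨z + speed c κ * t, t, h1, ?_⟩
  rw [phi, h1, ht]
  field_simp
  ring

theorem exists_breather_ne (hκ : κ ≠ 0) (ha : 0 < (chi c κ).re) (hb : 0 < (chi c κ).im)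
    (hν : ν ≠ 0) : ∃ x t : ℝ, breather c κ ν x t ≠ c := by
  by_contra! hall
  have hR : 0 < ‖chi c κ‖ := norm_pos_iff.mpr fun h0 => by simp [h0] at ha
  have hn : 0 < ‖ν‖ := norm_pos_iff.mpr hν
  -- On the line φ = 0 put E = e^{2Zχ₂}. In the numerator f hₓ - h fₓ the terms in E⁻² cancel, so E
  -- times it is a quadratic polynomial with nonzero leading coefficient. If q were c everywhere, it
  -- would vanish for all E > 0.
  obtain ⟨u, v, huv⟩ : ∃ u v : ℝ, ∀ E : ℝ, 0 < E →
      -2 * (chi c κ).im * ‖chi c κ‖ * (‖chi c κ‖ ^ 2 / ‖ν‖) * E ^ 2 + u * E + v = 0 := by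
    set D := c * ‖ν‖ * (chi c κ).re ^ 2 / (2 * ‖chi c κ‖ ^ 2 * (chi c κ).im) with hD
    set B := (chi c κ).re ^ 2 * (‖chi c κ‖ ^ 2 - c ^ 2)
      / (4 * ‖chi c κ‖ ^ 2 * (chi c κ).im ^ 2) * ‖ν‖ with hB
    refine ⟨-4 * (chi c κ).im * D * (‖chi c κ‖ ^ 2 / ‖ν‖)
        - 2 * (chi c κ).re * c * Real.cos (theta2 c κ) * ‖chi c κ‖,
      2 * (chi c κ).im * c * Real.sin (theta2 c κ) * D + 2 * (chi c κ).im * B * ‖chi c κ‖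
        - 2 * (chi c κ).re * c * Real.cos (theta2 c κ) * D, fun E hE => ?_⟩
    · obtain ⟨x, t, hZ, hφ⟩ := exists_Z_phi (ν := ν) ha (Real.log E / (2 * (chi c κ).im))
      have h1 := hall x t
      rw [breather_eq hκ] at h1
      have h2 : breatherDen c κ ν x t * breatherNumDeriv c κ ν x t
          - breatherNum c κ ν x t * breatherDenDeriv c κ ν x t = 0 := by
        have := breather_denominator_ne_zero hκ ha hb hν x t
        have h3 : (breatherDen c κ ν x t * breatherNumDeriv c κ ν x t
          - breatherNum c κ ν x t * breatherDenDeriv c κ ν x t)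
          / (breatherDen c κ ν x t ^ 2 + breatherNum c κ ν x t ^ 2) = 0 := by linarith
        exact (div_eq_zero_iff.mp h3).resolve_right this
      have e1 : Real.exp (2 * Z c κ x t * (chi c κ).im) = E := by
        rw [hZ]
        rw [show 2 * (Real.log E / (2 * (chi c κ).im)) * (chi c κ).im = Real.log E by field_simp,
          Real.exp_log hE]
      have e2 : Real.exp (-2 * Z c κ x t * (chi c κ).im) = E⁻¹ := by
        rw [← e1, ← Real.exp_neg]; ring_nf
      rw [breatherNum_eq hκ, breatherDen_eq hκ, breatherNumDeriv, breatherDenDeriv, e1, e2, hφ,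
        Real.cos_zero, Real.sin_zero, zero_sub, Real.sin_neg, Real.cos_neg, ← hD, ← hB] at h2
      have h4 := congrArg (· * E) h2
      simp only [zero_mul] at h4
      rw [← h4]
      generalize ‖chi c κ‖ ^ 2 / ‖ν‖ = A
      field_simp
      ring
  -- The second difference over E = 1, 2, 3 isolates the leading coefficient.
  have e1 := huv 1 one_pos
  have e2 := huv 2 two_pos
  have e3 := huv 3 three_pos
  have : 0 < (chi c κ).im * ‖chi c κ‖ * (‖chi c κ‖ ^ 2 / ‖ν‖) := by positivity
  nlinarith

end

/-! ### Two-soliton tau functions, Hirota equations and mKdV -/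

section

/-- The exponential `e^{2i l (x + 2 (2l² - 3c²) t)}`, with its amplitude. -/
noncomputable def solitonTerm (c : ℝ) (σ n l : ℂ) (x t : ℝ) : ℂ :=
  n * (c - σ * l) / (2 * l ^ 2) * exp (2 * I * l * x + 4 * I * l * (2 * l ^ 2 - 3 * c ^ 2) * t)

/-- The derivatives `∂ₓᵐ ∂ₜⁿ` of the two-soliton tau function. -/
noncomputable def tauJet (c : ℝ) (σ n₁ n₂ l₁ l₂ : ℂ) (m n : ℕ) (x t : ℝ) : ℂ :=
  -- The constant term 1 of tau: since `0 ^ 0 = 1`, it is present only for m = n = 0.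
  0 ^ m * 0 ^ n
    + (2 * I * l₁) ^ m * (4 * I * l₁ * (2 * l₁ ^ 2 - 3 * c ^ 2)) ^ n * solitonTerm c σ n₁ l₁ x t
    + (2 * I * l₂) ^ m * (4 * I * l₂ * (2 * l₂ ^ 2 - 3 * c ^ 2)) ^ n * solitonTerm c σ n₂ l₂ x t
    + (2 * I * l₁ + 2 * I * l₂) ^ m
      * (4 * I * l₁ * (2 * l₁ ^ 2 - 3 * c ^ 2) + 4 * I * l₂ * (2 * l₂ ^ 2 - 3 * c ^ 2)) ^ n
      * ((l₁ - l₂) / (l₁ + l₂)) ^ 2 * (solitonTerm c σ n₁ l₁ x t * solitonTerm c σ n₂ l₂ x t)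

theorem hasDerivAt_solitonTerm_x (c : ℝ) (σ n l : ℂ) (x t : ℝ) :
    HasDerivAt (fun y => solitonTerm c σ n l y t) (2 * I * l * solitonTerm c σ n l x t) x := by
  have h1 := ((((hasDerivAt_id x).ofReal_comp.const_mul (2 * I * l)).add_const
    (4 * I * l * (2 * l ^ 2 - 3 * c ^ 2) * t)).cexp).const_mul (n * (c - σ * l) / (2 * l ^ 2))
  refine h1.congr_deriv ?_
  simp only [solitonTerm, id, ofReal_one]; ring

theorem hasDerivAt_solitonTerm_t (c : ℝ) (σ n l : ℂ) (x t : ℝ) :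
    HasDerivAt (fun s => solitonTerm c σ n l x s)
      (4 * I * l * (2 * l ^ 2 - 3 * c ^ 2) * solitonTerm c σ n l x t) t := by
  have h1 := ((((hasDerivAt_id t).ofReal_comp.const_mul
    (4 * I * l * (2 * l ^ 2 - 3 * c ^ 2))).const_add (2 * I * l * x)).cexp).const_mul
    (n * (c - σ * l) / (2 * l ^ 2))
  refine h1.congr_deriv ?_
  simp only [solitonTerm, id, ofReal_one]; ring

theorem hasDerivAt_tauJet_x (c : ℝ) (σ n₁ n₂ l₁ l₂ : ℂ) (m n : ℕ) (x t : ℝ) :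
    HasDerivAt (fun y => tauJet c σ n₁ n₂ l₁ l₂ m n y t) (tauJet c σ n₁ n₂ l₁ l₂ (m + 1) n x t) x := by
  have h1 := hasDerivAt_solitonTerm_x c σ n₁ l₁ x t
  have h2 := hasDerivAt_solitonTerm_x c σ n₂ l₂ x t
  refine ((((h1.const_mul _).const_add _).add (h2.const_mul _)).add
    ((h1.mul h2).const_mul _)).congr_deriv ?_
  rw [tauJet]; ring

theorem hasDerivAt_tauJet_t (c : ℝ) (σ n₁ n₂ l₁ l₂ : ℂ) (m n : ℕ) (x t : ℝ) :
    HasDerivAt (fun s => tauJet c σ n₁ n₂ l₁ l₂ m n x s) (tauJet c σ n₁ n₂ l₁ l₂ m (n + 1) x t) t := by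
  have h1 := hasDerivAt_solitonTerm_t c σ n₁ l₁ x t
  have h2 := hasDerivAt_solitonTerm_t c σ n₂ l₂ x t
  refine ((((h1.const_mul _).const_add _).add (h2.const_mul _)).add
    ((h1.mul h2).const_mul _)).congr_deriv ?_
  rw [tauJet]; ring

theorem contDiff_solitonTerm (c : ℝ) (σ n l : ℂ) :
    ContDiff ℝ ∞ fun p : ℝ × ℝ => solitonTerm c σ n l p.1 p.2 := by
  unfold solitonTerm
  have h1 : ContDiff ℝ ∞ fun p : ℝ × ℝ => (p.1 : ℂ) := ofRealCLM.contDiff.comp contDiff_fst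
  have h2 : ContDiff ℝ ∞ fun p : ℝ × ℝ => (p.2 : ℂ) := ofRealCLM.contDiff.comp contDiff_snd
  exact contDiff_const.mul ((contDiff_const.mul h1).add (contDiff_const.mul h2)).cexp

theorem contDiff_tauJet (c : ℝ) (σ n₁ n₂ l₁ l₂ : ℂ) (m n : ℕ) :
    ContDiff ℝ ∞ fun p : ℝ × ℝ => tauJet c σ n₁ n₂ l₁ l₂ m n p.1 p.2 := by
  have h1 := contDiff_solitonTerm c σ n₁ l₁
  have h2 := contDiff_solitonTerm c σ n₂ l₂
  unfold tauJet
  exact ((contDiff_const.add (contDiff_const.mul h1)).add (contDiff_const.mul h2)).add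
    (contDiff_const.mul (h1.mul h2))

variable {c : ℝ} {n₁ n₂ l₁ l₂ : ℂ}

/-- Separating the factor that depends on σ leaves the same exponentials in F (σ = 1) and G (σ =
-1). They can then be treated as free variables X, Y, and the Hirota equations become rational
identities. -/
theorem solitonTerm_eq (c : ℝ) (σ n l : ℂ) (x t : ℝ) : solitonTerm c σ n l x t =
    (c - σ * l) * (n / (2 * l ^ 2)
      * exp (2 * I * l * x + 4 * I * l * (2 * l ^ 2 - 3 * c ^ 2) * t)) := by
  rw [solitonTerm]; ring

/-- The first Hirota equation `Dₓ² F·G = -2ic Dₓ F·G`. -/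
theorem hirota_one (h : l₁ + l₂ ≠ 0) (x t : ℝ) {F G : ℕ → ℕ → ℂ}
    (hF : F = fun m n => tauJet c 1 n₁ n₂ l₁ l₂ m n x t)
    (hG : G = fun m n => tauJet c (-1) n₁ n₂ l₁ l₂ m n x t) :
    F 2 0 * G 0 0 - 2 * F 1 0 * G 1 0 + F 0 0 * G 2 0
      + 2 * I * c * (F 1 0 * G 0 0 - F 0 0 * G 1 0) = 0 := by
  subst hF hG
  simp only [tauJet, solitonTerm_eq]
  generalize n₁ / (2 * l₁ ^ 2) * exp (2 * I * l₁ * x + 4 * I * l₁ * (2 * l₁ ^ 2 - 3 * c ^ 2) * t) = X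
  generalize n₂ / (2 * l₂ ^ 2) * exp (2 * I * l₂ * x + 4 * I * l₂ * (2 * l₂ ^ 2 - 3 * c ^ 2) * t) = Y
  field_simp
  ring

/-- The second Hirota equation `(D_t + Dₓ³ + 6c² Dₓ) F·G = 0`. -/
theorem hirota_two (h : l₁ + l₂ ≠ 0) (x t : ℝ) {F G : ℕ → ℕ → ℂ}
    (hF : F = fun m n => tauJet c 1 n₁ n₂ l₁ l₂ m n x t)
    (hG : G = fun m n => tauJet c (-1) n₁ n₂ l₁ l₂ m n x t) :
    F 0 1 * G 0 0 - F 0 0 * G 0 1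
      + (F 3 0 * G 0 0 - 3 * F 2 0 * G 1 0 + 3 * F 1 0 * G 2 0 - F 0 0 * G 3 0)
      + 6 * c ^ 2 * (F 1 0 * G 0 0 - F 0 0 * G 1 0) = 0 := by
  subst hF hG
  simp only [tauJet, solitonTerm_eq]
  generalize n₁ / (2 * l₁ ^ 2) * exp (2 * I * l₁ * x + 4 * I * l₁ * (2 * l₁ ^ 2 - 3 * c ^ 2) * t) = X
  generalize n₂ / (2 * l₂ ^ 2) * exp (2 * I * l₂ * x + 4 * I * l₂ * (2 * l₂ ^ 2 - 3 * c ^ 2) * t) = Y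
  field_simp
  have hI : I ^ 3 = -I := I_pow_three
  ring_nf
  simp only [hI]
  ring

theorem hasDerivAt_re {f : ℝ → ℂ} {f' : ℂ} {x : ℝ} (h : HasDerivAt f f' x) :
    HasDerivAt (fun y => (f y).re) f'.re x :=
  reCLM.hasFDerivAt.comp_hasDerivAt x h

/-- The Hirota equations imply the modified Korteweg-de Vries equation. -/
theorem mkdv_of_hirota {F G : ℕ → ℕ → ℝ → ℝ → ℂ}
    (hFx : ∀ m n x t, HasDerivAt (fun y => F m n y t) (F (m + 1) n x t) x)
    (hFt : ∀ m n x t, HasDerivAt (fun s => F m n x s) (F m (n + 1) x t) t)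
    (hGx : ∀ m n x t, HasDerivAt (fun y => G m n y t) (G (m + 1) n x t) x)
    (hGt : ∀ m n x t, HasDerivAt (fun s => G m n x s) (G m (n + 1) x t) t)
    (hF : ∀ x t, F 0 0 x t ≠ 0) (hG : ∀ x t, G 0 0 x t ≠ 0)
    (h₁ : ∀ x t, F 2 0 x t * G 0 0 x t - 2 * F 1 0 x t * G 1 0 x t + F 0 0 x t * G 2 0 x t
      + 2 * I * c * (F 1 0 x t * G 0 0 x t - F 0 0 x t * G 1 0 x t) = 0)
    (h₂ : ∀ x t, F 0 1 x t * G 0 0 x t - F 0 0 x t * G 0 1 x t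
      + (F 3 0 x t * G 0 0 x t - 3 * F 2 0 x t * G 1 0 x t + 3 * F 1 0 x t * G 2 0 x t
        - F 0 0 x t * G 3 0 x t)
      + 6 * c ^ 2 * (F 1 0 x t * G 0 0 x t - F 0 0 x t * G 1 0 x t) = 0)
    {q : ℝ → ℝ → ℝ}
    (hq : ∀ x t, (q x t : ℂ) = c - I * (F 1 0 x t / F 0 0 x t - G 1 0 x t / G 0 0 x t)) (x t : ℝ) :
    deriv (fun s => q x s) t + 6 * q x t ^ 2 * deriv (fun y => q y t) x
      + iteratedDeriv 3 (fun y => q y t) x = 0 := by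
  set Q : ℝ → ℝ → ℂ := fun x t => c - I * (F 1 0 x t / F 0 0 x t - G 1 0 x t / G 0 0 x t) with hQ
  set Q₁ : ℝ → ℝ → ℂ := fun x t => -I * ((F 2 0 x t / F 0 0 x t - (F 1 0 x t / F 0 0 x t) ^ 2)
    - (G 2 0 x t / G 0 0 x t - (G 1 0 x t / G 0 0 x t) ^ 2)) with hQ₁
  set Q₂ : ℝ → ℝ → ℂ := fun x t => -I * ((F 3 0 x t / F 0 0 x t
      - 3 * (F 1 0 x t / F 0 0 x t) * (F 2 0 x t / F 0 0 x t) + 2 * (F 1 0 x t / F 0 0 x t) ^ 3)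
    - (G 3 0 x t / G 0 0 x t
      - 3 * (G 1 0 x t / G 0 0 x t) * (G 2 0 x t / G 0 0 x t) + 2 * (G 1 0 x t / G 0 0 x t) ^ 3))
    with hQ₂
  set P : ℝ → ℝ → ℂ := fun x t => -I * (F 0 1 x t / F 0 0 x t - G 0 1 x t / G 0 0 x t) with hP
  set Qt : ℝ → ℝ → ℂ := fun x t => -I * ((F 1 1 x t / F 0 0 x t
      - F 1 0 x t * F 0 1 x t / F 0 0 x t ^ 2)
    - (G 1 1 x t / G 0 0 x t - G 1 0 x t * G 0 1 x t / G 0 0 x t ^ 2)) with hQt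
  have dF : ∀ m n x t, HasDerivAt (fun y => F m n y t / F 0 0 y t)
      (F (m + 1) n x t / F 0 0 x t - F m n x t * F 1 0 x t / F 0 0 x t ^ 2) x := fun m n x t =>
    ((hFx m n x t).div (hFx 0 0 x t) (hF x t)).congr_deriv (by field_simp [hF x t])
  have dG : ∀ m n x t, HasDerivAt (fun y => G m n y t / G 0 0 y t)
      (G (m + 1) n x t / G 0 0 x t - G m n x t * G 1 0 x t / G 0 0 x t ^ 2) x := fun m n x t =>
    ((hGx m n x t).div (hGx 0 0 x t) (hG x t)).congr_deriv (by field_simp [hG x t])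
  have d0 : ∀ x t, HasDerivAt (fun y => Q y t) (Q₁ x t) x := fun x t =>
    ((((dF 1 0 x t).sub (dG 1 0 x t)).const_mul I).const_sub (c : ℂ)).congr_deriv (by
      simp only [hQ₁]; ring)
  have d1 : ∀ x t, HasDerivAt (fun y => Q₁ y t) (Q₂ x t) x := fun x t =>
    ((((dF 2 0 x t).sub ((dF 1 0 x t).pow 2)).sub
      ((dG 2 0 x t).sub ((dG 1 0 x t).pow 2))).const_mul (-I)).congr_deriv (by
      simp only [hQ₂]; push_cast; ring)
  have dP : ∀ x t, HasDerivAt (fun y => P y t) (Qt x t) x := fun x t =>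
    (((dF 0 1 x t).sub (dG 0 1 x t)).const_mul (-I)).congr_deriv (by simp only [hQt]; ring)
  have dt : ∀ x t, HasDerivAt (fun s => Q x s) (Qt x t) t := fun x t => by
    have e1 := (hFt 1 0 x t).div (hFt 0 0 x t) (hF x t)
    have e2 := (hGt 1 0 x t).div (hGt 0 0 x t) (hG x t)
    refine (((e1.sub e2).const_mul I).const_sub (c : ℂ)).congr_deriv ?_
    have := hF x t
    have := hG x t
    simp only [hQt]
    field_simp
  -- This is mKdV integrated once in x. It is a combination of the Hirota equations divided by FG,
  -- where only logarithmic-type quotients of F and of G remain.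
  have key : ∀ x t, Q₂ x t = 2 * c ^ 3 - P x t - 2 * Q x t ^ 3 := fun x t => by
    have hF' := hF x t
    have hG' := hG x t
    have b1 : F 2 0 x t / F 0 0 x t - 2 * (F 1 0 x t / F 0 0 x t) * (G 1 0 x t / G 0 0 x t)
        + G 2 0 x t / G 0 0 x t
        + 2 * I * c * (F 1 0 x t / F 0 0 x t - G 1 0 x t / G 0 0 x t) = 0 := by
      field_simp
      linear_combination h₁ x t
    have b2 : F 0 1 x t / F 0 0 x t - G 0 1 x t / G 0 0 x t + (F 3 0 x t / F 0 0 x t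
        - 3 * (F 2 0 x t / F 0 0 x t) * (G 1 0 x t / G 0 0 x t)
        + 3 * (F 1 0 x t / F 0 0 x t) * (G 2 0 x t / G 0 0 x t) - G 3 0 x t / G 0 0 x t)
        + 6 * c ^ 2 * (F 1 0 x t / F 0 0 x t - G 1 0 x t / G 0 0 x t) = 0 := by
      field_simp
      linear_combination h₂ x t
    simp only [hQ₂, hP, hQ]
    generalize F 1 0 x t / F 0 0 x t = a at *
    generalize F 2 0 x t / F 0 0 x t = a₂ at *
    generalize F 3 0 x t / F 0 0 x t = a₃ at *
    generalize F 0 1 x t / F 0 0 x t = a' at *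
    generalize G 1 0 x t / G 0 0 x t = b at *
    generalize G 2 0 x t / G 0 0 x t = b₂ at *
    generalize G 3 0 x t / G 0 0 x t = b₃ at *
    generalize G 0 1 x t / G 0 0 x t = b' at *
    linear_combination (-I) * b2 + 3 * I * (a - b) * b1
      + (-2 * I * (a - b) ^ 3) * I_sq
  -- The third derivative is obtained by differentiating `key`: the x-derivative of P is the
  -- t-derivative of Q, as both are the mixed derivative of -i log(F/G).
  have d2 : ∀ x t, HasDerivAt (fun y => Q₂ y t) (-Qt x t - 6 * Q x t ^ 2 * Q₁ x t) x := fun x t => by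
    simp only [key]
    refine (((dP x t).const_sub (2 * (c : ℂ) ^ 3)).sub (((d0 x t).pow 3).const_mul 2)).congr_deriv ?_
    push_cast
    ring
  have hqQ : ∀ x t, q x t = (Q x t).re := fun x t => by rw [← ofReal_re (q x t), hq]
  simp only [hqQ]
  have r0 : deriv (fun y => (Q y t).re) = fun y => (Q₁ y t).re :=
    funext fun y => (hasDerivAt_re (d0 y t)).deriv
  have r1 : deriv (fun y => (Q₁ y t).re) = fun y => (Q₂ y t).re :=
    funext fun y => (hasDerivAt_re (d1 y t)).deriv
  have r3 : iteratedDeriv 3 (fun y => (Q y t).re) x = (-Qt x t - 6 * Q x t ^ 2 * Q₁ x t).re := by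
    rw [iteratedDeriv_succ, iteratedDeriv_succ, iteratedDeriv_one, r0, r1]
    exact (hasDerivAt_re (d2 x t)).deriv
  rw [r3, (hasDerivAt_re (dt x t)).deriv, r0]
  -- Q is real, so taking real parts passes through the factor Q² in the nonlinear term.
  have hQr : Q x t = ((Q x t).re : ℂ) := by rw [← hqQ, hq]
  have e : (-Qt x t - 6 * Q x t ^ 2 * Q₁ x t).re
      = -(Qt x t).re - 6 * (Q x t).re ^ 2 * (Q₁ x t).re := by
    rw [show -Qt x t - 6 * Q x t ^ 2 * Q₁ x t
      = -Qt x t - ((6 * (Q x t).re ^ 2 : ℝ) : ℂ) * Q₁ x t by push_cast; rw [← hQr],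
      sub_re, neg_re, re_ofReal_mul]
  rw [e]
  ring

theorem contDiff_of_tau {F G F₁ G₁ : ℝ → ℝ → ℂ} {q : ℝ → ℝ → ℝ}
    (hF : ContDiff ℝ ∞ fun p : ℝ × ℝ => F p.1 p.2) (hG : ContDiff ℝ ∞ fun p : ℝ × ℝ => G p.1 p.2)
    (hF₁ : ContDiff ℝ ∞ fun p : ℝ × ℝ => F₁ p.1 p.2)
    (hG₁ : ContDiff ℝ ∞ fun p : ℝ × ℝ => G₁ p.1 p.2)
    (hF0 : ∀ x t, F x t ≠ 0) (hG0 : ∀ x t, G x t ≠ 0)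
    (hq : ∀ x t, (q x t : ℂ) = c - I * (F₁ x t / F x t - G₁ x t / G x t)) :
    ContDiff ℝ ∞ fun p : ℝ × ℝ => q p.1 p.2 := by
  have h : (fun p : ℝ × ℝ => q p.1 p.2) = fun p => reCLM
      ((c : ℂ) - I * (F₁ p.1 p.2 / F p.1 p.2 - G₁ p.1 p.2 / G p.1 p.2)) := by
    funext p
    rw [← hq, reCLM_apply, ofReal_re]
  rw [h]
  simp only [div_eq_mul_inv]
  exact reCLM.contDiff.comp (contDiff_const.sub (contDiff_const.mul
    ((hF₁.mul (hF.inv fun p => hF0 _ _)).sub (hG₁.mul (hG.inv fun p => hG0 _ _)))))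

end

/-! ### Tau function versus f + ih, and solvability of the problem -/

section

variable {c : ℝ} {κ ν : ℂ}

/-- This converts the coefficients of the linear system into soliton terms, e = -2lS; the system's
determinant becomes tau and its Cramer numerator becomes i ∂ₓ tau. -/
theorem residue_amplitude_eq {σ n : ℂ} (hσ : σ ^ 2 = 1) (hκ : κ ≠ 0) (hχ : chi c κ ≠ 0) (x t : ℝ) :
    I * σ * (I * n * exp (2 * I * gc c x t κ)) * (σ * c - chi c κ) / chi c κ
      = -2 * chi c κ * solitonTerm c σ n (chi c κ) x t := by
  rw [gc_eq hκ, solitonTerm, show 2 * I * (chi c κ * (x + 2 * (2 * chi c κ ^ 2 - 3 * c ^ 2) * t))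
    = 2 * I * chi c κ * x + 4 * I * chi c κ * (2 * chi c κ ^ 2 - 3 * c ^ 2) * t by ring]
  generalize exp _ = E
  field_simp
  linear_combination (n * E * (c * σ ^ 2 - σ * chi c κ)) * I_sq - n * E * c * hσ

theorem tau_eq_tauJet {c : ℝ} {σ n₁ n₂ l₁ l₂ : ℂ} (h₁ : l₁ ≠ 0) (h₂ : l₂ ≠ 0) (h : l₁ + l₂ ≠ 0)
    (x t : ℝ) :
    tau (-2 * l₁ * solitonTerm c σ n₁ l₁ x t) (-2 * l₂ * solitonTerm c σ n₂ l₂ x t) l₁ l₂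
      = tauJet c σ n₁ n₂ l₁ l₂ 0 0 x t := by
  rw [tau, tauJet]
  field_simp
  ring

theorem tau_numerator_eq_tauJet {c : ℝ} {σ n₁ n₂ l₁ l₂ e₁ e₂ : ℂ} (h₁ : l₁ ≠ 0) (h₂ : l₂ ≠ 0)
    (h : l₁ + l₂ ≠ 0) (x t : ℝ) (he₁ : e₁ = -2 * l₁ * solitonTerm c σ n₁ l₁ x t)
    (he₂ : e₂ = -2 * l₂ * solitonTerm c σ n₂ l₂ x t) :
    e₁ + e₂ + e₁ * e₂ * (2 / (l₁ + l₂) - 1 / (2 * l₁) - 1 / (2 * l₂))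
      = I * tauJet c σ n₁ n₂ l₁ l₂ 1 0 x t := by
  subst he₁ he₂
  rw [tauJet]
  have hI := I_sq
  field_simp
  ring_nf
  simp only [hI]
  ring

/-- The tau function of the breather and its derivatives. -/
noncomputable def breatherTau (c : ℝ) (κ ν σ : ℂ) (m n : ℕ) (x t : ℝ) : ℂ :=
  tauJet c σ ν (starRingEnd ℂ ν) (chi c κ) (-starRingEnd ℂ (chi c κ)) m n x t

theorem conj_solitonTerm (c : ℝ) (σ : ℝ) (n l : ℂ) (x t : ℝ) :
    starRingEnd ℂ (solitonTerm c σ n l x t)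
      = solitonTerm c (-σ) (starRingEnd ℂ n) (-starRingEnd ℂ l) x t := by
  rw [solitonTerm, solitonTerm]
  simp only [map_mul, map_div₀, map_sub, map_add, map_pow, conj_ofReal, conj_I, map_ofNat, ← exp_conj,
    neg_sq, neg_mul_neg]
  congr 2
  ring

/-- Conjugation combined with σ ↦ -σ exchanges the two soliton terms, because l₂ = -l̄₁ and n₂ =
n̄₁; the interaction coefficient is real. This is what makes q real. -/
theorem conj_breatherTau (c : ℝ) (κ ν : ℂ) (m n : ℕ) (x t : ℝ) :
    starRingEnd ℂ (breatherTau c κ ν 1 m n x t) = breatherTau c κ ν (-1) m n x t := by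
  have h1 := conj_solitonTerm c 1 ν (chi c κ) x t
  have h2 := conj_solitonTerm c 1 (starRingEnd ℂ ν) (-starRingEnd ℂ (chi c κ)) x t
  simp only [ofReal_one, map_neg, conj_conj, neg_neg] at h1 h2
  rw [breatherTau, breatherTau, tauJet, tauJet]
  simp only [map_mul, map_div₀, map_sub, map_add, map_pow, conj_I, map_ofNat, map_zero, map_neg,
    conj_conj, conj_ofReal, h1, h2]
  have h3 : ((starRingEnd ℂ (chi c κ) - -chi c κ) / (starRingEnd ℂ (chi c κ) + -chi c κ)) ^ 2
      = ((chi c κ - -starRingEnd ℂ (chi c κ)) / (chi c κ + -starRingEnd ℂ (chi c κ))) ^ 2 := by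
    rw [← sub_eq_add_neg, ← sub_eq_add_neg, sub_neg_eq_add, sub_neg_eq_add,
      ← neg_sub (chi c κ), div_neg, neg_sq, add_comm]
  rw [h3]
  ring

/-- The absolute value of the residue coefficient. -/
noncomputable def amplitude (c : ℝ) (κ ν : ℂ) (x t : ℝ) : ℝ :=
  ‖ν‖ * Real.exp (-2 * Z c κ x t * (chi c κ).im)

/-- Polar form, where the phases enter: iν = |ν|e^{iθ₁}, χ = |χ|e^{iθ₂}, and φ collects 2 Re g_c +
θ₁ - θ₂. -/
theorem mul_exp_gc (hκ : κ ≠ 0) (hb : 0 < (chi c κ).im) (x t : ℝ) :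
    ν * exp (2 * I * gc c x t κ) = -I * amplitude c κ ν x t
      * (Real.cos (phi c κ ν x t) + Real.sin (phi c κ ν x t) * I) * (chi c κ / ‖chi c κ‖) := by
  have hR : 0 < ‖chi c κ‖ := norm_pos_iff.mpr fun h0 => by simp [h0] at hb
  have h1 : I * ν = ‖ν‖ * exp (theta1 ν * I) := by
    have := norm_mul_exp_arg_mul_I (I * ν)
    rw [norm_mul, norm_I, one_mul] at this
    exact this.symm
  have h2 : chi c κ / ‖chi c κ‖ = exp (theta2 c κ * I) := by
    rw [exp_mul_I, ← ofReal_cos, ← ofReal_sin, cos_theta2, sin_theta2 hb]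
    push_cast
    have hR' : (‖chi c κ‖ : ℂ) ≠ 0 := by exact_mod_cast hR.ne'
    field_simp
    rw [re_add_im]
  have h3 : exp (2 * I * gc c x t κ) = (Real.exp (-2 * Z c κ x t * (chi c κ).im) : ℂ)
      * exp (2 * (gc c x t κ).re * I) := by
    have h4 : 2 * I * gc c x t κ = ((-2 * Z c κ x t * (chi c κ).im : ℝ) : ℂ)
        + 2 * (gc c x t κ).re * I := by
      rw [mul_assoc (-2), ← gc_im_eq_Z hκ]
      nth_rw 1 [← re_add_im (gc c x t κ)]
      push_cast
      linear_combination (2 * ((gc c x t κ).im : ℂ)) * I_sq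
    rw [h4, exp_add, ofReal_exp]
  have h5 : ∀ E : ℂ, ν * E = -I * (I * ν) * E := fun E => by linear_combination (ν * E) * I_sq
  rw [h2, h5, h1, h3, ofReal_cos, ofReal_sin, ← exp_mul_I, amplitude]
  have h6 : exp (theta1 ν * I) * exp (2 * (gc c x t κ).re * I)
      = exp (phi c κ ν x t * I) * exp (theta2 c κ * I) := by
    rw [← exp_add, ← exp_add, ← gc_re_eq_phi hκ]
    congr 1
    push_cast
    ring
  push_cast
  linear_combination (-I * ‖ν‖ * exp (-2 * Z c κ x t * (chi c κ).im)) * h6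

theorem solitonTerm_chi_eq {σ : ℂ} (hκ : κ ≠ 0) (hb : 0 < (chi c κ).im) (x t : ℝ) :
    solitonTerm c σ ν (chi c κ) x t = -I * amplitude c κ ν x t
      * (Real.cos (phi c κ ν x t) + Real.sin (phi c κ ν x t) * I)
      * (c - σ * chi c κ) / (2 * chi c κ * ‖chi c κ‖) := by
  have hχ : chi c κ ≠ 0 := fun h => by simp [h] at hb
  have hR : (‖chi c κ‖ : ℂ) ≠ 0 := by simpa using hχ
  have h1 := mul_exp_gc (ν := ν) hκ hb x t
  have h2 : solitonTerm c σ ν (chi c κ) x t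
      = ν * exp (2 * I * gc c x t κ) * (c - σ * chi c κ) / (2 * chi c κ ^ 2) := by
    rw [gc_eq hκ, solitonTerm, show 2 * I * (chi c κ * (x + 2 * (2 * chi c κ ^ 2 - 3 * c ^ 2) * t))
      = 2 * I * chi c κ * x + 4 * I * chi c κ * (2 * chi c κ ^ 2 - 3 * c ^ 2) * t by ring]
    ring
  rw [h2, h1]
  field_simp

/-- The bridge between the Riemann-Hilbert side and the explicit formula: f and h are the real and
imaginary parts of tau up to a positive factor, so arg tau is arg(f + ih). -/
theorem breatherTau_mul (hκ : κ ≠ 0) (hb : 0 < (chi c κ).im) (hν : ν ≠ 0) (x t : ℝ) :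
    breatherTau c κ ν 1 0 0 x t * ‖chi c κ‖ ^ 2
      = amplitude c κ ν x t * (breatherDen c κ ν x t + breatherNum c κ ν x t * I) := by
  have hR : 0 < ‖chi c κ‖ := norm_pos_iff.mpr fun h0 => by simp [h0] at hb
  have hn : 0 < ‖ν‖ := norm_pos_iff.mpr hν
  have hs0 : 0 < amplitude c κ ν x t := by rw [amplitude]; positivity
  have hR2 := norm_chi_sq c κ
  have hcs := Real.sin_sq_add_cos_sq (phi c κ ν x t)
  have hE : Real.exp (2 * Z c κ x t * (chi c κ).im) = ‖ν‖ / amplitude c κ ν x t := by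
    rw [amplitude, show -2 * Z c κ x t * (chi c κ).im = -(2 * Z c κ x t * (chi c κ).im) by ring,
      Real.exp_neg]
    field_simp
  have hE' : Real.exp (-2 * Z c κ x t * (chi c κ).im) = amplitude c κ ν x t / ‖ν‖ := by
    rw [amplitude]; field_simp
  have h1 := solitonTerm_chi_eq (ν := ν) (σ := 1) hκ hb x t
  have h2 := conj_solitonTerm c (-1) ν (chi c κ) x t
  rw [ofReal_neg, ofReal_one, neg_neg, solitonTerm_chi_eq hκ hb] at h2
  simp only [map_mul, map_div₀, map_sub, map_add, map_neg, map_one, conj_I, map_ofNat,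
    conj_ofReal] at h2
  rw [breatherTau, tauJet, h1, ← h2, breatherDen_eq hκ, breatherNum_eq hκ, hE, hE',
    Real.sin_sub, cos_theta2, sin_theta2 hb]
  have hl : chi c κ = (chi c κ).re + (chi c κ).im * I := (re_add_im _).symm
  have hl' : starRingEnd ℂ (chi c κ) = (chi c κ).re - (chi c κ).im * I := by
    apply Complex.ext <;> simp
  have hχ : chi c κ ≠ 0 := fun h => by simp [h] at hb
  have hχ' : starRingEnd ℂ (chi c κ) ≠ 0 := by simpa using hχ
  have hll : chi c κ * starRingEnd ℂ (chi c κ) = (‖chi c κ‖ : ℂ) ^ 2 := mul_conj' _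
  have hR0 : (‖chi c κ‖ : ℂ) ≠ 0 := by simpa using hχ
  have hb0 : ((chi c κ).im : ℂ) ≠ 0 := by exact_mod_cast hb.ne'
  have hs : (amplitude c κ ν x t : ℂ) ≠ 0 := by exact_mod_cast hs0.ne'
  have hn' : (‖ν‖ : ℂ) ≠ 0 := by exact_mod_cast hn.ne'
  have hcs' : (Real.sin (phi c κ ν x t) : ℂ) ^ 2 + (Real.cos (phi c κ ν x t) : ℂ) ^ 2 = 1 := by
    exact_mod_cast hcs
  push_cast [-ofReal_sin, -ofReal_cos, -ofReal_exp]
  generalize (Real.sin (phi c κ ν x t) : ℂ) = q at *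
  generalize (Real.cos (phi c κ ν x t) : ℂ) = p at *
  generalize (‖chi c κ‖ : ℂ) = R at *
  generalize ((chi c κ).re : ℂ) = a at *
  generalize ((chi c κ).im : ℂ) = b at *
  generalize (amplitude c κ ν x t : ℂ) = s at *
  generalize starRingEnd ℂ (chi c κ) = l' at *
  generalize chi c κ = l at *
  generalize (c : ℂ) = C at *
  clear h1 h2 hE hE' hR2
  have ha : a = (l + l') / 2 := by rw [hl, hl']; ring
  have hb1 : b * I = (l - l') / 2 := by rw [hl, hl']; ring
  have e1 : l - -l' = 2 * a := by rw [hl, hl']; ring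
  have e2 : l + -l' = 2 * b * I := by rw [hl, hl']; ring
  rw [e1, e2]
  have e3 : (2 * a / (2 * b * I)) ^ 2 = - a ^ 2 / b ^ 2 := by
    rw [div_pow, mul_pow, mul_pow (2 * b), I_sq]; field_simp
  rw [e3]
  have e4 : -I * s * (p + q * I) * (C - 1 * l) / (2 * l * R)
      = -I * s * (p + q * I) * (C - l) * l' / (2 * R ^ 3) := by
    rw [show R ^ 3 = R * (l * l') by rw [hll]; ring]; field_simp
  have e5 : - -I * s * (p + q * -I) * (C - -1 * l') / (2 * l' * R)
      = I * s * (p - q * I) * (C + l') * l / (2 * R ^ 3) := by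
    rw [show R ^ 3 = R * (l * l') by rw [hll]; ring]; field_simp; ring
  -- In the interaction term the phases of the two solitons cancel, by cos² + sin² = 1; only the
  -- e^{-2Zχ₂} terms of f and h come from it.
  have e6 : (-I * s * (p + q * I) * (C - l) * l' / (2 * R ^ 3))
      * (I * s * (p - q * I) * (C + l') * l / (2 * R ^ 3))
      = s ^ 2 * (C - l) * (C + l') / (4 * R ^ 4) := by
    rw [div_mul_div_comm, div_eq_div_iff (by simp [hR0]) (by simp [hR0])]
    have : (p + q * I) * (p - q * I) = 1 := by linear_combination hcs' - q ^ 2 * I_sq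
    linear_combination (-I ^ 2 * s ^ 2 * (C - l) * (C + l') * (4 * R ^ 4) * (l * l')) * this
      - I ^ 2 * s ^ 2 * (C - l) * (C + l') * (4 * R ^ 4) * hll
      - s ^ 2 * (C - l) * (C + l') * (4 * R ^ 6) * I_sq
  have e7 : (C - l) * (C + l') = C ^ 2 - 2 * b * I * C - R ^ 2 := by
    linear_combination -hll + 2 * C * hb1
  rw [e4, e5, e6, mul_assoc (s ^ 2), e7, mul_assoc (-I * s * (p + q * I)),
    show (C - l) * l' = C * (a - b * I) - R ^ 2 by rw [← hl']; linear_combination -hll,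
    mul_assoc (I * s * (p - q * I)),
    show (C + l') * l = C * (a + b * I) + R ^ 2 by rw [← hl]; linear_combination hll]
  simp only [pow_zero, one_mul]
  clear e1 e2 e3 e4 e5 e6 e7 hl hl' hll ha hb1 hcs'
  have hI : I ^ 2 = -1 := I_sq
  field_simp
  ring_nf
  simp only [hI]
  ring

theorem amplitude_pos (hν : ν ≠ 0) (x t : ℝ) : 0 < amplitude c κ ν x t :=
  mul_pos (norm_pos_iff.mpr hν) (Real.exp_pos _)

theorem breatherTau_one_ne_zero (hκ : κ ≠ 0) (ha : 0 < (chi c κ).re) (hb : 0 < (chi c κ).im)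
    (hν : ν ≠ 0) (x t : ℝ) : breatherTau c κ ν 1 0 0 x t ≠ 0 := by
  intro h
  have h1 := breatherTau_mul hκ hb hν x t
  rw [h, zero_mul, eq_comm, mul_eq_zero, or_iff_right (by exact_mod_cast (amplitude_pos hν x t).ne')]
    at h1
  have h2 := congrArg re h1
  have h3 := congrArg im h1
  simp at h2 h3
  exact breather_denominator_ne_zero hκ ha hb hν x t (by rw [h2, h3]; ring)

theorem breatherTau_neg_one_ne_zero (hκ : κ ≠ 0) (ha : 0 < (chi c κ).re) (hb : 0 < (chi c κ).im)
    (hν : ν ≠ 0) (x t : ℝ) : breatherTau c κ ν (-1) 0 0 x t ≠ 0 := by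
  rw [← conj_breatherTau]
  simpa using breatherTau_one_ne_zero hκ ha hb hν x t

theorem hasDerivAt_amplitude (c : ℝ) (κ ν : ℂ) (x t : ℝ) :
    HasDerivAt (fun y => amplitude c κ ν y t) (-2 * (chi c κ).im * amplitude c κ ν x t) x := by
  have h := ((((hasDerivAt_Z c κ x t).const_mul (-2)).mul_const (chi c κ).im).exp).const_mul ‖ν‖
  refine h.congr_deriv ?_
  rw [amplitude]; ring

/-- The x-derivative of `breatherTau_mul`, obtained from uniqueness of derivatives instead of a
second algebraic computation. -/
theorem breatherTau_one_zero_mul (hκ : κ ≠ 0) (hb : 0 < (chi c κ).im) (hν : ν ≠ 0) (x t : ℝ) :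
    breatherTau c κ ν 1 1 0 x t * ‖chi c κ‖ ^ 2
      = amplitude c κ ν x t * (breatherDenDeriv c κ ν x t + breatherNumDeriv c κ ν x t * I
        - 2 * (chi c κ).im * (breatherDen c κ ν x t + breatherNum c κ ν x t * I)) := by
  have h1 := (hasDerivAt_tauJet_x c 1 ν (starRingEnd ℂ ν) (chi c κ) (-starRingEnd ℂ (chi c κ))
    0 0 x t).mul_const ((‖chi c κ‖ : ℂ) ^ 2)
  have h2 := (hasDerivAt_amplitude c κ ν x t).ofReal_comp.mul
    ((hasDerivAt_breatherDen (c := c) (ν := ν) hκ x t).ofReal_comp.add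
      ((hasDerivAt_breatherNum (c := c) (ν := ν) hκ x t).ofReal_comp.mul_const I))
  have h3 : (fun y => tauJet c 1 ν (starRingEnd ℂ ν) (chi c κ) (-starRingEnd ℂ (chi c κ)) 0 0 y t
      * (‖chi c κ‖ : ℂ) ^ 2) = fun y => (amplitude c κ ν y t : ℂ)
        * (breatherDen c κ ν y t + breatherNum c κ ν y t * I) :=
    funext fun y => breatherTau_mul hκ hb hν y t
  rw [h3] at h1
  have h4 := h1.unique h2
  rw [breatherTau, h4]
  simp only [Pi.add_apply]
  push_cast
  ring

/-- The positive factor between tau and f + ih adds only the real number -2χ₂ to the logarithmic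
derivative, so the imaginary parts agree. -/
theorem breather_eq_im (hκ : κ ≠ 0) (ha : 0 < (chi c κ).re) (hb : 0 < (chi c κ).im)
    (hν : ν ≠ 0) (x t : ℝ) : breather c κ ν x t
      = c + 2 * (breatherTau c κ ν 1 1 0 x t / breatherTau c κ ν 1 0 0 x t).im := by
  have h1 := breatherTau_mul hκ hb hν x t
  have h2 := breatherTau_one_zero_mul hκ hb hν x t
  have hR : (‖chi c κ‖ : ℂ) ^ 2 ≠ 0 := by
    have : chi c κ ≠ 0 := fun h => by simp [h] at hb
    simpa using this
  have hs : (amplitude c κ ν x t : ℂ) ≠ 0 := by exact_mod_cast (amplitude_pos hν x t).ne'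
  have h3 : breatherTau c κ ν 1 1 0 x t / breatherTau c κ ν 1 0 0 x t
      = (breatherDenDeriv c κ ν x t + breatherNumDeriv c κ ν x t * I)
        / (breatherDen c κ ν x t + breatherNum c κ ν x t * I) - (2 * (chi c κ).im : ℝ) := by
    have h4 := breatherTau_one_ne_zero hκ ha hb hν x t
    have h5 : (breatherDen c κ ν x t + breatherNum c κ ν x t * I : ℂ) ≠ 0 := by
      intro h
      rw [h, mul_zero] at h1
      exact mul_ne_zero h4 hR h1
    rw [← mul_div_mul_right _ _ hR, h1, h2, mul_div_mul_left _ _ hs, sub_div,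
      mul_div_cancel_right₀ _ h5]
    push_cast
    rfl
  rw [breather_eq hκ, h3]
  simp [div_im, normSq_apply]
  ring

theorem breather_eq_tau (hκ : κ ≠ 0) (ha : 0 < (chi c κ).re) (hb : 0 < (chi c κ).im)
    (hν : ν ≠ 0) (x t : ℝ) : (breather c κ ν x t : ℂ)
      = c - I * (breatherTau c κ ν 1 1 0 x t / breatherTau c κ ν 1 0 0 x t
        - breatherTau c κ ν (-1) 1 0 x t / breatherTau c κ ν (-1) 0 0 x t) := by
  rw [breather_eq_im hκ ha hb hν, ← conj_breatherTau, ← conj_breatherTau, ← map_div₀, sub_conj]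
  push_cast
  linear_combination (2 * ((breatherTau c κ ν 1 1 0 x t / breatherTau c κ ν 1 0 0 x t).im : ℂ)) * I_sq

theorem breather_mkdv (hκ : κ ≠ 0) (ha : 0 < (chi c κ).re) (hb : 0 < (chi c κ).im)
    (hν : ν ≠ 0) (x t : ℝ) :
    deriv (fun s => breather c κ ν x s) t
        + 6 * breather c κ ν x t ^ 2 * deriv (fun y => breather c κ ν y t) x
        + iteratedDeriv 3 (fun y => breather c κ ν y t) x = 0 := by
  have h : chi c κ + -starRingEnd ℂ (chi c κ) ≠ 0 := by
    intro h
    have := congrArg im h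
    simp at this
    linarith
  have dx := fun σ m n x t => hasDerivAt_tauJet_x c σ ν (starRingEnd ℂ ν) (chi c κ)
    (-starRingEnd ℂ (chi c κ)) m n x t
  have dt := fun σ m n x t => hasDerivAt_tauJet_t c σ ν (starRingEnd ℂ ν) (chi c κ)
    (-starRingEnd ℂ (chi c κ)) m n x t
  have h1 := fun x t => hirota_one (c := c) (n₁ := ν) (n₂ := starRingEnd ℂ ν) h x t rfl rfl
  have h2 := fun x t => hirota_two (c := c) (n₁ := ν) (n₂ := starRingEnd ℂ ν) h x t rfl rfl
  exact mkdv_of_hirota (F := breatherTau c κ ν 1) (G := breatherTau c κ ν (-1))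
    (dx 1) (dt 1) (dx (-1)) (dt (-1))
    (breatherTau_one_ne_zero hκ ha hb hν) (breatherTau_neg_one_ne_zero hκ ha hb hν)
    h1 h2 (breather_eq_tau hκ ha hb hν) x t

theorem contDiff_breather (hκ : κ ≠ 0) (ha : 0 < (chi c κ).re) (hb : 0 < (chi c κ).im)
    (hν : ν ≠ 0) : ContDiff ℝ ∞ fun p : ℝ × ℝ => breather c κ ν p.1 p.2 :=
  contDiff_of_tau (contDiff_tauJet ..) (contDiff_tauJet ..) (contDiff_tauJet ..)
    (contDiff_tauJet ..) (breatherTau_one_ne_zero hκ ha hb hν)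
    (breatherTau_neg_one_ne_zero hκ ha hb hν) (breather_eq_tau hκ ha hb hν)

theorem theta1_eq_arccos (hν : ν ≠ 0) (h : 0 ≤ ν.re) : theta1 ν = Real.arccos (-ν.im / ‖ν‖) := by
  rw [theta1, arg_of_im_nonneg_of_ne_zero (by simpa using h) (by simpa using hν)]
  simp

theorem exists_isRHSolution (hc : 0 ≤ c) (hκre : 0 < κ.re) (hκim : 0 < κ.im) (hν : ν ≠ 0)
    (x t : ℝ) : ∃ M, IsRHSolution c κ ν x t M ∧ ∀ i j, i ≠ j →
      Tendsto (fun k => k * M k i j) (cobounded ℂ) (𝓝 (-I / 2 * breather c κ ν x t)) := by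
  obtain ⟨ha, hb⟩ : 0 < (chi c κ).re ∧ 0 < (chi c κ).im := sqrtBranch_mem_quadrant hc hκre hκim
  have hκ : κ ≠ 0 := fun h => by simp [h] at hκre
  have hs : κ ∉ slit c := not_mem_slit_of_re_ne_zero hκre.ne'
  have hs' : -starRingEnd ℂ κ ∉ slit c := by rwa [neg_mem_slit, conj_mem_slit]
  have hl : sqrtBranch c (-starRingEnd ℂ κ) = -starRingEnd ℂ (chi c κ) := sqrtBranch_neg_conj hc hs
  have hχ : chi c κ ≠ 0 := fun h => by simp [h] at hb
  have hχ' : -starRingEnd ℂ (chi c κ) ≠ 0 := by simpa using hχ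
  have hκ' : -starRingEnd ℂ κ ≠ 0 := by simpa using hκ
  have hsum : chi c κ + -starRingEnd ℂ (chi c κ) ≠ 0 := by
    intro h
    have := congrArg im h
    simp at this
    linarith
  -- The nonvanishing of tau is exactly the solvability of the linear system for the row with sign
  -- σ.
  have key : ∀ σ : ℂ, σ ^ 2 = 1 → breatherTau c κ ν σ 0 0 x t ≠ 0 → ∃ Y₁ Y₂ : ℂ,
      IsRowSolution c κ (-starRingEnd ℂ κ) (I * ν * exp (2 * I * gc c x t κ))
        (I * starRingEnd ℂ ν * exp (2 * I * gc c x t (-starRingEnd ℂ κ)))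
        (rhRow c σ Y₁ Y₂ (chi c κ) (-starRingEnd ℂ (chi c κ))) ∧
      Y₁ + Y₂ = I * (breatherTau c κ ν σ 1 0 x t / breatherTau c κ ν σ 0 0 x t) := by
    intro σ hσ hτ
    have e₁ := residue_amplitude_eq (n := ν) hσ hκ hχ x t
    have e₂ := residue_amplitude_eq (c := c) (n := starRingEnd ℂ ν) hσ hκ' (by rwa [chi, hl]) x t
    rw [show chi c (-starRingEnd ℂ κ) = _ from hl] at e₂
    have hT := tau_eq_tauJet (c := c) (σ := σ) (n₁ := ν) (n₂ := starRingEnd ℂ ν) hχ hχ' hsum x t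
    have hN := tau_numerator_eq_tauJet hχ hχ' hsum x t e₁ e₂
    rw [← e₁, ← e₂] at hT
    obtain ⟨Y₁, Y₂, h1, h2, h3⟩ := exists_linear_system (hT.trans_ne hτ)
    refine ⟨Y₁, Y₂, ?_, ?_⟩
    · rw [← hl]
      rw [← hl] at h1 h2
      refine rhRow_isRowSolution hc hs hs' ?_ ?_ hσ ?_ ?_ h1 h2
      · intro h
        have := congrArg re h
        simp at this
        linarith
      · intro h
        have := congrArg im h
        simp at this
        linarith
      · simp only [sq, mul_im]
        positivity
      · simp only [sq, mul_im, neg_re, neg_im, conj_re, conj_im]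
        nlinarith [mul_pos hκre hκim]
    · rw [h3, hN, hT, mul_div_assoc]; rfl
  obtain ⟨Y₁, Y₂, h1, h2⟩ := key 1 (by norm_num) (breatherTau_one_ne_zero hκ ha hb hν x t)
  obtain ⟨Y₁', Y₂', h1', h2'⟩ := key (-1) (by norm_num) (breatherTau_neg_one_ne_zero hκ ha hb hν x t)
  have has := tendsto_matrixOfRows_rhRow c Y₁ Y₂ Y₁' Y₂' (chi c κ) (-starRingEnd ℂ (chi c κ))
  refine ⟨_, isRHSolution_matrixOfRows hc hκre.ne' rfl rfl h1 h1' fun i j => ⟨_, has i j⟩,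
    fun i j hij => ?_⟩
  have hq : (c : ℂ) - (Y₁ + Y₂ - (Y₁' + Y₂')) = breather c κ ν x t := by
    rw [breather_eq_tau hκ ha hb hν, h2, h2']; ring
  have := has i j
  rw [hq] at this
  fin_cases i <;> fin_cases j <;> simp at hij this ⊢ <;> exact this

theorem eventually_not_mem_singular (c : ℝ) (κ : ℂ) :
    ∀ᶠ k in cobounded ℂ, k ∈ (slit c ∪ spectralPoints κ)ᶜ := by
  have h : Bornology.IsBounded (slit c ∪ spectralPoints κ) := by
    refine IsBounded.union ?_ (spectralPoints_finite κ).isBounded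
    refine (Metric.isBounded_closedBall (x := (0 : ℂ)) (r := c)).subset fun k hk => ?_
    rw [mem_closedBall_zero_iff]
    calc ‖k‖ ≤ |k.re| + |k.im| := norm_le_abs_re_add_abs_im k
      _ ≤ c := by rw [hk.1, abs_zero, zero_add]; exact hk.2
  exact isBounded_def.mp h

/-- Near infinity an arbitrary solution coincides with the constructed one, by uniqueness. -/
theorem IsRHSolution.tendsto_mul_offDiag (hc : 0 ≤ c) (hκre : 0 < κ.re) (hκim : 0 < κ.im)
    (hν : ν ≠ 0) {x t : ℝ} {M : ℂ → Matrix (Fin 2) (Fin 2) ℂ} (hM : IsRHSolution c κ ν x t M)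
    {i j : Fin 2} (hij : i ≠ j) :
    Tendsto (fun k => 2 * I * (k * M k i j)) (cobounded ℂ) (𝓝 (breather c κ ν x t)) := by
  obtain ⟨M', h1, h2⟩ := exists_isRHSolution hc hκre hκim hν x t
  have h3 := (h2 i j hij).const_mul (2 * I)
  rw [show 2 * I * (-I / 2 * breather c κ ν x t) = (breather c κ ν x t : ℂ) by
    linear_combination -(breather c κ ν x t : ℂ) * I_sq] at h3
  refine h3.congr' ?_
  filter_upwards [eventually_not_mem_singular c κ] with k hk
  rw [IsRHSolution.eqOn hc hκre.ne' hν hM h1 hk]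

end

/-! ### Exponential localization -/

/-- A quotient whose numerator is `O(y + y³)` and whose denominator is bounded below by a multiple
of `(1 + y²)²` is `O(y / (1 + y²))`; the lower bound is given separately near `0` and near `∞`. -/
theorem exists_quotient_bound {A δ K₁ K₂ K₃ : ℝ} (hA : 0 < A) (hδ : 0 < δ) (hK₁ : 0 ≤ K₁)
    (hK₂ : 0 ≤ K₂) (hK₃ : 0 ≤ K₃) : ∃ C : ℝ, 0 ≤ C ∧ ∀ y F H N : ℝ, 0 < y →
      |N| ≤ K₁ * (y + y ^ 2 + y ^ 3) → A - K₂ * (y + y ^ 2) ≤ F →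
      δ * y ^ 3 ≤ (|F| + |H|) * (K₃ * (1 + y)) →
      |N / (F ^ 2 + H ^ 2)| ≤ C * (y / (1 + y ^ 2)) := by
  -- For y ≤ y₀ one has K₂(y + y²) ≤ 2K₂y ≤ A/2, hence F ≥ A/2.
  set y₀ := min 1 (A / (4 * (K₂ + 1))) with hy₀
  have hy₀0 : 0 < y₀ := lt_min one_pos (by positivity)
  -- The first summand serves y ≤ y₀, the second y ≥ y₀, in the bound 1 + y² ≤ L(|F| + |H|).
  set L := 4 / A + (1 / y₀ ^ 2 + 1) * (K₃ / δ * (1 / y₀ + 1)) with hL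
  have hL0 : 0 ≤ L := by positivity
  refine ⟨3 * K₁ * L ^ 2, by positivity, fun y F H N hy hN hF hFH => ?_⟩
  have hS0 : 0 ≤ |F| + |H| := by positivity
  have hS : 1 + y ^ 2 ≤ L * (|F| + |H|) := by
    rcases le_total y y₀ with h | h
    · have h1 : y ≤ 1 := h.trans (min_le_left _ _)
      have h2 : y * (4 * (K₂ + 1)) ≤ A :=
        (le_div_iff₀ (by positivity)).mp (h.trans (min_le_right _ _))
      have h3 : A / 2 ≤ |F| + |H| := by
        have : A / 2 ≤ F := by nlinarith
        linarith [le_abs_self F, abs_nonneg H]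
      calc 1 + y ^ 2 ≤ 2 := by nlinarith
        _ = 4 / A * (A / 2) := by field_simp; norm_num
        _ ≤ L * (|F| + |H|) := by
            refine mul_le_mul ?_ h3 (by positivity) hL0
            rw [hL]
            exact le_add_of_nonneg_right (by positivity)
    · have h1 : 1 / y ≤ 1 / y₀ := one_div_le_one_div_of_le hy₀0 h
      have h2 : y ^ 2 ≤ K₃ / δ * (1 / y₀ + 1) * (|F| + |H|) := by
        calc y ^ 2 = δ * y ^ 3 / (δ * y) := by field_simp
          _ ≤ (|F| + |H|) * (K₃ * (1 + y)) / (δ * y) := by gcongr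
          _ = K₃ / δ * (1 / y + 1) * (|F| + |H|) := by field_simp
          _ ≤ _ := by gcongr
      calc 1 + y ^ 2 = (1 / y ^ 2 + 1) * y ^ 2 := by field_simp
        _ ≤ (1 / y₀ ^ 2 + 1) * (K₃ / δ * (1 / y₀ + 1) * (|F| + |H|)) := by gcongr
        _ ≤ L * (|F| + |H|) := by
            rw [← mul_assoc]
            refine mul_le_mul_of_nonneg_right ?_ hS0
            rw [hL]
            exact le_add_of_nonneg_left (by positivity)
  have hS2 : (1 + y ^ 2) ^ 2 ≤ 2 * L ^ 2 * (F ^ 2 + H ^ 2) := by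
    calc (1 + y ^ 2) ^ 2 ≤ (L * (|F| + |H|)) ^ 2 := by gcongr
      _ ≤ L ^ 2 * (2 * (|F| ^ 2 + |H| ^ 2)) := by
          rw [mul_pow]
          exact mul_le_mul_of_nonneg_left add_sq_le (by positivity)
      _ = _ := by rw [sq_abs, sq_abs]; ring
  have hD : 0 < F ^ 2 + H ^ 2 := by
    by_contra! h
    have : 2 * L ^ 2 * (F ^ 2 + H ^ 2) ≤ 0 := mul_nonpos_of_nonneg_of_nonpos (by positivity) h
    have : 0 < (1 + y ^ 2) ^ 2 := by positivity
    linarith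
  rw [abs_div, abs_of_pos hD, div_le_iff₀ hD]
  calc |N| ≤ K₁ * (y + y ^ 2 + y ^ 3) := hN
    _ ≤ K₁ * (3 / 2 * y * (1 + y ^ 2)) := by
        refine mul_le_mul_of_nonneg_left ?_ hK₁
        nlinarith [mul_nonneg hy.le (sq_nonneg (y - 1))]
    _ = 3 / 2 * K₁ * (y / (1 + y ^ 2)) * (1 + y ^ 2) ^ 2 := by field_simp
    _ ≤ 3 / 2 * K₁ * (y / (1 + y ^ 2)) * (2 * L ^ 2 * (F ^ 2 + H ^ 2)) := by gcongr
    _ = _ := by ring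

theorem abs_mul_le_abs_left {m u : ℝ} (hu : |u| ≤ 1) : |m * u| ≤ |m| := by
  rw [abs_mul]; exact mul_le_of_le_one_right (abs_nonneg m) hu

section

variable {c : ℝ} {κ ν : ℂ}

theorem exists_breather_bound (hc : 0 ≤ c) (hκ : κ ≠ 0) (ha : 0 < (chi c κ).re)
    (hb : 0 < (chi c κ).im) (hν : ν ≠ 0) : ∃ C : ℝ, ∀ x t : ℝ, |breather c κ ν x t - c|
      ≤ C * Real.exp (-2 * (chi c κ).im * |x - speed c κ * t|) := by
  have hR : 0 < ‖chi c κ‖ := norm_pos_iff.mpr fun h0 => by simp [h0] at hb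
  have hn : 0 < ‖ν‖ := norm_pos_iff.mpr hν
  have hden := fun x t => breatherDen_eq (c := c) (ν := ν) hκ x t
  have hnum := fun x t => breatherNum_eq (c := c) (ν := ν) hκ x t
  have hnum' := fun x t => breatherNumDeriv.eq_1 c κ ν x t
  have hden' := fun x t => breatherDenDeriv.eq_1 c κ ν x t
  have hmul := fun x t => breatherDen_mul_eq (c := c) (ν := ν) hκ hb hν x t _ rfl
  set R := ‖chi c κ‖
  set n := ‖ν‖
  set a := (chi c κ).re
  set b := (chi c κ).im
  set A := R ^ 2 / n with hA
  set B := a ^ 2 * (R ^ 2 - c ^ 2) / (4 * R ^ 2 * b ^ 2) * n with hB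
  set D := c * n * a ^ 2 / (2 * R ^ 2 * b) with hD
  set g := c * a ^ 2 / (2 * R ^ 3 * b) + c * b / R ^ 3 with hg
  have hg0 : 0 ≤ g := by positivity
  obtain ⟨C, hC0, hC⟩ := exists_quotient_bound (A := A) (δ := (n * a / (2 * R * b)) ^ 2)
    (K₁ := (|-2 * a * R * A| + |-2 * b * R * A|)
      + (|-4 * b * D * A| + |-2 * a * c * R| + |-2 * a * c * R|)
      + (|-2 * b * c * D| + |-2 * a * R * B| + |2 * b * R * B| + |-2 * a * c * D|))
    (K₂ := |B| + c) (K₃ := n / R ^ 2 + (1 + g * n) / R) (by positivity) (by positivity)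
    (by positivity) (by positivity) (by positivity)
  refine ⟨2 * C, fun x t => ?_⟩
  have hZ := Z_eq c κ x t
  -- Multiplication by y turns f, h and their derivatives into polynomials in y with bounded
  -- coefficients, and leaves the quotient in q - c unchanged.
  set y := Real.exp (-2 * Z c κ x t * b) with hy
  have hy0 : 0 < y := Real.exp_pos _
  have hE : Real.exp (2 * Z c κ x t * b) = 1 / y := by
    rw [hy, one_div, ← Real.exp_neg]; ring_nf
  have hp := Real.abs_cos_le_one (phi c κ ν x t)
  have hq := Real.abs_sin_le_one (phi c κ ν x t)
  have hρ := Real.abs_cos_le_one (phi c κ ν x t - theta2 c κ)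
  have hσ := Real.abs_sin_le_one (phi c κ ν x t - theta2 c κ)
  have e1 := hden x t
  have e2 := hnum x t
  have e3 := hden' x t
  have e4 := hnum' x t
  have e5 := hmul x t
  rw [hE, ← hy] at e1 e3
  rw [← hy] at e2 e4 e5
  clear hden hnum hden' hnum' hmul
  have hq1 := breather_eq (c := c) (ν := ν) hκ x t
  generalize Real.cos (phi c κ ν x t) = p at *
  generalize Real.sin (phi c κ ν x t) = q at *
  generalize Real.cos (phi c κ ν x t - theta2 c κ) = ρ at *
  generalize Real.sin (phi c κ ν x t - theta2 c κ) = σ at *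
  generalize breatherDen c κ ν x t = f at *
  generalize breatherNum c κ ν x t = h at *
  generalize breatherDenDeriv c κ ν x t = f' at *
  generalize breatherNumDeriv c κ ν x t = h' at *
  generalize breather c κ ν x t = Q at *
  clear_value R n a b A B D g y
  have hF : y * f = A + B * y ^ 2 + c * σ * y := by rw [e1]; field_simp
  have hH : y * h = R * p * y + D * y ^ 2 := by rw [e2]; ring
  have hF' : y * f' = 2 * b * A - 2 * b * B * y ^ 2 + 2 * a * c * ρ * y := by
    rw [e3]; field_simp
  have hH' : y * h' = -2 * a * R * q * y - 2 * b * D * y ^ 2 := by rw [e4]; ring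
  -- There is no constant term, since yh and yh' have none, and the y⁴ terms in BD cancel.
  have hN : y * f * (y * h') - y * h * (y * f')
      = (-2 * a * R * A * q + -2 * b * R * A * p) * y
        + (-4 * b * D * A + -2 * a * c * R * (σ * q) + -2 * a * c * R * (p * ρ)) * y ^ 2
        + (-2 * b * c * D * σ + -2 * a * R * B * q + 2 * b * R * B * p + -2 * a * c * D * ρ)
          * y ^ 3 := by
    rw [hF, hH, hF', hH']; ring
  have hσq : |σ * q| ≤ 1 := by rw [abs_mul]; exact mul_le_one₀ hσ (abs_nonneg _) hq
  have hpρ : |p * ρ| ≤ 1 := by rw [abs_mul]; exact mul_le_one₀ hp (abs_nonneg _) hρ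
  have bound := hC y (y * f) (y * h) (y * f * (y * h') - y * h * (y * f')) hy0 ?_ ?_ ?_
  · have hQ : Q - c = 2 * ((y * f * (y * h') - y * h * (y * f')) / ((y * f) ^ 2 + (y * h) ^ 2)) := by
      rw [hq1, show y * f * (y * h') - y * h * (y * f') = y ^ 2 * (f * h' - h * f') by ring,
        show (y * f) ^ 2 + (y * h) ^ 2 = y ^ 2 * (f ^ 2 + h ^ 2) by ring,
        mul_div_mul_left _ _ (by positivity)]
      ring
    -- y/(1 + y²) is at most both y and 1/y, and the smaller of these is e^{-2χ₂|Z|}.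
    have hexp : y / (1 + y ^ 2) ≤ Real.exp (-2 * b * |x - speed c κ * t|) := by
      rw [← hZ]
      rcases le_total 0 (Z c κ x t) with h0 | h0
      · rw [abs_of_nonneg h0, mul_right_comm, ← hy]
        exact div_le_self hy0.le (le_add_of_nonneg_right (sq_nonneg y))
      · rw [abs_of_nonpos h0, show -2 * b * -Z c κ x t = 2 * Z c κ x t * b by ring, hE,
          div_le_div_iff₀ (by positivity) hy0, one_mul, ← sq]
        exact le_add_of_nonneg_left zero_le_one
    rw [hQ, abs_mul, abs_two, mul_assoc 2 C]
    exact mul_le_mul_of_nonneg_left (bound.trans (mul_le_mul_of_nonneg_left hexp hC0)) two_pos.le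
  · rw [hN]
    have k1 := (abs_add_le _ _).trans (add_le_add (abs_mul_le_abs_left (m := -2 * a * R * A) hq)
      (abs_mul_le_abs_left (m := -2 * b * R * A) hp))
    have k2 : |-4 * b * D * A + -2 * a * c * R * (σ * q) + -2 * a * c * R * (p * ρ)|
        ≤ |-4 * b * D * A| + |-2 * a * c * R| + |-2 * a * c * R| :=
      (abs_add_le _ _).trans (add_le_add ((abs_add_le _ _).trans
        (add_le_add le_rfl (abs_mul_le_abs_left hσq))) (abs_mul_le_abs_left hpρ))
    have k3 := (abs_add_le _ _).trans (add_le_add ((abs_add_le _ _).trans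
      (add_le_add ((abs_add_le _ _).trans (add_le_add
        (abs_mul_le_abs_left (m := -2 * b * c * D) hσ)
        (abs_mul_le_abs_left (m := -2 * a * R * B) hq)))
        (abs_mul_le_abs_left (m := 2 * b * R * B) hp)))
      (abs_mul_le_abs_left (m := -2 * a * c * D) hρ))
    rw [mul_add, mul_add]
    refine (abs_add_le _ _).trans (add_le_add ((abs_add_le _ _).trans (add_le_add ?_ ?_)) ?_) 
    all_goals rw [abs_mul]
    · rw [abs_of_pos hy0]
      refine mul_le_mul_of_nonneg_right ?_ hy0.le
      exact k1.trans (by rw [add_assoc]; exact le_add_of_nonneg_right (by positivity))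
    · rw [abs_of_pos (pow_pos hy0 2)]
      refine mul_le_mul_of_nonneg_right ?_ (pow_pos hy0 2).le
      exact k2.trans ((le_add_of_nonneg_left (by positivity)).trans
        (le_add_of_nonneg_right (by positivity)))
    · rw [abs_of_pos (pow_pos hy0 3)]
      refine mul_le_mul_of_nonneg_right ?_ (pow_pos hy0 3).le
      exact k3.trans (le_add_of_nonneg_left (by positivity))
  · rw [hF]
    have k1 : -|B| * y ^ 2 ≤ B * y ^ 2 :=
      mul_le_mul_of_nonneg_right (neg_abs_le B) (by positivity)
    have k2 : -c * y ≤ c * σ * y := by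
      have := mul_le_mul_of_nonneg_left (abs_le.mp hσ).1 hc
      exact mul_le_mul_of_nonneg_right (by linarith only [this]) hy0.le
    have k3 : 0 ≤ |B| * y := by positivity
    have k4 : 0 ≤ c * y ^ 2 := by positivity
    linarith only [k1, k2, k3, k4]
  -- This is y times `breatherDen_mul_eq` with the first square dropped. The leading coefficient B
  -- of yf cannot be used alone, as it vanishes for |χ| = c and is negative for |χ| < c.
  · have k1 : (n * a / (2 * R * b)) ^ 2 * y ^ 3 ≤ n * y / R ^ 2 * (y * f)
        + y * h / R * (-p + g * n * y) := by
      have := mul_le_mul_of_nonneg_left (le_add_of_nonneg_left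
        (a := (n * y * a / (2 * R * b)) ^ 2) (sq_nonneg (q + c * a * (n * y) / (2 * R ^ 3)))) hy0.le
      have e6 : n * y / R ^ 2 * (y * f) = y * (n * y * f / R ^ 2) := by ring
      rw [e6, e5]
      linear_combination this
    have k2 : n * y / R ^ 2 * (y * f) ≤ |y * f| * ((n / R ^ 2 + (1 + g * n) / R) * (1 + y)) := by
      have : n * y / R ^ 2 * (y * f) ≤ n * y / R ^ 2 * |y * f| := by gcongr; exact le_abs_self _
      refine this.trans ?_
      rw [mul_comm]
      gcongr
      have : 0 ≤ n / R ^ 2 + (1 + g * n) / R * (1 + y) := by positivity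
      linear_combination this
    have k3 : y * h / R * (-p + g * n * y)
        ≤ |y * h| * ((n / R ^ 2 + (1 + g * n) / R) * (1 + y)) := by
      have k4 : |-p + g * n * y| ≤ 1 + g * n * y := by
        refine (abs_add_le _ _).trans (add_le_add (by rwa [abs_neg]) ?_)
        rw [abs_of_nonneg (by positivity)]
      calc y * h / R * (-p + g * n * y) ≤ |y * h / R * (-p + g * n * y)| := le_abs_self _
        _ = |y * h| * (|-p + g * n * y| / R) := by rw [abs_mul, abs_div, abs_of_pos hR]; ring
        _ ≤ |y * h| * ((1 + g * n * y) / R) := by gcongr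
        _ ≤ _ := by
          gcongr
          have : 0 ≤ n / R ^ 2 * (1 + y) + (g * n + y) / R := by positivity
          linear_combination this
    rw [add_mul]
    linarith only [k1, k2, k3]

end

end MKdV

/-! ### The main theorem -/

theorem mainTheorem5 (c : ℝ) (hc : 0 ≤ c) (κ ν : ℂ) (hκre : 0 < κ.re) (hκim : 0 < κ.im)
    (hν : ν ≠ 0) :
    -- `χ = √(κ² + c²)` lies in the first quadrant
    (chi c κ ^ 2 = κ ^ 2 + (c : ℂ) ^ 2 ∧ 0 < (chi c κ).re ∧ 0 < (chi c κ).im) ∧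
    -- real and imaginary part of `g_c` at `κ`
    (∀ x t : ℝ,
      (gc c x t κ).re = (chi c κ).re *
        (4 * ((chi c κ).re ^ 2 - 3 * (chi c κ).im ^ 2 - 3 / 2 * c ^ 2) * t + x) ∧
      (gc c x t κ).im = (chi c κ).im *
        (4 * (3 * (chi c κ).re ^ 2 - (chi c κ).im ^ 2 - 3 / 2 * c ^ 2) * t + x)) ∧
    (0 ≤ ν.re → theta1 ν = Real.arccos (-ν.im / ‖ν‖)) ∧
    -- the Riemann-Hilbert problem has exactly one solution
    (∀ x t : ℝ, ∃ M : ℂ → Matrix (Fin 2) (Fin 2) ℂ, IsRHSolution c κ ν x t M) ∧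
    (∀ (x t : ℝ) (M M' : ℂ → Matrix (Fin 2) (Fin 2) ℂ),
      IsRHSolution c κ ν x t M → IsRHSolution c κ ν x t M' →
        Set.EqOn M M' (slit c ∪ spectralPoints κ)ᶜ) ∧
    -- the function obtained from it is the breather
    (∀ (x t : ℝ) (M : ℂ → Matrix (Fin 2) (Fin 2) ℂ), IsRHSolution c κ ν x t M →
      Tendsto (fun k : ℂ => 2 * I * (k * M k 1 0)) (cobounded ℂ)
        (𝓝 (breather c κ ν x t : ℂ)) ∧
      Tendsto (fun k : ℂ => 2 * I * (k * M k 0 1)) (cobounded ℂ)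
        (𝓝 (breather c κ ν x t : ℂ))) ∧
    -- the breather is `c + 2 ∂ₓ arctan (h / f)`
    (∀ x t : ℝ, breatherDen c κ ν x t ^ 2 + breatherNum c κ ν x t ^ 2 ≠ 0) ∧
    (∀ x t : ℝ, breatherDen c κ ν x t ≠ 0 →
      HasDerivAt (fun y => Real.arctan (breatherNum c κ ν y t / breatherDen c κ ν y t))
        ((breather c κ ν x t - c) / 2) x) ∧
    -- it is a smooth solution of the focusing modified Korteweg-de Vries equation
    ContDiff ℝ ∞ (fun p : ℝ × ℝ => breather c κ ν p.1 p.2) ∧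
    (∀ x t : ℝ,
      deriv (fun s => breather c κ ν x s) t
        + 6 * breather c κ ν x t ^ 2 * deriv (fun y => breather c κ ν y t) x
        + iteratedDeriv 3 (fun y => breather c κ ν y t) x = 0) ∧
    -- the same numerator and denominator in the variables `Z` and `φ`
    (∀ x t : ℝ,
      breatherNum c κ ν x t =
        ‖chi c κ‖ * Real.cos (phi c κ ν x t)
          + c * ‖ν‖ * (chi c κ).re ^ 2 / (2 * ‖chi c κ‖ ^ 2 * (chi c κ).im)
            * Real.exp (-2 * Z c κ x t * (chi c κ).im) ∧
      breatherDen c κ ν x t =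
        ‖chi c κ‖ ^ 2 / ‖ν‖ * Real.exp (2 * Z c κ x t * (chi c κ).im)
          + (chi c κ).re ^ 2 * (‖chi c κ‖ ^ 2 - c ^ 2)
            / (4 * ‖chi c κ‖ ^ 2 * (chi c κ).im ^ 2) * ‖ν‖
            * Real.exp (-2 * Z c κ x t * (chi c κ).im)
          + c * Real.sin (phi c κ ν x t - theta2 c κ)) ∧
    -- breather on the constant background `c` with speed `V`: in the frame moving with speed `V`
    -- it is periodic in time, and it is exponentially localized there; it is not constant
    (∀ x t : ℝ, Z c κ x t = x - speed c κ * t) ∧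
    (∀ ξ : ℝ, Function.Periodic (fun t => breather c κ ν (ξ + speed c κ * t) t) (period c κ)) ∧
    (∃ C : ℝ, ∀ x t : ℝ, |breather c κ ν x t - c|
      ≤ C * Real.exp (-2 * (chi c κ).im * |x - speed c κ * t|)) ∧
    (∃ x t : ℝ, breather c κ ν x t ≠ c) := by
  have hκ : κ ≠ 0 := fun h => by simp [h] at hκre
  obtain ⟨ha, hb⟩ : 0 < (chi c κ).re ∧ 0 < (chi c κ).im := sqrtBranch_mem_quadrant hc hκre hκim
  refine ⟨⟨chi_sq hκ, ha, hb⟩, fun x t => ⟨gc_re hκ x t, gc_im hκ x t⟩, theta1_eq_arccos hν,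
    fun x t => (exists_isRHSolution hc hκre hκim hν x t).imp fun _ h => h.1,
    fun x t M M' h h' => h.eqOn hc hκre.ne' hν h',
    fun x t M h => ⟨h.tendsto_mul_offDiag hc hκre hκim hν one_ne_zero,
      h.tendsto_mul_offDiag hc hκre hκim hν zero_ne_one⟩,
    breather_denominator_ne_zero hκ ha hb hν, hasDerivAt_arctan_breather hκ,
    contDiff_breather hκ ha hb hν, breather_mkdv hκ ha hb hν,
    fun x t => ⟨breatherNum_eq hκ x t, breatherDen_eq hκ x t⟩, Z_eq c κ,
    breather_periodic hκ ha, exists_breather_bound hc hκ ha hb hν,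
    exists_breather_ne hκ ha hb hν⟩
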